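/- Let $M$ be a $C^\infty$ manifold (Hausdorff, second countable) of dimension $n=d+1$ with a smooth Lorentzian metric $g$ of signature $(-,+,\dots,+)$ and a time orientation; let $A$ be a smooth one-form on $M$ (electromagnetic potential), $q\in\mathbb R$ (charge) and $m>0$ (mass). On the tangent bundle $\pi:TM\to M$ define the Hamiltonian $H(x,p)=\tfrac12 g_x(p,p)$, the one-form $\Theta_{(x,p)}(X)=g_x(p,\pi_*X)+q\,A_x(\pi_*X)$, the symplectic form $\Omega_s=d\Theta$, the Liouville vector field $L$ by $dH=\Omega_s(\cdot,L)$, and the volume form $\Lambda=\frac{(-1)^{n(n-1)/2}}{n!}\,\Omega_s\wedge\dots\wedge\Omega_s$ ($n$ factors). Let $\Gamma_m^+=\{(x,p)\in TM: g_x(p,p)=-m^2,\ p \text{ future-directed}\}$ be the future mass shell, to which $L$ is tangent; let $\Omega$ be the volume form on $\Gamma_m^+$ obtained by restricting any $(2n-1)$-form $\sigma$ with $dH\wedge\sigma=\Lambda$ on $\{H<0\}$ (for instance $\sigma=i_N\Lambda$, where $N=X/(2H)$ and $X$ generates the rescalings $(x,p)\mapsto(x,e^{t}p)$ of the fibres),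 and let $\omega=i_L\Omega$, a $2d$-form on $\Gamma_m^+$. If $\Sigma\subset\Gamma_m^+$ is a $2d$-dimensional submanifold which is transverse to $L$, then the pull-back of $\omega$ to $\Sigma$ vanishes nowhere; it orients $\Sigma$, and integration against it defines a Borel measure $\mu_\Sigma$ on $\Sigma$. Let $\Sigma_1,\Sigma_2\subset\Gamma_m^+$ be $2d$-dimensional (embedded, smooth) submanifolds, transverse to $L$ at each of their points, such that each maximal integral curve of $L$ in $\Gamma_m^+$ meets $\Sigma_1$ in exactly one point and $\Sigma_2$ in exactly one point. Then the map $\varphi:\Sigma_1\to\Sigma_2$ which sends a point $s$ to the point of $\Sigma_2$ on the integral curve of $L$ through $s$ is a $C^\infty$ diffeomorphism, and for every $C^\infty$ function $f:\Sigma_2\to\mathbb R$ of compact support, $f$ is $\mu_{\Sigma_2}$-integrable, $\varphi^*f=f\circ\varphi$ is $\mu_{\Sigma_1}$-integrable, and $$\int_{\Sigma_2} f\,d\mu_{\Sigma_2}=\int_{\Sigma_1}\varphi^*f\,d\mu_{\Sigma_1}.$$ -/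

import Mathlib

open scoped Manifold ContDiff Topology
open MeasureTheory Set

noncomputable section

namespace Kinetic

/-! ### Exterior algebra and exterior derivative -/

/-- The `n`-fold wedge product `B ∧ ⋯ ∧ B` of an alternating bilinear form `B`, in the
normalization `(α ∧ β)(X, Y) = α(X) β(Y) - α(Y) β(X)` for one-forms. -/
def wedgePow {V : Type*} (B : V → V → ℝ) (n : ℕ) (w : Fin (2 * n) → V) : ℝ :=
  (1 / 2 : ℝ) ^ n * ∑ τ : Equiv.Perm (Fin (2 * n)), ((Equiv.Perm.sign τ : ℤ) : ℝ) *
    ∏ i : Fin n, B (w (τ ⟨2 * i, by omega⟩)) (w (τ ⟨2 * i + 1, by omega⟩))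

/-- The exterior derivative `dθ(X, Y)` at `x` of a one-form `θ` on a manifold without boundary:
write `θ` in the chart around `x`, and apply the exterior derivative of the model space. -/
def extDerivOneForm {E H N : Type*} [NormedAddCommGroup E] [NormedSpace ℝ E]
    [TopologicalSpace H] {I : ModelWithCorners ℝ E H} [I.Boundaryless]
    [TopologicalSpace N] [ChartedSpace H N]
    (θ : ∀ x : N, TangentSpace I x →L[ℝ] ℝ) (x : N) (X Y : TangentSpace I x) : ℝ :=
  extDeriv
    (fun y : E => ContinuousAlternatingMap.ofSubsingleton ℝ E ℝ (0 : Fin 1)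
      ((θ ((extChartAt I x).symm y)).comp (mfderiv 𝓘(ℝ, E) I (extChartAt I x).symm y)))
    (extChartAt I x x)
    ![mfderiv I 𝓘(ℝ, E) (extChartAt I x) x X, mfderiv I 𝓘(ℝ, E) (extChartAt I x) x Y]

/-! ### The measure of a form of top degree -/

section TopForm

variable {k : ℕ} {S : Type*} [TopologicalSpace S] [ChartedSpace (EuclideanSpace ℝ (Fin k)) S]
  [MeasurableSpace S]

/-- The measure `|α(∂₁, …, ∂ₖ)| dy¹⋯dyᵏ` on the domain of a chart `e = (y¹, …, yᵏ)`, regarded as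
a measure on `S` which vanishes outside the domain of `e`. -/
def chartMeasure (α : ∀ s : S, (Fin k → TangentSpace (𝓡 k) s) → ℝ)
    (e : OpenPartialHomeomorph S (EuclideanSpace ℝ (Fin k))) : Measure S :=
  ((volume.restrict e.target).withDensity fun y => ENNReal.ofReal
    |α (e.symm y) fun i => mfderiv (𝓡 k) (𝓡 k) e.symm y
      (EuclideanSpace.single i (1 : ℝ) : EuclideanSpace ℝ (Fin k))|).map e.symm

/-- The measure on the `k`-dimensional manifold `S` given by a `k`-form `α`, that is, integration
of functions against `|α|` (which is `α` if `α` vanishes nowhere and `S` is oriented by `α`).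
By the change of variables formula, the measures in two charts agree on the overlap of the charts;
the measure given by `α` is the one obtained by gluing, i.e. the least measure
that dominates all of them. -/
def formMeasure (α : ∀ s : S, (Fin k → TangentSpace (𝓡 k) s) → ℝ) : Measure S :=
  ⨆ e ∈ IsManifold.maximalAtlas (𝓡 k) ∞ S, chartMeasure α e

end TopForm

/-! ### Integral curves -/

/-- The integral curve of the vector field `X` through `v`, as a set of points: the image of the
maximal integral curve, i.e. all points reached from `v` along integral curves of `X` that are
defined on some open interval. -/
def integralCurveThrough {E H N : Type*} [NormedAddCommGroup E] [NormedSpace ℝ E]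
    [TopologicalSpace H] {I : ModelWithCorners ℝ E H} [TopologicalSpace N] [ChartedSpace H N]
    (X : ∀ x : N, TangentSpace I x) (v : N) : Set N :=
  {w | ∃ (γ : ℝ → N) (a b : ℝ), IsMIntegralCurveOn γ X (Ioo a b) ∧
    ∃ t₀ ∈ Ioo a b, ∃ t₁ ∈ Ioo a b, γ t₀ = v ∧ γ t₁ = w}

/-! ### Spacetimes -/

section Spacetime

variable {d : ℕ} {M : Type*} [TopologicalSpace M]
  [ChartedSpace (EuclideanSpace ℝ (Fin (d + 1))) M]

variable (d M) in
/-- A smooth Lorentz metric, of signature `(-, +, …, +)`, on a manifold of dimension `d + 1`. -/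
structure LorentzMetric [IsManifold (𝓡 (d + 1)) ∞ M] where
  /-- the scalar product on each tangent space -/
  val : ∀ x : M, TangentSpace (𝓡 (d + 1)) x →L[ℝ] TangentSpace (𝓡 (d + 1)) x →L[ℝ] ℝ
  symm : ∀ (x : M) (v w : TangentSpace (𝓡 (d + 1)) x), val x v w = val x w v
  /-- some vector is timelike, and the metric is positive definite on its orthogonal complement -/
  signature : ∀ x : M, ∃ t : TangentSpace (𝓡 (d + 1)) x, val x t t < 0 ∧
    ∀ w : TangentSpace (𝓡 (d + 1)) x, val x t w = 0 → w ≠ 0 → 0 < val x w w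
  contMDiff : ContMDiff (𝓡 (d + 1))
    ((𝓡 (d + 1)).prod 𝓘(ℝ, EuclideanSpace ℝ (Fin (d + 1)) →L[ℝ]
      EuclideanSpace ℝ (Fin (d + 1)) →L[ℝ] ℝ)) ∞
    (fun x => Bundle.TotalSpace.mk' (EuclideanSpace ℝ (Fin (d + 1)) →L[ℝ]
      EuclideanSpace ℝ (Fin (d + 1)) →L[ℝ] ℝ) x (val x))

variable (d M) in
/-- A smooth one-form on `M`. -/
structure OneForm [IsManifold (𝓡 (d + 1)) ∞ M] where
  /-- the covector at each point -/
  val : ∀ x : M, TangentSpace (𝓡 (d + 1)) x →L[ℝ] ℝ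
  contMDiff : ContMDiff (𝓡 (d + 1))
    ((𝓡 (d + 1)).prod 𝓘(ℝ, EuclideanSpace ℝ (Fin (d + 1)) →L[ℝ] ℝ)) ∞
    (fun x => Bundle.TotalSpace.mk' (EuclideanSpace ℝ (Fin (d + 1)) →L[ℝ] ℝ) x (val x))

variable [IsManifold (𝓡 (d + 1)) ∞ M]

/-- A time orientation, given by a continuous timelike vector field that is declared to be
future-directed. -/
structure TimeOrientation (g : LorentzMetric d M) where
  /-- the future-directed timelike vector field -/
  field : ∀ x : M, TangentSpace (𝓡 (d + 1)) x
  continuous_field : Continuous fun x : M => (⟨x, field x⟩ : TangentBundle (𝓡 (d + 1)) M)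
  timelike : ∀ x : M, g.val x (field x) (field x) < 0

/-- The Hamiltonian `H(x, p) = g_x(p, p) / 2` on the tangent bundle. -/
def hamiltonian (g : LorentzMetric d M) (v : TangentBundle (𝓡 (d + 1)) M) : ℝ :=
  g.val v.proj v.snd v.snd / 2

/-- The future mass shell `Γ_m⁺`: all `(x, p)` with `g_x(p, p) = -m²` and `p` future-directed. -/
def futureMassShell (g : LorentzMetric d M) (T : TimeOrientation g) (m : ℝ) :
    Set (TangentBundle (𝓡 (d + 1)) M) :=
  {v | hamiltonian g v = -m ^ 2 / 2 ∧ g.val v.proj (T.field v.proj) v.snd < 0}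

/-- The Poincaré one-form `Θ_{(x, p)}(X) = g_x(p, π_* X) + q A_x(π_* X)`. -/
def poincareForm (g : LorentzMetric d M) (q : ℝ) (A : OneForm d M)
    (v : TangentBundle (𝓡 (d + 1)) M) : TangentSpace (𝓡 (d + 1)).tangent v →L[ℝ] ℝ :=
  (g.val v.proj v.snd + q • A.val v.proj).comp
    (mfderiv (𝓡 (d + 1)).tangent (𝓡 (d + 1))
      (fun w : TangentBundle (𝓡 (d + 1)) M => w.proj) v)

/-- The symplectic form `Ω_s = dΘ`. -/
def symplecticForm (g : LorentzMetric d M) (q : ℝ) (A : OneForm d M)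
    (v : TangentBundle (𝓡 (d + 1)) M) (X Y : TangentSpace (𝓡 (d + 1)).tangent v) : ℝ :=
  extDerivOneForm (poincareForm g q A) v X Y

/-- The Liouville vector field: the Hamiltonian vector field `L` of `H`, that is, the unique
solution of `dH = Ω_s(·, L)`. -/
def liouville (g : LorentzMetric d M) (q : ℝ) (A : OneForm d M)
    (v : TangentBundle (𝓡 (d + 1)) M) : TangentSpace (𝓡 (d + 1)).tangent v :=
  Classical.epsilon fun L : TangentSpace (𝓡 (d + 1)).tangent v =>
    ∀ X : TangentSpace (𝓡 (d + 1)).tangent v,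
      mfderiv (𝓡 (d + 1)).tangent 𝓘(ℝ, ℝ) (hamiltonian g) v X = symplecticForm g q A v X L

/-- The volume form `Λ = (-1)^{n(n-1)/2} / n! · Ω_s ∧ ⋯ ∧ Ω_s` on the tangent bundle, where
`n = d + 1`. -/
def volumeForm (g : LorentzMetric d M) (q : ℝ) (A : OneForm d M)
    (v : TangentBundle (𝓡 (d + 1)) M)
    (w : Fin (2 * (d + 1)) → TangentSpace (𝓡 (d + 1)).tangent v) : ℝ :=
  (-1) ^ ((d + 1) * d / 2) / (Nat.factorial (d + 1) : ℝ) *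
    wedgePow (symplecticForm g q A v) (d + 1) w

/-- The generator `X_{(x, p)}`, at parameter `0`, of the rescaling `(x, p) ↦ (x, e^t p)` of the
fibres. -/
def rescalingField (v : TangentBundle (𝓡 (d + 1)) M) : TangentSpace (𝓡 (d + 1)).tangent v :=
  mfderiv 𝓘(ℝ, ℝ) (𝓡 (d + 1)).tangent
    (fun t : ℝ => (⟨v.proj, Real.exp t • v.snd⟩ : TangentBundle (𝓡 (d + 1)) M)) 0 (1 : ℝ)

/-- The form `σ = i_N Λ`, where `N = X / (2H)` satisfies `dH(N) = 1` on the set `H < 0`; there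
`dH ∧ σ = Λ`. On vectors that are tangent to the mass shell, `σ` is the induced
volume form `Ω` of the mass shell (its value there is the same for every `σ` with
`dH ∧ σ = Λ`). -/
def massShellForm (g : LorentzMetric d M) (q : ℝ) (A : OneForm d M)
    (v : TangentBundle (𝓡 (d + 1)) M)
    (w : Fin (2 * d + 1) → TangentSpace (𝓡 (d + 1)).tangent v) : ℝ :=
  volumeForm g q A v
    (Matrix.vecCons ((2 * hamiltonian g v)⁻¹ • rescalingField v) w)

/-- The form `ω = i_L Ω` of degree `2d` on the mass shell. -/
def fluxForm (g : LorentzMetric d M) (q : ℝ) (A : OneForm d M)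
    (v : TangentBundle (𝓡 (d + 1)) M)
    (w : Fin (2 * d) → TangentSpace (𝓡 (d + 1)).tangent v) : ℝ :=
  massShellForm g q A v (Matrix.vecCons (liouville g q A v) w)

/-! ### Cross sections of the flow in the mass shell -/

section CrossSection

variable {S : Type*} [TopologicalSpace S] [ChartedSpace (EuclideanSpace ℝ (Fin (2 * d))) S]

/-- `ι` embeds `S` as a `2d`-dimensional smooth submanifold of the future mass shell that is
transverse to `L` and met at exactly one point by each integral curve of `L` in the future
mass shell. -/
structure IsCrossSection (g : LorentzMetric d M) (T : TimeOrientation g) (m q : ℝ)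
    (A : OneForm d M) (ι : S → TangentBundle (𝓡 (d + 1)) M) : Prop where
  isSmoothEmbedding :
    Manifold.IsSmoothEmbedding (𝓡 (2 * d)) (𝓡 (d + 1)).tangent ∞ ι
  mem_massShell : ∀ s : S, ι s ∈ futureMassShell g T m
  transverse : ∀ s : S,
    ∀ w : TangentSpace (𝓡 (2 * d)) s,
      mfderiv (𝓡 (2 * d)) (𝓡 (d + 1)).tangent ι s w ≠ liouville g q A (ι s)
  existsUnique : ∀ v ∈ futureMassShell g T m,
    ∃! s : S, ι s ∈ integralCurveThrough (liouville g q A) v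

/-- The measure `μ_Σ` on a submanifold `ι : S → Γ_m⁺` given by the pull-back `ι^* ω`. -/
def inducedMeasure [MeasurableSpace S] (g : LorentzMetric d M) (q : ℝ)
    (A : OneForm d M) (ι : S → TangentBundle (𝓡 (d + 1)) M) : Measure S :=
  formMeasure (k := 2 * d) fun s w => fluxForm g q A (ι s) fun i =>
    mfderiv (𝓡 (2 * d)) (𝓡 (d + 1)).tangent ι s (w i)

end CrossSection

end Spacetime

end Kinetic

end

open scoped Manifold ContDiff Topology
open MeasureTheory Set

noncomputable section

/-! The form `ω` is the restriction of `i_L i_N Λ`, up to the sign fixed by the order of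
contraction, where `Λ` is a constant multiple of the top power of `Ω_s = dΘ` and `dH(N) = 1`. Since
`i_L Ω_s = -dH` and `dΩ_s = 0`, the flow of `L` preserves `Ω_s`; it also preserves `H`, hence `dH`
and `L`. It need not preserve `N`, but it changes `N` only by a vector in `ker dH`. Inserting into
the top-degree form `Λ` a vector of `ker dH` next to `L` and `2d` vectors tangent to the mass shell
gives zero, because these are `2d + 2` vectors in a space of dimension `2d + 1`. So `ω` is invariant
under the flow.

A section is moved onto another one by the flow, for a time that varies from point to point. The
variable time adds multiples of `L` to the tangent vectors, and these are invisible to `i_L`. Hence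
`φ` carries one induced form into the other at every point, and the equality of integrals is the
change of variables formula for `φ`. Stokes' theorem is not used. Compact support of `f` serves only
integrability, through local finiteness of the measure.

Smoothness of `φ` is local. Near a point, the first section is transported by finitely many local
flows along one integral curve until it reaches the second section. There a flow box, given by the
inverse function theorem, supplies smooth hitting times, and uniqueness of the intersection point
identifies the result with `φ`. Smooth dependence of the flow on time and initial point comes from
the implicit function theorem in `C([-1, 1], F)`.

The argument is carried by `exists_contDiffOn_localFlow` (smooth flows), `hamiltonianFlow_invariant`
(invariance of `dΘ` and `dH`), `IsTransported` and `IsHamiltonian.contMDiffAt_and_isTransported`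
(smoothness of `φ` and its differential modulo `L`), `wedgePow_contract_eq` (the linear algebra) and
`map_formMeasure` (passage from forms to measures). What is special to spacetimes is contained in
`isHamiltonian_liouville` and Euler's relation `mfderiv_hamiltonian_rescalingField`. -/

namespace Kinetic

/-! ### Smoothness of superposition operators on spaces of continuous curves. -/

section Nemytskii

universe u
variable {K : Type*} [TopologicalSpace K] [CompactSpace K]
  {F : Type u} [NormedAddCommGroup F] [NormedSpace ℝ F]
  {G : Type u} [NormedAddCommGroup G] [NormedSpace ℝ G]

/-- Pointwise application, as a continuous bilinear map. -/
def pointwiseApply (K : Type*) [TopologicalSpace K] [CompactSpace K]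
    (F G : Type*) [NormedAddCommGroup F] [NormedSpace ℝ F] [NormedAddCommGroup G]
    [NormedSpace ℝ G] : C(K, F →L[ℝ] G) →L[ℝ] C(K, F) →L[ℝ] C(K, G) :=
  LinearMap.mkContinuous₂
    (LinearMap.mk₂ ℝ (fun (a : C(K, F →L[ℝ] G)) (u : C(K, F)) =>
        (⟨fun t => a t (u t), a.continuous.clm_apply u.continuous⟩ : C(K, G)))
      (fun _ _ _ => by ext; simp) (fun _ _ _ => by ext; simp)
      (fun _ _ _ => by ext; simp) (fun _ _ _ => by ext; simp)) 1
    (fun a u => by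
      rw [ContinuousMap.norm_le _ (by positivity)]
      intro t
      rw [one_mul]
      exact (a t).le_of_opNorm_le_of_le (a.norm_coe_le_norm t) (u.norm_coe_le_norm t))

/-- The superposition operator `u ↦ f ∘ u`. -/
def superposition (K : Type*) [TopologicalSpace K] {F G : Type*} [TopologicalSpace F]
    [TopologicalSpace G] (f : C(F, G)) (u : C(K, F)) : C(K, G) := f.comp u

/-- Postcomposition with `f'` is continuous in the sup norm, so for small `h` the derivative `f'`
stays within `ε` of `f' (u t)` on all segments from `u t` to `u t + h t`, uniformly in `t`. The mean
value inequality on each segment then gives the little-o estimate. -/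
lemma hasFDerivAt_superposition {f : C(F, G)} {f' : C(F, F →L[ℝ] G)}
    (hf : ∀ x, HasFDerivAt f (f' x) x) (u : C(K, F)) :
    HasFDerivAt (superposition K f) (pointwiseApply K F G (superposition K f' u)) u := by
  rw [hasFDerivAt_iff_isLittleO_nhds_zero, Asymptotics.isLittleO_iff]
  intro ε hε
  have hcont : Continuous (superposition K f') := ContinuousMap.continuous_postcomp f'
  obtain ⟨δ, hδ, hball⟩ := (Metric.continuousAt_iff (α := C(K, F))
    (β := C(K, F →L[ℝ] G))).1 hcont.continuousAt ε hε
  filter_upwards [Metric.ball_mem_nhds (0 : C(K, F)) hδ] with h hh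
  rw [mem_ball_zero_iff] at hh
  rw [ContinuousMap.norm_le _ (by positivity)]
  intro t
  have key : ‖f (u t + h t) - f (u t) - f' (u t) (u t + h t - u t)‖ ≤ ε * ‖u t + h t - u t‖ := by
    refine Convex.norm_image_sub_le_of_norm_hasFDerivWithin_le' (s := segment ℝ (u t) (u t + h t))
      (f' := fun y => f' y)
      (fun y _ => (hf y).hasFDerivWithinAt) ?_ (convex_segment _ _) (left_mem_segment _ _ _)
      (right_mem_segment _ _ _)
    intro y hy
    rw [segment_eq_image'] at hy
    obtain ⟨r, hr, rfl⟩ := hy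
    have h1 : dist (u + r • h) u < δ := by
      rw [dist_eq_norm, add_sub_cancel_left, norm_smul, Real.norm_of_nonneg hr.1]
      exact lt_of_le_of_lt (mul_le_of_le_one_left (norm_nonneg _) hr.2) hh
    have h2 := (ContinuousMap.dist_apply_le_dist (f := superposition K f' (u + r • h))
      (g := superposition K f' u) t).trans (hball h1).le
    rw [dist_eq_norm] at h2
    simpa [superposition] using h2
  simp only [add_sub_cancel_left] at key
  exact key.trans (mul_le_mul_of_nonneg_left (h.norm_coe_le_norm t) hε.le)

/-- The derivative is again a superposition operator, with values in `F →L[ℝ] G`, so the induction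
runs over all target spaces. A common universe for `F` and `G` keeps this new target admissible. -/
lemma contDiff_superposition_nat (n : ℕ) : ∀ {G : Type u} [NormedAddCommGroup G] [NormedSpace ℝ G]
    (f : C(F, G)), ContDiff ℝ n f → ContDiff ℝ n (superposition K f) := by
  induction n with
  | zero =>
    intro G _ _ f _
    exact contDiff_zero.2 (ContinuousMap.continuous_postcomp f)
  | succ n ih =>
    intro G _ _ f hf
    have hf1 : ContDiff ℝ n (fderiv ℝ f) := hf.fderiv_right le_rfl
    let f' : C(F, F →L[ℝ] G) := ⟨fderiv ℝ f, hf1.continuous⟩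
    have hd : ∀ x, HasFDerivAt f (f' x) x := fun x =>
      (hf.differentiable (by simp) x).hasFDerivAt
    exact_mod_cast contDiff_succ_iff_hasFDerivAt.2
      ⟨fun u => pointwiseApply K F G (superposition K f' u),
      (pointwiseApply K F G).contDiff.comp (ih f' hf1), hasFDerivAt_superposition hd⟩

theorem contDiff_superposition (f : C(F, G)) (hf : ContDiff ℝ ∞ f) :
    ContDiff ℝ ∞ (superposition K f) :=
  contDiff_infty.2 fun n => contDiff_superposition_nat n f (contDiff_infty.1 hf n)

end Nemytskii

/-! ### The integration operator on `C([-1, 1], F)`. -/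

section Primitive

variable {F : Type*} [NormedAddCommGroup F]

/-- Extension of a function on `[-1, 1]` to the line. -/
def extendIcc (u : C(Icc (-1 : ℝ) 1, F)) (r : ℝ) : F := IccExtend (by norm_num) u r

lemma continuous_extendIcc (u : C(Icc (-1 : ℝ) 1, F)) : Continuous (extendIcc u) :=
  u.continuous.Icc_extend'

lemma extendIcc_of_mem (u : C(Icc (-1 : ℝ) 1, F)) (t : Icc (-1 : ℝ) 1) :
    extendIcc u t = u t := IccExtend_val _ _ _

variable [NormedSpace ℝ F] [CompleteSpace F]

/-- The primitive vanishing at `0`, as a continuous linear operator on `C([-1, 1], F)`. -/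
def primitive (F : Type*) [NormedAddCommGroup F] [NormedSpace ℝ F] [CompleteSpace F] :
    C(Icc (-1 : ℝ) 1, F) →L[ℝ] C(Icc (-1 : ℝ) 1, F) :=
  LinearMap.mkContinuous
    { toFun := fun u => ⟨fun t => ∫ r in (0 : ℝ)..t, extendIcc u r,
        (intervalIntegral.continuous_primitive
          (fun _ _ => (continuous_extendIcc u).intervalIntegrable _ _) 0).comp
            continuous_subtype_val⟩
      map_add' := fun u v => by
        ext t
        exact intervalIntegral.integral_add ((continuous_extendIcc u).intervalIntegrable _ _)
          ((continuous_extendIcc v).intervalIntegrable _ _)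
      map_smul' := fun c u => by
        ext t
        exact intervalIntegral.integral_smul _ _ } 1
    (fun u => by
      rw [ContinuousMap.norm_le _ (by positivity)]
      intro t
      have h := intervalIntegral.norm_integral_le_of_norm_le_const (a := 0) (b := (t : ℝ))
        (f := extendIcc u) (C := ‖u‖) (fun r _ => u.norm_coe_le_norm _)
      have ht : |(t : ℝ) - 0| ≤ 1 := by rw [sub_zero]; exact abs_le.2 t.2
      calc _ ≤ _ := h
        _ ≤ ‖u‖ * 1 := by gcongr
        _ = _ := by ring)

end Primitive

/-- For order `∞`, smoothness at the base point alone does not give smoothness of order `∞` at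
nearby points. At a nearby point of the graph the partial derivative is still invertible, so a
second implicit function exists there and is smooth; local uniqueness identifies it with the first.
-/
lemma eventually_contDiffAt_implicitFunction {E₁ E₂ G : Type*}
    [NormedAddCommGroup E₁] [NormedSpace ℝ E₁] [CompleteSpace E₁]
    [NormedAddCommGroup E₂] [NormedSpace ℝ E₂] [CompleteSpace E₂]
    [NormedAddCommGroup G] [NormedSpace ℝ G] [CompleteSpace G]
    {f : E₁ × E₂ → G} (hf : ContDiff ℝ ∞ f) {u : E₁ × E₂} (pn : (∞ : WithTop ℕ∞) ≠ 0)
    (inv : (fderiv ℝ f u ∘L .inr ℝ E₁ E₂).IsInvertible) :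
    ∀ᶠ p in 𝓝 u.1, ContDiffAt ℝ ∞ (hf.contDiffAt.implicitFunction pn inv) p := by
  set ψ := hf.contDiffAt.implicitFunction pn inv with hψ
  have hψu : ψ u.1 = u.2 := hf.contDiffAt.implicitFunction_apply_self pn inv
  have hψc : ContinuousAt ψ u.1 := (hf.contDiffAt.contDiffAt_implicitFunction pn inv).continuousAt
  have hopen : ∀ᶠ v in 𝓝 u, (fderiv ℝ f v ∘L .inr ℝ E₁ E₂).IsInvertible := by
    have hc : Continuous fun v => fderiv ℝ f v ∘L .inr ℝ E₁ E₂ :=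
      (hf.continuous_fderiv (by simp)).clm_comp continuous_const
    exact hc.continuousAt.eventually_mem (ContinuousLinearEquiv.isOpen.mem_nhds inv)
  have hiff := eventually_eventually_nhds.2
    (hf.contDiffAt.eventually_apply_eq_iff_implicitFunction pn inv)
  have hlim : Filter.Tendsto (fun p => (p, ψ p)) (𝓝 u.1) (𝓝 u) := by
    have := continuousAt_id.prodMk hψc
    rw [ContinuousAt, hψu] at this
    exact this
  filter_upwards [hlim.eventually (hopen.and hiff),
    hf.contDiffAt.eventually_apply_implicitFunction pn inv] with p hp hp0
  let ψp := hf.contDiffAt.implicitFunction pn hp.1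
  have hψp : ContDiffAt ℝ ∞ ψp p := hf.contDiffAt.contDiffAt_implicitFunction pn hp.1
  have hψpp : ψp p = ψ p := hf.contDiffAt.implicitFunction_apply_self pn hp.1
  have hlim' : Filter.Tendsto (fun q => (q, ψp q)) (𝓝 p) (𝓝 (p, ψ p)) := by
    have := continuousAt_id.prodMk hψp.continuousAt
    rw [ContinuousAt, hψpp] at this
    exact this
  refine hψp.congr_of_eventuallyEq ?_
  filter_upwards [hlim'.eventually hp.2,
    hf.contDiffAt.eventually_apply_implicitFunction pn hp.1] with q hq hq0
  exact hq.1 (hq0.trans hp0)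

/-! ### Smooth local flows of Lipschitz vector fields. -/

section Flow

universe u
variable {F : Type u} [NormedAddCommGroup F] [NormedSpace ℝ F]

variable (F) in
/-- Constant curves on `[-1, 1]`, as a continuous linear map. -/
def constCurve : F →L[ℝ] C(Icc (-1 : ℝ) 1, F) :=
  LinearMap.mkContinuous
    { toFun := ContinuousMap.const _
      map_add' := fun _ _ => rfl
      map_smul' := fun _ _ => rfl } 1
    (fun x => by
      rw [ContinuousMap.norm_le _ (by positivity)]
      intro t
      rw [one_mul]
      exact le_rfl)

variable [CompleteSpace F]

/-- The map whose zeros are the solutions `u` of `u(t) = x + s ∫₀ᵗ f(u)`. -/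
def integralEquation (f : C(F, F)) (p : (F × ℝ) × C(Icc (-1 : ℝ) 1, F)) :
    C(Icc (-1 : ℝ) 1, F) :=
  p.2 - constCurve F p.1.1
    - p.1.2 • primitive F (superposition (Icc (-1 : ℝ) 1) f p.2)

lemma contDiff_integralEquation {f : C(F, F)} (hf : ContDiff ℝ ∞ f) :
    ContDiff ℝ ∞ (integralEquation f) := by
  unfold integralEquation
  have h1 : ContDiff ℝ ∞ fun p : (F × ℝ) × C(Icc (-1 : ℝ) 1, F) =>
      superposition (Icc (-1 : ℝ) 1) f p.2 :=
    (contDiff_superposition f hf).comp contDiff_snd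
  have h2 := (primitive F).contDiff.comp h1
  exact (contDiff_snd.sub ((constCurve F).contDiff.comp (contDiff_fst.comp contDiff_fst))).sub
    ((contDiff_snd.comp contDiff_fst).smul h2)

/-- At `s = 0` the nonlinear term is switched off. Treating time as a parameter `s` on the fixed
interval `[-1, 1]` thus makes the invertibility hypothesis of the implicit function theorem trivial.
-/
lemma fderiv_integralEquation_comp_inr {f : C(F, F)} (hf : ContDiff ℝ ∞ f) (x : F)
    (u : C(Icc (-1 : ℝ) 1, F)) :
    fderiv ℝ (integralEquation f) ((x, 0), u) ∘L .inr ℝ (F × ℝ) (C(Icc (-1 : ℝ) 1, F)) =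
      ContinuousLinearMap.id ℝ _ := by
  have h1 := ((contDiff_integralEquation hf).differentiable (by simp) ((x, 0), u)).hasFDerivAt
  have h2 : HasFDerivAt (fun v : C(Icc (-1 : ℝ) 1, F) => (((x, 0), v) : (F × ℝ) × _))
      (.inr ℝ (F × ℝ) (C(Icc (-1 : ℝ) 1, F))) u := hasFDerivAt_prodMk_right _ _
  have h3 := h1.comp u h2
  have h4 : integralEquation f ∘ (fun v : C(Icc (-1 : ℝ) 1, F) => (((x, (0 : ℝ)), v) : (F × ℝ) × _))
      = fun v => v - constCurve F x := by
    ext v t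
    simp [integralEquation]
  rw [h4] at h3
  exact h3.unique ((hasFDerivAt_id u).sub_const _)

/-- A zero of the integral equation solves the differential equation. -/
lemma hasDerivAt_of_integralEquation_eq_zero {f : C(F, F)} {x : F} {s : ℝ}
    {u : C(Icc (-1 : ℝ) 1, F)} (h : integralEquation f ((x, s), u) = 0) :
    extendIcc u 0 = x ∧ ∀ t ∈ Ioo (-1 : ℝ) 1, HasDerivAt (extendIcc u) (s • f (extendIcc u t)) t := by
  have key : ∀ t ∈ Icc (-1 : ℝ) 1,
      extendIcc u t = x + s • ∫ r in (0 : ℝ)..t, f (extendIcc u r) := by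
    intro t ht
    have h1 := congrArg (fun v : C(Icc (-1 : ℝ) 1, F) => v ⟨t, ht⟩) h
    simp only [integralEquation, ContinuousMap.sub_apply, ContinuousMap.zero_apply, sub_sub,
      sub_eq_zero] at h1
    rw [extendIcc_of_mem u ⟨t, ht⟩, h1]
    rfl
  refine ⟨by simpa using key 0 (by norm_num), fun t ht => ?_⟩
  have hc : Continuous fun r => f (extendIcc u r) := f.continuous.comp (continuous_extendIcc u)
  have h2 : HasDerivAt (fun t => x + s • ∫ r in (0 : ℝ)..t, f (extendIcc u r))
      (s • f (extendIcc u t)) t :=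
    ((intervalIntegral.integral_hasDerivAt_right (hc.intervalIntegrable _ _)
      (hc.stronglyMeasurableAtFilter _ _) hc.continuousAt).const_smul s).const_add x
  refine h2.congr_of_eventuallyEq ?_
  filter_upwards [Icc_mem_nhds ht.1 ht.2] with r hr using key r hr

/-- The local flow of a globally Lipschitz smooth vector field is jointly smooth. -/
theorem exists_contDiffAt_localFlow_of_lipschitzWith {f : F → F} (hf : ContDiff ℝ ∞ f)
    {k : NNReal} (hk : LipschitzWith k f) (x₀ : F) :
    ∃ ε > 0, ∃ W ∈ 𝓝 x₀, ∃ Φ : ℝ × F → F,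
      (∀ᶠ p in 𝓝 (0, x₀), ContDiffAt ℝ ∞ Φ p) ∧ ∀ x ∈ W, Φ (0, x) = x ∧
      ∀ t ∈ Ioo (-ε) ε, HasDerivAt (fun s => Φ (s, x)) (f (Φ (t, x))) t := by
  let fc : C(F, F) := ⟨f, hf.continuous⟩
  have hfc : ContDiff ℝ ∞ fc := hf
  let p₀ : (F × ℝ) × C(Icc (-1 : ℝ) 1, F) := ((x₀, 0), constCurve F x₀)
  have cdf : ContDiffAt ℝ ∞ (integralEquation fc) p₀ := (contDiff_integralEquation hfc).contDiffAt
  have inv : (fderiv ℝ (integralEquation fc) p₀ ∘L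
      .inr ℝ (F × ℝ) (C(Icc (-1 : ℝ) 1, F))).IsInvertible := by
    rw [fderiv_integralEquation_comp_inr hfc]
    exact ⟨ContinuousLinearEquiv.refl ℝ _, rfl⟩
  have pn : (∞ : WithTop ℕ∞) ≠ 0 := by simp
  let ψ := cdf.implicitFunction pn inv
  have hψ : ∀ᶠ p in 𝓝 (x₀, 0), ContDiffAt ℝ ∞ ψ p :=
    eventually_contDiffAt_implicitFunction (contDiff_integralEquation hfc) pn inv
  have hzero : integralEquation fc p₀ = 0 := by
    ext t
    simp [integralEquation, p₀]
  have hev : ∀ᶠ p in 𝓝 (x₀, (0 : ℝ)), integralEquation fc (p, ψ p) = 0 := by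
    have := cdf.eventually_apply_implicitFunction pn inv
    rw [hzero] at this
    exact this
  rw [nhds_prod_eq] at hev
  obtain ⟨W, hW, V, hV, hWV⟩ := Filter.mem_prod_iff.1 hev
  obtain ⟨δ, hδ, hδV⟩ := Metric.mem_nhds_iff.1 hV
  rw [Real.ball_eq_Ioo, zero_sub, zero_add] at hδV
  have sol : ∀ x ∈ W, ∀ s ∈ Ioo (-δ) δ, integralEquation fc ((x, s), ψ (x, s)) = 0 :=
    fun x hx s hs => hWV (mk_mem_prod hx (hδV hs))
  -- the solutions for different values of `s` are reparametrizations of each other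
  have rescale : ∀ x ∈ W, ∀ s ∈ Ioo (-δ) δ, ∀ t ∈ Icc (-1 : ℝ) 1,
      extendIcc (ψ (x, s * t)) 1 = extendIcc (ψ (x, s)) t := by
    intro x hx s hs t ht
    have hst : s * t ∈ Ioo (-δ) δ := by
      rw [mem_Ioo, ← abs_lt, abs_mul]
      exact lt_of_le_of_lt (mul_le_of_le_one_right (abs_nonneg _) (abs_le.2 ht)) (abs_lt.2 hs)
    obtain ⟨h10, h1⟩ := hasDerivAt_of_integralEquation_eq_zero (sol x hx s hs)
    obtain ⟨h20, h2⟩ := hasDerivAt_of_integralEquation_eq_zero (sol x hx _ hst)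
    -- The global Lipschitz bound enters only here, to compare two solutions of the same equation
    -- with the same initial value.
    have hlip : ∀ r ∈ Ioo (-1 : ℝ) 1, LipschitzOnWith (‖s * t‖₊ * k) (fun y => (s * t) • f y) univ :=
      fun _ _ => ((lipschitzWith_smul (s * t)).comp hk).lipschitzOnWith
    have hd : ∀ r ∈ Ioo (-1 : ℝ) 1, HasDerivAt (fun r => extendIcc (ψ (x, s)) (t * r))
        ((s * t) • f (extendIcc (ψ (x, s)) (t * r))) r := by
      intro r hr
      have htr : t * r ∈ Ioo (-1 : ℝ) 1 := by
        rw [mem_Ioo, ← abs_lt, abs_mul]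
        exact lt_of_le_of_lt (mul_le_of_le_one_left (abs_nonneg _) (abs_le.2 ht)) (abs_lt.2 hr)
      have := (h1 _ htr).scomp r ((hasDerivAt_id r).const_mul t)
      rw [mul_one, smul_smul, mul_comm t s] at this
      exact this
    have := ODE_solution_unique_of_mem_Icc (v := fun _ y => (s * t) • f y) (s := fun _ => univ)
      (K := ‖s * t‖₊ * k) hlip (t₀ := 0) (by norm_num)
      (continuous_extendIcc (ψ (x, s * t))).continuousOn h2 (fun _ _ => trivial)
      ((continuous_extendIcc (ψ (x, s))).comp (continuous_const.mul continuous_id)).continuousOn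
      hd (fun _ _ => trivial) (by simp [h20, h10])
    simpa using this (show (1 : ℝ) ∈ Icc (-1 : ℝ) 1 by norm_num)
  -- The flow at time `t` is the endpoint of the solution with parameter `t`. This is jointly smooth
  -- because `ψ` is. For `|t| < δ / 2` all these endpoints lie on the single curve with parameter `δ
  -- / 2`, by `rescale`, and this yields the differential equation in `t`.
  refine ⟨δ / 2, by positivity, W, hW, fun p => ψ (p.2, p.1) ⟨1, by norm_num⟩, ?_, ?_⟩
  · have hswap : Filter.Tendsto (fun p : ℝ × F => (p.2, p.1)) (𝓝 (0, x₀)) (𝓝 (x₀, 0)) :=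
      (continuous_snd.prodMk continuous_fst).tendsto _
    filter_upwards [hswap.eventually hψ] with p hp
    have h1 : ContDiffAt ℝ ∞ (fun p : ℝ × F => ψ (p.2, p.1)) p :=
      ContDiffAt.comp p hp (contDiff_snd.prodMk contDiff_fst).contDiffAt
    exact (ContinuousMap.evalCLM ℝ (⟨1, by norm_num⟩ : Icc (-1 : ℝ) 1)).contDiff.contDiffAt.comp
      p h1
  · intro x hx
    have hΦ : ∀ s ∈ Icc (-(δ / 2)) (δ / 2), ψ (x, s) ⟨1, by norm_num⟩ =
        extendIcc (ψ (x, δ / 2)) (s / (δ / 2)) := by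
      intro s hs
      rw [← rescale x hx (δ / 2) (by constructor <;> linarith) (s / (δ / 2)),
        mul_div_cancel₀ _ (by positivity), ← extendIcc_of_mem]
      constructor
      · rw [le_div_iff₀ (by positivity)]; linarith [hs.1]
      · rw [div_le_iff₀ (by positivity)]; linarith [hs.2]
    obtain ⟨h10, h1⟩ := hasDerivAt_of_integralEquation_eq_zero
      (sol x hx (δ / 2) (by constructor <;> linarith))
    constructor
    · change ψ (x, 0) _ = x
      rw [hΦ 0 (by constructor <;> linarith), zero_div, h10]
    · intro t ht
      have htr : t / (δ / 2) ∈ Ioo (-1 : ℝ) 1 := by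
        constructor
        · rw [lt_div_iff₀ (by positivity)]; linarith [ht.1]
        · rw [div_lt_iff₀ (by positivity)]; linarith [ht.2]
      have h2 := (h1 _ htr).scomp t ((hasDerivAt_id t).div_const (δ / 2))
      have h3 : (1 / (δ / 2)) • (δ / 2) • fc (extendIcc (ψ (x, δ / 2)) (t / (δ / 2))) =
          f (ψ (x, t) ⟨1, by norm_num⟩) := by
        rw [hΦ t (Ioo_subset_Icc_self ht), smul_smul, one_div_mul_cancel (by positivity), one_smul]
        rfl
      rw [← h3]
      refine h2.congr_of_eventuallyEq ?_
      filter_upwards [Icc_mem_nhds ht.1 ht.2] with r hr using hΦ r hr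

end Flow

/-! ### Local flows of smooth vector fields on open sets. -/

section LocalFlow

variable {F : Type*} [NormedAddCommGroup F] [NormedSpace ℝ F] [FiniteDimensional ℝ F]

/-- The local flow of a smooth vector field is jointly smooth. -/
theorem exists_contDiffOn_localFlow {f : F → F} {U : Set F} (hU : IsOpen U)
    (hf : ContDiffOn ℝ ∞ f U) {x₀ : F} (hx₀ : x₀ ∈ U) :
    ∃ ε > 0, ∃ W, IsOpen W ∧ x₀ ∈ W ∧ ∃ Φ : ℝ × F → F, ContDiffOn ℝ ∞ Φ (Ioo (-ε) ε ×ˢ W) ∧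
      ∀ x ∈ W, Φ (0, x) = x ∧ ∀ t ∈ Ioo (-ε) ε, Φ (t, x) ∈ U ∧
        HasDerivAt (fun s => Φ (s, x)) (f (Φ (t, x))) t := by
  have : CompleteSpace F := FiniteDimensional.complete ℝ F
  obtain ⟨R, hR, hRU⟩ := Metric.nhds_basis_closedBall.mem_iff.1 (hU.mem_nhds hx₀)
  let χ : ContDiffBump x₀ := ⟨R / 2, R, by positivity, by linarith⟩
  -- The cut-off field is smooth with compact support, hence globally Lipschitz, and agrees with `f`
  -- on the closed ball of radius `R / 2`.
  let f₁ : F → F := fun x => χ x • f x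
  have hsupp : tsupport f₁ ⊆ Metric.closedBall x₀ R := by
    refine (closure_mono (Function.support_smul_subset_left _ _)).trans ?_
    rw [← tsupport, χ.tsupport_eq]
  have hf₁ : ContDiff ℝ ∞ f₁ := by
    rw [contDiff_iff_contDiffAt]
    intro x
    by_cases hx : x ∈ U
    · exact χ.contDiff.contDiffAt.smul (hf.contDiffAt (hU.mem_nhds hx))
    · have hx' : x ∉ tsupport f₁ := fun h => hx (hRU (hsupp h))
      exact (contDiffAt_const (c := (0 : F))).congr_of_eventuallyEq
        (notMem_tsupport_iff_eventuallyEq.1 hx')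
  have hcomp : HasCompactSupport f₁ := χ.hasCompactSupport.smul_right
  obtain ⟨k, hk⟩ := hf₁.lipschitzWith_of_hasCompactSupport hcomp (by simp)
  obtain ⟨ε, hε, W, hW, Φ, hΦ, hflow⟩ := exists_contDiffAt_localFlow_of_lipschitzWith hf₁ hk x₀
  have h0 : Φ (0, x₀) = x₀ := (hflow x₀ (mem_of_mem_nhds hW)).1
  -- For short times the trajectories stay where the cut-off equals one, so the flow of `f₁` is a
  -- flow of `f`.
  have h1 : ∀ᶠ p in 𝓝 (0, x₀), Φ p ∈ Metric.ball x₀ (R / 2) := by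
    refine hΦ.self_of_nhds.continuousAt.eventually_mem ?_
    rw [h0]
    exact Metric.ball_mem_nhds _ (by positivity)
  have h2 := h1.and hΦ
  rw [nhds_prod_eq] at h2
  obtain ⟨V, hV, W', hW', hVW⟩ := Filter.mem_prod_iff.1 h2
  obtain ⟨δ, hδ, hδV⟩ := Metric.mem_nhds_iff.1 hV
  rw [Real.ball_eq_Ioo, zero_sub, zero_add] at hδV
  obtain ⟨W'', hW''W, hWo, hWx⟩ := mem_nhds_iff.1 (Filter.inter_mem hW hW')
  have hmin : Ioo (-min ε δ) (min ε δ) ⊆ Ioo (-δ) δ :=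
    Ioo_subset_Ioo (neg_le_neg (min_le_right ε δ)) (min_le_right ε δ)
  refine ⟨min ε δ, lt_min hε hδ, W'', hWo, hWx, Φ, ?_, ?_⟩
  · rintro ⟨t, x⟩ ⟨ht, hx⟩
    exact (hVW (mk_mem_prod (hδV (hmin ht)) (hW''W hx).2)).2.contDiffWithinAt
  · intro x hx
    refine ⟨(hflow x (hW''W hx).1).1, fun t ht => ?_⟩
    have hmem : Φ (t, x) ∈ Metric.ball x₀ (R / 2) :=
      (hVW (mk_mem_prod (hδV (hmin ht)) (hW''W hx).2)).1
    refine ⟨hRU (Metric.ball_subset_closedBall (Metric.ball_subset_ball (by linarith) hmem)), ?_⟩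
    have := (hflow x (hW''W hx).1).2 t
      (Ioo_subset_Ioo (neg_le_neg (min_le_left ε δ)) (min_le_left ε δ) ht)
    have h3 : f₁ (Φ (t, x)) = f (Φ (t, x)) := by
      simp only [f₁]
      rw [χ.one_of_mem_closedBall (Metric.ball_subset_closedBall hmem), one_smul]
    rwa [h3] at this

end LocalFlow

/-! ### Exterior derivatives of one-forms on a normed space. -/

section OneFormDeriv

variable {F : Type*} [NormedAddCommGroup F] [NormedSpace ℝ F]

/-- The exterior derivative of a one-form on a normed space, as a bilinear form. -/
def dOne (θ : F → F →L[ℝ] ℝ) (y : F) : F →L[ℝ] F →L[ℝ] ℝ :=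
  fderiv ℝ θ y - (fderiv ℝ θ y).flip

lemma dOne_apply (θ : F → F →L[ℝ] ℝ) (y a b : F) :
    dOne θ y a b = fderiv ℝ θ y a b - fderiv ℝ θ y b a := rfl

lemma dOne_swap (θ : F → F →L[ℝ] ℝ) (y a b : F) : dOne θ y a b = -dOne θ y b a := by
  simp [dOne_apply]

lemma dOne_self (θ : F → F →L[ℝ] ℝ) (y a : F) : dOne θ y a a = 0 := by
  simp [dOne_apply]

lemma dOne_congr {θ θ' : F → F →L[ℝ] ℝ} {y : F} (h : θ =ᶠ[𝓝 y] θ') : dOne θ y = dOne θ' y := by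
  rw [dOne, dOne, h.fderiv_eq]

lemma extDeriv_ofSubsingleton {θ : F → F →L[ℝ] ℝ} {y : F} (hθ : DifferentiableAt ℝ θ y) (a b : F) :
    extDeriv (fun y => ContinuousAlternatingMap.ofSubsingleton ℝ F ℝ (0 : Fin 1) (θ y)) y ![a, b] =
      dOne θ y a b := by
  have h1 : DifferentiableAt ℝ
      (fun y => ContinuousAlternatingMap.ofSubsingleton ℝ F ℝ (0 : Fin 1) (θ y)) y :=
    (ContinuousAlternatingMap.ofSubsingletonLIE (𝕜 := ℝ) (E := F) (F := ℝ)
      (0 : Fin 1)).toContinuousLinearEquiv.toContinuousLinearMap.differentiableAt.comp y hθ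
  have h2 : ∀ v : F, fderiv ℝ (fun x => θ x v) y = (fderiv ℝ θ y).flip v := by
    intro v
    have h3 := hθ.hasFDerivAt.clm_apply (hasFDerivAt_const v y)
    refine h3.fderiv.trans ?_
    ext c
    simp
  rw [extDeriv_apply h1]
  simp [Fin.sum_univ_succ, dOne_apply, h2, Fin.removeNth, sub_eq_add_neg]

/-- The product rule produces a term with the second derivative of `T`; it is symmetric and cancels
in the antisymmetrization. -/
lemma dOne_pullback {F' : Type*} [NormedAddCommGroup F'] [NormedSpace ℝ F']
    {θ : F → F →L[ℝ] ℝ} {T : F' → F} {x : F'}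
    (hθ : DifferentiableAt ℝ θ (T x)) (hT : ContDiffAt ℝ 2 T x) (a b : F') :
    dOne (fun y => (θ (T y)).comp (fderiv ℝ T y)) x a b =
      dOne θ (T x) (fderiv ℝ T x a) (fderiv ℝ T x b) := by
  have h1 : HasFDerivAt (fun y => θ (T y)) ((fderiv ℝ θ (T x)).comp (fderiv ℝ T x)) x :=
    hθ.hasFDerivAt.comp x (hT.differentiableAt (by simp)).hasFDerivAt
  have h2 : HasFDerivAt (fderiv ℝ T) (fderiv ℝ (fderiv ℝ T) x) x :=
    ((hT.fderiv_right (m := 1) le_rfl).differentiableAt (by simp)).hasFDerivAt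
  have h3 := h1.clm_comp h2
  have hsymm : fderiv ℝ (fderiv ℝ T) x a b = fderiv ℝ (fderiv ℝ T) x b a :=
    (hT.isSymmSndFDerivAt (by simp)) a b
  rw [dOne_apply, dOne_apply, h3.fderiv]
  simp [hsymm]

lemma contDiff_flip :
    ContDiff ℝ ∞ (fun T : F →L[ℝ] F →L[ℝ] ℝ => T.flip) :=
  IsBoundedLinearMap.contDiff ⟨⟨fun _ _ => rfl, fun _ _ => rfl⟩, 1, one_pos, fun T => by
    rw [ContinuousLinearMap.opNorm_flip, one_mul]⟩

lemma minSmoothness_two_le_infty : minSmoothness ℝ 2 ≤ ∞ := by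
  simp only [minSmoothness_of_isRCLikeNormedField]
  exact WithTop.coe_le_coe.2 (le_top : (2 : ℕ∞) ≤ ⊤)

lemma contDiffAt_dOne {θ : F → F →L[ℝ] ℝ} {y : F} (hθ : ContDiffAt ℝ ∞ θ y) :
    ContDiffAt ℝ ∞ (dOne θ) y := by
  have h1 : ContDiffAt ℝ ∞ (fderiv ℝ θ) y := hθ.fderiv_right (by simp)
  exact h1.sub (contDiff_flip.contDiffAt.comp y h1)

/-- The Lie derivative of `dθ` along a vector field `f` with `dH = dθ(·, f)` vanishes. -/
lemma fderiv_dOne_add_eq_zero {θ : F → F →L[ℝ] ℝ} {H : F → ℝ} {f : F → F} {y : F}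
    (hθ : ContDiffAt ℝ ∞ θ y) (hH : ContDiffAt ℝ ∞ H y) (hf : DifferentiableAt ℝ f y)
    (hL : ∀ᶠ z in 𝓝 y, ∀ a, fderiv ℝ H z a = dOne θ z a (f z)) (a b : F) :
    fderiv ℝ (dOne θ) y (f y) a b + dOne θ y (fderiv ℝ f y a) b + dOne θ y a (fderiv ℝ f y b) = 0 := by
  have hB := ((contDiffAt_dOne hθ).differentiableAt (by simp)).hasFDerivAt
  have hθ2 := ((hθ.fderiv_right (m := ∞) (by simp)).differentiableAt (by simp)).hasFDerivAt
  have hH2 := ((hH.fderiv_right (m := ∞) (by simp)).differentiableAt (by simp)).hasFDerivAt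
  have hBform : ∀ c a b, fderiv ℝ (dOne θ) y c a b =
      fderiv ℝ (fderiv ℝ θ) y c a b - fderiv ℝ (fderiv ℝ θ) y c b a := by
    intro c a b
    have h1 := (hB.clm_apply (hasFDerivAt_const a y)).clm_apply (hasFDerivAt_const b y)
    have h2 := ((hθ2.clm_apply (hasFDerivAt_const a y)).clm_apply (hasFDerivAt_const b y)).sub
      ((hθ2.clm_apply (hasFDerivAt_const b y)).clm_apply (hasFDerivAt_const a y))
    have h3 := congrArg (fun T => T c) (h1.unique h2)
    simpa using h3
  have hsθ : ∀ c d, fderiv ℝ (fderiv ℝ θ) y c d = fderiv ℝ (fderiv ℝ θ) y d c :=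
    hθ.isSymmSndFDerivAt minSmoothness_two_le_infty
  have hsH : ∀ c d, fderiv ℝ (fderiv ℝ H) y c d = fderiv ℝ (fderiv ℝ H) y d c :=
    hH.isSymmSndFDerivAt minSmoothness_two_le_infty
  -- The identity `dH(a) = dθ(a, f)` is differentiated in the direction `b`. Comparing this with the
  -- version where `a` and `b` are exchanged uses the symmetry of the Hessian of `H`.
  have hdiff : ∀ a b, fderiv ℝ (fderiv ℝ H) y b a =
      fderiv ℝ (dOne θ) y b a (f y) + dOne θ y a (fderiv ℝ f y b) := by
    intro a b
    have h1 := hH2.clm_apply (hasFDerivAt_const a y)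
    have h2 := (hB.clm_apply (hasFDerivAt_const a y)).clm_apply hf.hasFDerivAt
    have h3 := h2.congr_of_eventuallyEq (f₁ := fun z => fderiv ℝ H z a)
      (hL.mono fun z hz => hz a)
    have h4 := congrArg (fun T => T b) (h1.unique h3)
    simp at h4
    linarith
  have e1 := hdiff a b
  have e2 := hdiff b a
  rw [hsH] at e1
  have e3 := dOne_swap θ y b (fderiv ℝ f y a)
  simp only [hBform] at e1 e2 ⊢
  -- These three symmetries of the second derivative of `θ` amount to `d(dθ) = 0` on `f y`, `a`,
  -- `b`.
  have s1 := congrArg (fun T => T b) (hsθ (f y) a)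
  have s2 := congrArg (fun T => T a) (hsθ (f y) b)
  have s3 := congrArg (fun T => T (f y)) (hsθ a b)
  linarith

end OneFormDeriv

/-! ### Hamiltonian flows in coordinates. -/

section HamiltonianFlow

variable {F : Type*} [NormedAddCommGroup F] [NormedSpace ℝ F]
  {θ : F → F →L[ℝ] ℝ} {H : F → ℝ} {f : F → F} {U W : Set F} {ε : ℝ} {Φ : ℝ × F → F}

lemma fderiv_flow_one_zero {t : ℝ} {x : F} {v : F} (hΦ : DifferentiableAt ℝ Φ (t, x))
    (h : HasDerivAt (fun s => Φ (s, x)) v t) : fderiv ℝ Φ (t, x) (1, 0) = v := by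
  have h1 : HasFDerivAt (fun s : ℝ => (s, x)) (.inl ℝ ℝ F) t := hasFDerivAt_prodMk_left _ _
  have h2 := (hΦ.hasFDerivAt.comp t h1).hasDerivAt
  have h3 := h2.unique h
  simpa using h3

/-- The flow of the Hamiltonian vector field of `H` preserves `dθ` and `dH`. -/
theorem hamiltonianFlow_invariant (hU : IsOpen U) (hθ : ContDiffOn ℝ ∞ θ U)
    (hH : ContDiffOn ℝ ∞ H U) (hf : ContDiffOn ℝ ∞ f U)
    (hL : ∀ z ∈ U, ∀ a, fderiv ℝ H z a = dOne θ z a (f z)) (hε : 0 < ε) (hW : IsOpen W)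
    (hΦ : ContDiffOn ℝ ∞ Φ (Ioo (-ε) ε ×ˢ W))
    (hflow : ∀ x ∈ W, Φ (0, x) = x ∧ ∀ t ∈ Ioo (-ε) ε, Φ (t, x) ∈ U ∧
        HasDerivAt (fun s => Φ (s, x)) (f (Φ (t, x))) t)
    {t : ℝ} (ht : t ∈ Ioo (-ε) ε) {x : F} (hx : x ∈ W) :
    (∀ r a, fderiv ℝ Φ (t, x) (r, a) = r • f (Φ (t, x)) + fderiv ℝ Φ (t, x) (0, a)) ∧
    (∀ a b, dOne θ (Φ (t, x)) (fderiv ℝ Φ (t, x) (0, a)) (fderiv ℝ Φ (t, x) (0, b)) =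
      dOne θ x a b) ∧
    (∀ a, fderiv ℝ H (Φ (t, x)) (fderiv ℝ Φ (t, x) (0, a)) = fderiv ℝ H x a) := by
  have hopen : IsOpen (Ioo (-ε) ε ×ˢ W) := isOpen_Ioo.prod hW
  have hΦat : ∀ s ∈ Ioo (-ε) ε, ∀ z ∈ W, ContDiffAt ℝ ∞ Φ (s, z) := fun s hs z hz =>
    hΦ.contDiffAt (hopen.mem_nhds ⟨hs, hz⟩)
  have hΦd : ∀ s ∈ Ioo (-ε) ε, ∀ z ∈ W, HasFDerivAt Φ (fderiv ℝ Φ (s, z)) (s, z) :=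
    fun s hs z hz => ((hΦat s hs z hz).differentiableAt (by simp)).hasFDerivAt
  have hone : ∀ s ∈ Ioo (-ε) ε, ∀ z ∈ W, fderiv ℝ Φ (s, z) (1, 0) = f (Φ (s, z)) :=
    fun s hs z hz => fderiv_flow_one_zero (hΦd s hs z hz).differentiableAt ((hflow z hz).2 s hs).2
  have h0 : (0 : ℝ) ∈ Ioo (-ε) ε := ⟨by linarith, hε⟩
  have hid : ∀ z ∈ W, ∀ a, fderiv ℝ Φ (0, z) (0, a) = a := by
    intro z hz a
    have h1 : HasFDerivAt (fun y : F => ((0 : ℝ), y)) (.inr ℝ ℝ F) z := hasFDerivAt_prodMk_right _ _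
    have h2 := (hΦd 0 h0 z hz).comp z h1
    have h3 : HasFDerivAt (Φ ∘ fun y : F => ((0 : ℝ), y)) (ContinuousLinearMap.id ℝ F) z :=
      (hasFDerivAt_id z).congr_of_eventuallyEq (by
        filter_upwards [hW.mem_nhds hz] with y hy using (hflow y hy).1)
    simpa using congrArg (fun T => T a) (h2.unique h3)
  -- the variational equation
  have hvar : ∀ a, ∀ s ∈ Ioo (-ε) ε, HasDerivAt (fun s => fderiv ℝ Φ (s, x) (0, a))
      (fderiv ℝ f (Φ (s, x)) (fderiv ℝ Φ (s, x) (0, a))) s := by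
    intro a s hs
    have h2 : HasFDerivAt (fderiv ℝ Φ) (fderiv ℝ (fderiv ℝ Φ) (s, x)) (s, x) :=
      (((hΦat s hs x hx).fderiv_right (m := ∞) (by simp)).differentiableAt (by simp)).hasFDerivAt
    have h1 : HasFDerivAt (fun s : ℝ => (s, x)) (.inl ℝ ℝ F) s := hasFDerivAt_prodMk_left _ _
    have h3 : HasDerivAt (fun s => fderiv ℝ Φ (s, x)) (fderiv ℝ (fderiv ℝ Φ) (s, x) (1, 0)) s :=
      (h2.comp s h1).hasDerivAt
    have h4 := h3.clm_apply (hasDerivAt_const s ((0 : ℝ), a))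
    have hfd : HasFDerivAt f (fderiv ℝ f (Φ (s, x))) (Φ (s, x)) :=
      ((hf.contDiffAt (hU.mem_nhds ((hflow x hx).2 s hs).1)).differentiableAt (by simp)).hasFDerivAt
    have h5 : HasFDerivAt (fun p => f (Φ p)) ((fderiv ℝ f (Φ (s, x))).comp (fderiv ℝ Φ (s, x)))
      (s, x) := hfd.comp (s, x) (hΦd s hs x hx)
    have h6 : HasFDerivAt (fun p => fderiv ℝ Φ p (1, 0))
        ((fderiv ℝ f (Φ (s, x))).comp (fderiv ℝ Φ (s, x))) (s, x) :=
      h5.congr_of_eventuallyEq (by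
        filter_upwards [hopen.mem_nhds (mk_mem_prod hs hx)] with p hp using hone p.1 hp.1 p.2 hp.2)
    have h7 := h2.clm_apply (hasFDerivAt_const ((1 : ℝ), (0 : F)) (s, x))
    have h8 := congrArg (fun T => T ((0 : ℝ), a)) (h7.unique h6)
    -- Symmetry of the second derivative of `Φ` exchanges the time derivative with the derivative in
    -- the initial point.
    have hsymm := (hΦat s hs x hx).isSymmSndFDerivAt minSmoothness_two_le_infty ((1 : ℝ), (0 : F)) ((0 : ℝ), a)
    simp at h8 h4
    rw [← h8, ← hsymm]
    exact h4
  refine ⟨fun r a => ?_, fun a b => ?_, fun a => ?_⟩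
  · have : ((r, a) : ℝ × F) = r • ((1 : ℝ), (0 : F)) + ((0 : ℝ), a) := by simp
    rw [this, map_add, map_smul, hone t ht x hx]
  -- By the variational equation, the time derivative of the pulled back form is the Lie derivative
  -- of `dθ` along `f`, which vanishes. The value at time `0` is `dOne θ x a b` since the spatial
  -- differential is then the identity.
  · have hd : ∀ s ∈ Ioo (-ε) ε, HasDerivAt (fun s => dOne θ (Φ (s, x)) (fderiv ℝ Φ (s, x) (0, a))
        (fderiv ℝ Φ (s, x) (0, b))) 0 s := by
      intro s hs
      have hmem := ((hflow x hx).2 s hs).1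
      have hθs := hθ.contDiffAt (hU.mem_nhds hmem)
      have h1 := ((contDiffAt_dOne hθs).differentiableAt (by simp)).hasFDerivAt.comp_hasDerivAt s
        ((hflow x hx).2 s hs).2
      have h2 := (h1.clm_apply (hvar a s hs)).clm_apply (hvar b s hs)
      refine h2.congr_deriv ?_
      have h3 := fderiv_dOne_add_eq_zero hθs (hH.contDiffAt (hU.mem_nhds hmem))
        ((hf.contDiffAt (hU.mem_nhds hmem)).differentiableAt (by simp))
        (by filter_upwards [hU.mem_nhds hmem] with z hz using hL z hz)
        (fderiv ℝ Φ (s, x) (0, a)) (fderiv ℝ Φ (s, x) (0, b))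
      simpa using h3
    have hc := isOpen_Ioo.is_const_of_deriv_eq_zero isPreconnected_Ioo
      (fun s hs => (hd s hs).differentiableAt.differentiableWithinAt)
      (fun s hs => (hd s hs).deriv) ht h0
    simp only [(hflow x hx).1, hid x hx] at hc
    exact hc
  -- `H` is constant on orbits because `dH(f) = dθ(f, f) = 0`. Differentiating this conservation law
  -- in the initial point gives the invariance of `dH`.
  · have hconst : ∀ z ∈ W, H (Φ (t, z)) = H z := by
      intro z hz
      have hd : ∀ s ∈ Ioo (-ε) ε, HasDerivAt (fun s => H (Φ (s, z))) 0 s := by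
        intro s hs
        have hmem := ((hflow z hz).2 s hs).1
        have h1 := ((hH.contDiffAt (hU.mem_nhds hmem)).differentiableAt
          (by simp)).hasFDerivAt.comp_hasDerivAt s ((hflow z hz).2 s hs).2
        rw [hL _ hmem, dOne_self] at h1
        exact h1
      have hc := isOpen_Ioo.is_const_of_deriv_eq_zero isPreconnected_Ioo
        (fun s hs => (hd s hs).differentiableAt.differentiableWithinAt)
        (fun s hs => (hd s hs).deriv) ht h0
      simpa only [(hflow z hz).1] using hc
    have hmem := ((hflow x hx).2 t ht).1
    have h1 : HasFDerivAt (fun y : F => (t, y)) (.inr ℝ ℝ F) x := hasFDerivAt_prodMk_right _ _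
    have h2 := ((hH.contDiffAt (hU.mem_nhds hmem)).differentiableAt (by simp)).hasFDerivAt.comp x
      ((hΦd t ht x hx).comp x h1)
    have h3 : HasFDerivAt H _ x := h2.congr_of_eventuallyEq (by
      filter_upwards [hW.mem_nhds hx] with y hy using (hconst y hy).symm)
    rw [h3.fderiv]
    simp

/-- The Hamiltonian vector field of a smooth function is smooth. -/
theorem contDiffOn_hamiltonianVectorField [FiniteDimensional ℝ F] (hU : IsOpen U)
    (hθ : ContDiffOn ℝ ∞ θ U) (hH : ContDiffOn ℝ ∞ H U)
    (hnd : ∀ z ∈ U, ∀ b, (∀ a, dOne θ z a b = 0) → b = 0)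
    (hL : ∀ z ∈ U, ∀ a, fderiv ℝ H z a = dOne θ z a (f z)) : ContDiffOn ℝ ∞ f U := by
  have : CompleteSpace F := FiniteDimensional.complete ℝ F
  intro z hz
  have hbij : ∀ z ∈ U, ((dOne θ z).flip).IsInvertible := by
    intro z hz
    have hinj : Function.Injective ((dOne θ z).flip : F →ₗ[ℝ] F →L[ℝ] ℝ) := by
      rw [← LinearMap.ker_eq_bot, LinearMap.ker_eq_bot']
      intro b hb
      refine hnd z hz b fun a => ?_
      exact congrArg (fun T : F →L[ℝ] ℝ => T a) hb
    have hfr : Module.finrank ℝ F = Module.finrank ℝ (F →L[ℝ] ℝ) := by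
      rw [← (LinearMap.toContinuousLinearMap (𝕜 := ℝ) (E := F) (F' := ℝ)).finrank_eq]
      exact (Subspace.dual_finrank_eq (K := ℝ) (V := F)).symm
    exact ⟨(LinearEquiv.ofInjectiveOfFinrankEq _ hinj hfr).toContinuousLinearEquiv, by ext; rfl⟩
  -- The field is recovered from `dH` by inverting the non-degenerate form, and inversion of
  -- operators is smooth.
  have heq : ∀ z ∈ U, f z = (dOne θ z).flip.inverse (fderiv ℝ H z) := by
    intro z hz
    obtain ⟨e, he⟩ := hbij z hz
    have h1 : (dOne θ z).flip (f z) = fderiv ℝ H z := by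
      ext a
      exact (hL z hz a).symm
    rw [← h1, ← he, ContinuousLinearMap.inverse_equiv]
    simp
  obtain ⟨e, he⟩ := hbij z hz
  have h1 : ContDiffAt ℝ ∞ (fun z => (dOne θ z).flip) z :=
    contDiff_flip.contDiffAt.comp z
      (contDiffAt_dOne (hθ.contDiffAt (hU.mem_nhds hz)))
  have h2 : ContDiffAt ℝ ∞ ContinuousLinearMap.inverse (dOne θ z).flip := by
    rw [← he]
    exact contDiffAt_map_inverse e
  have h3 : ContDiffAt ℝ ∞ (ContinuousLinearMap.inverse ∘ fun z => (dOne θ z).flip) z :=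
    h2.comp z h1
  have h4 : ContDiffAt ℝ ∞ (fun z => (dOne θ z).flip.inverse (fderiv ℝ H z)) z :=
    h3.clm_apply ((hH.contDiffAt (hU.mem_nhds hz)).fderiv_right (by simp))
  refine (h4.congr_of_eventuallyEq ?_).contDiffWithinAt
  filter_upwards [hU.mem_nhds hz] with y hy using heq y hy

end HamiltonianFlow

/-! ### One-forms and vector fields in charts of a manifold. -/

section Charts

variable {F : Type*} [NormedAddCommGroup F] [NormedSpace ℝ F]
  {HN : Type*} [TopologicalSpace HN] {I : ModelWithCorners ℝ F HN}
  {N : Type*} [TopologicalSpace N] [ChartedSpace HN N]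

/-- A one-form in the chart around `x`. -/
def chartForm (θ : ∀ x : N, TangentSpace I x →L[ℝ] ℝ) (x : N) (y : F) : F →L[ℝ] ℝ :=
  (θ ((extChartAt I x).symm y)).comp (mfderiv 𝓘(ℝ, F) I (extChartAt I x).symm y)

/-- A vector field in the chart around `x`. -/
def chartField (L : ∀ x : N, TangentSpace I x) (x : N) (y : F) : F :=
  mfderiv I 𝓘(ℝ, F) (extChartAt I x) ((extChartAt I x).symm y) (L ((extChartAt I x).symm y))

lemma chartForm_apply {θ : ∀ x : N, TangentSpace I x →L[ℝ] ℝ} {x p : N} {y : F}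
    (h : (extChartAt I x).symm y = p) (a : F) :
    chartForm θ x y a = θ p (mfderiv 𝓘(ℝ, F) I (extChartAt I x).symm y a) := by
  subst h
  rfl

lemma chartField_extChartAt {L : ∀ x : N, TangentSpace I x} {x p : N}
    (hp : p ∈ (extChartAt I x).source) :
    chartField L x (extChartAt I x p) = mfderiv I 𝓘(ℝ, F) (extChartAt I x) p (L p) := by
  have h : ∀ q, q = p → mfderiv I 𝓘(ℝ, F) (extChartAt I x) q (L q) =
      mfderiv I 𝓘(ℝ, F) (extChartAt I x) p (L p) := by
    rintro q rfl
    rfl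
  exact h _ ((extChartAt I x).left_inv hp)

variable [IsManifold I ∞ N]

lemma contMDiffAt_extChartAt_of_mem {x v : N} (hv : v ∈ (extChartAt I x).source) :
    ContMDiffAt I 𝓘(ℝ, F) ∞ (extChartAt I x) v :=
  contMDiffAt_extChartAt' (by rwa [extChartAt_source] at hv)

lemma mdifferentiableAt_extChartAt_of_mem {x v : N} (hv : v ∈ (extChartAt I x).source) :
    MDifferentiableAt I 𝓘(ℝ, F) (extChartAt I x) v :=
  (contMDiffAt_extChartAt_of_mem hv).mdifferentiableAt (by simp)

variable [I.Boundaryless]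

lemma contMDiffAt_extChartAt_symm_of_mem {x : N} {y : F} (hy : y ∈ (extChartAt I x).target) :
    ContMDiffAt 𝓘(ℝ, F) I ∞ (extChartAt I x).symm y :=
  (contMDiffOn_extChartAt_symm x).contMDiffAt ((isOpen_extChartAt_target x).mem_nhds hy)

lemma mdifferentiableAt_extChartAt_symm_of_mem {x : N} {y : F}
    (hy : y ∈ (extChartAt I x).target) :
    MDifferentiableAt 𝓘(ℝ, F) I (extChartAt I x).symm y :=
  (contMDiffAt_extChartAt_symm_of_mem hy).mdifferentiableAt (by simp)

lemma mfderiv_extChartAt_symm_mfderiv {x v : N} (hv : v ∈ (extChartAt I x).source)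
    (a : TangentSpace I v) :
    mfderiv 𝓘(ℝ, F) I (extChartAt I x).symm (extChartAt I x v)
      (mfderiv I 𝓘(ℝ, F) (extChartAt I x) v a) = a := by
  have h1 := (mdifferentiableAt_extChartAt_symm_of_mem
    ((extChartAt I x).map_source hv)).hasMFDerivAt.comp v
    (mdifferentiableAt_extChartAt_of_mem hv).hasMFDerivAt
  have h2 : HasMFDerivAt I I ((extChartAt I x).symm ∘ extChartAt I x) v
      (ContinuousLinearMap.id ℝ (TangentSpace I v)) :=
    (hasMFDerivAt_id v).congr_of_eventuallyEq (by
      filter_upwards [(isOpen_extChartAt_source x).mem_nhds hv] with w hw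
        using (extChartAt I x).left_inv hw)
  exact congrArg (fun T : F →L[ℝ] F => T a) (hasMFDerivAt_unique h1 h2)

lemma mfderiv_extChartAt_mfderiv_symm {x v : N} (hv : v ∈ (extChartAt I x).source) (b : F) :
    mfderiv I 𝓘(ℝ, F) (extChartAt I x) v
      (mfderiv 𝓘(ℝ, F) I (extChartAt I x).symm (extChartAt I x v) b) = b := by
  have hy := (extChartAt I x).map_source hv
  have hv' : v = (extChartAt I x).symm (extChartAt I x v) := ((extChartAt I x).left_inv hv).symm
  have h0 := (mdifferentiableAt_extChartAt_of_mem hv).hasMFDerivAt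
  have h1 := HasMFDerivAt.comp (f := (extChartAt I x).symm) (extChartAt I x v) (by rwa [← hv'])
    (mdifferentiableAt_extChartAt_symm_of_mem hy).hasMFDerivAt
  have h2 : HasMFDerivAt 𝓘(ℝ, F) 𝓘(ℝ, F) (extChartAt I x ∘ (extChartAt I x).symm)
      (extChartAt I x v) (ContinuousLinearMap.id ℝ F) :=
    (hasMFDerivAt_id (extChartAt I x v)).congr_of_eventuallyEq (by
      filter_upwards [(isOpen_extChartAt_target x).mem_nhds hy] with w hw
        using (extChartAt I x).right_inv hw)
  exact congrArg (fun T : F →L[ℝ] F => T b) (hasMFDerivAt_unique h1 h2)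

/-- The exterior derivative of a one-form may be computed in any chart. -/
theorem extDerivOneForm_eq_dOne {θ : ∀ x : N, TangentSpace I x →L[ℝ] ℝ}
    (hθ : ∀ x : N, ContDiffOn ℝ ∞ (chartForm θ x) (extChartAt I x).target) {x v : N}
    (hv : v ∈ (extChartAt I x).source) (a b : TangentSpace I v) :
    extDerivOneForm θ v a b = dOne (chartForm θ x) (extChartAt I x v)
      (mfderiv I 𝓘(ℝ, F) (extChartAt I x) v a) (mfderiv I 𝓘(ℝ, F) (extChartAt I x) v b) := by
  have hvv := mem_extChartAt_source (I := I) v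
  have hyv := (extChartAt I v).map_source hvv
  have hyx := (extChartAt I x).map_source hv
  set T : F → F := extChartAt I x ∘ (extChartAt I v).symm with hT
  have hTv : T (extChartAt I v v) = extChartAt I x v := by simp [hT]
  have hmem : ∀ᶠ y in 𝓝 (extChartAt I v v), y ∈ (extChartAt I v).target ∧
      (extChartAt I v).symm y ∈ (extChartAt I x).source := by
    refine Filter.Eventually.and ((isOpen_extChartAt_target v).mem_nhds hyv) ?_
    refine (contMDiffAt_extChartAt_symm_of_mem hyv).continuousAt.eventually_mem ?_
    rw [(extChartAt I v).left_inv hvv]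
    exact (isOpen_extChartAt_source x).mem_nhds hv
  have hTsm : ContDiffAt ℝ ∞ T (extChartAt I v v) := by
    rw [← contMDiffAt_iff_contDiffAt]
    exact ContMDiffAt.comp _ (contMDiffAt_extChartAt_of_mem hmem.self_of_nhds.2)
      (contMDiffAt_extChartAt_symm_of_mem hyv)
  have hTd : ∀ y, y ∈ (extChartAt I v).target → (extChartAt I v).symm y ∈ (extChartAt I x).source →
      fderiv ℝ T y = (mfderiv I 𝓘(ℝ, F) (extChartAt I x) ((extChartAt I v).symm y)).comp
        (mfderiv 𝓘(ℝ, F) I (extChartAt I v).symm y) := by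
    intro y hy hyx
    rw [← mfderiv_eq_fderiv]
    exact mfderiv_comp _ (mdifferentiableAt_extChartAt_of_mem hyx)
      (mdifferentiableAt_extChartAt_symm_of_mem hy)
  -- `extDerivOneForm` at `v` uses the chart around `v`. In it the one-form is the pull-back, by the
  -- transition map `T`, of its expression in the chart around `x`, so `dOne_pullback` applies.
  have heq : chartForm θ v =ᶠ[𝓝 (extChartAt I v v)]
      fun y => (chartForm θ x (T y)).comp (fderiv ℝ T y) := by
    filter_upwards [hmem] with y hy
    ext c
    rw [ContinuousLinearMap.comp_apply, hTd y hy.1 hy.2]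
    refine (chartForm_apply rfl c).trans (Eq.trans ?_
      (chartForm_apply (p := (extChartAt I v).symm y) ((extChartAt I x).left_inv hy.2) _).symm)
    exact congrArg (θ ((extChartAt I v).symm y)) (mfderiv_extChartAt_symm_mfderiv hy.2 _).symm
  have hd : ∀ w, v ∈ (extChartAt I w).source → DifferentiableAt ℝ (chartForm θ w) (extChartAt I w v) :=
    fun w hw => ((hθ w).contDiffAt ((isOpen_extChartAt_target w).mem_nhds
      ((extChartAt I w).map_source hw))).differentiableAt (by simp)
  have h1 : extDerivOneForm θ v a b = dOne (chartForm θ v) (extChartAt I v v)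
      (mfderiv I 𝓘(ℝ, F) (extChartAt I v) v a) (mfderiv I 𝓘(ℝ, F) (extChartAt I v) v b) :=
    extDeriv_ofSubsingleton (hd v hvv) _ _
  have h2 : ∀ c : TangentSpace I v, fderiv ℝ T (extChartAt I v v)
      (mfderiv I 𝓘(ℝ, F) (extChartAt I v) v c) = mfderiv I 𝓘(ℝ, F) (extChartAt I x) v c := by
    intro c
    have h3 : HasMFDerivAt 𝓘(ℝ, F) 𝓘(ℝ, F) T (extChartAt I v v)
        (fderiv ℝ T (extChartAt I v v)) :=
      (hTsm.differentiableAt (by simp)).hasFDerivAt.hasMFDerivAt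
    have h4 := h3.comp v (mdifferentiableAt_extChartAt_of_mem hvv).hasMFDerivAt
    have h5 : HasMFDerivAt I 𝓘(ℝ, F) (T ∘ extChartAt I v) v
        (mfderiv I 𝓘(ℝ, F) (extChartAt I x) v) :=
      (mdifferentiableAt_extChartAt_of_mem hv).hasMFDerivAt.congr_of_eventuallyEq (by
        filter_upwards [(isOpen_extChartAt_source v).mem_nhds hvv] with w hw
        simp only [hT, Function.comp_apply]
        rw [(extChartAt I v).left_inv hw])
    exact congrArg (fun T : F →L[ℝ] F => T c) (hasMFDerivAt_unique h4 h5)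
  have h6 := dOne_pullback (θ := chartForm θ x) (T := T) (x := extChartAt I v v)
    (by rw [hTv]; exact hd x hv)
    (hTsm.of_le (WithTop.coe_le_coe.2 (le_top : (2 : ℕ∞) ≤ ⊤)))
    (mfderiv I 𝓘(ℝ, F) (extChartAt I v) v a) (mfderiv I 𝓘(ℝ, F) (extChartAt I v) v b)
  rw [← dOne_congr heq, hTv] at h6
  refine (h1.trans h6).trans ?_
  exact congr (congrArg (fun c => ⇑(dOne (chartForm θ x) (extChartAt I x v) c)) (h2 a)) (h2 b)

end Charts

/-- The target carries the model `𝓘(ℝ, E₁ × E₂)` and not a product of models, so that the pairing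
can be followed by a map that is differentiable on the normed space `E₁ × E₂`. -/
lemma hasMFDerivAt_prodMk_space {E₀ E₁ E₂ H₀ M₀ : Type*}
    [NormedAddCommGroup E₀] [NormedSpace ℝ E₀] [NormedAddCommGroup E₁] [NormedSpace ℝ E₁]
    [NormedAddCommGroup E₂] [NormedSpace ℝ E₂] [TopologicalSpace H₀] {I₀ : ModelWithCorners ℝ E₀ H₀}
    [TopologicalSpace M₀] [ChartedSpace H₀ M₀] {f : M₀ → E₁} {g : M₀ → E₂} {x : M₀}
    {df : TangentSpace I₀ x →L[ℝ] E₁} {dg : TangentSpace I₀ x →L[ℝ] E₂}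
    (hf : HasMFDerivAt I₀ 𝓘(ℝ, E₁) f x df) (hg : HasMFDerivAt I₀ 𝓘(ℝ, E₂) g x dg) :
    HasMFDerivAt I₀ 𝓘(ℝ, E₁ × E₂) (fun y => (f y, g y)) x (df.prod dg) :=
  ⟨hf.1.prodMk hg.1, hf.2.prodMk hg.2⟩

/-! ### Hamiltonian vector fields and their local flows on manifolds. -/

section Hamiltonian

variable {F : Type*} [NormedAddCommGroup F] [NormedSpace ℝ F]
  {HN : Type*} [TopologicalSpace HN] {I : ModelWithCorners ℝ F HN}
  {N : Type*} [TopologicalSpace N] [ChartedSpace HN N]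

variable [I.Boundaryless]

/-- `L` is the Hamiltonian vector field of `H` with respect to the exact symplectic form `dθ`. -/
structure IsHamiltonian (θ : ∀ x : N, TangentSpace I x →L[ℝ] ℝ) (H : N → ℝ)
    (L : ∀ x : N, TangentSpace I x) : Prop where
  contDiffOn_form : ∀ x : N, ContDiffOn ℝ ∞ (chartForm θ x) (extChartAt I x).target
  contMDiff_ham : ContMDiff I 𝓘(ℝ, ℝ) ∞ H
  nondegenerate : ∀ (x : N) (b : TangentSpace I x), (∀ a, extDerivOneForm θ x a b = 0) → b = 0
  ham_eq : ∀ (x : N) (a : TangentSpace I x),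
    mfderiv I 𝓘(ℝ, ℝ) H x a = extDerivOneForm θ x a (L x)

/-- `Φ` is a local flow, defined for `|t| < ε` on the open set `W`, by maps that preserve the
symplectic form and the Hamiltonian. -/
structure IsLocalFlow (θ : ∀ x : N, TangentSpace I x →L[ℝ] ℝ) (H : N → ℝ)
    (L : ∀ x : N, TangentSpace I x) (Φ : ℝ → N → N) (ε : ℝ) (W : Set N) : Prop where
  pos : 0 < ε
  isOpen : IsOpen W
  map_zero : ∀ z ∈ W, Φ 0 z = z
  curve : ∀ z ∈ W, IsMIntegralCurveOn (fun t => Φ t z) L (Ioo (-ε) ε)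
  contMDiffAt : ∀ t ∈ Ioo (-ε) ε, ∀ z ∈ W,
    ContMDiffAt (𝓘(ℝ, ℝ).prod I) I ∞ (fun p : ℝ × N => Φ p.1 p.2) (t, z)
  deriv : ∀ t ∈ Ioo (-ε) ε, ∀ z ∈ W, ∃ A : TangentSpace I z →L[ℝ] TangentSpace I (Φ t z),
    (∀ (r : ℝ) (a : TangentSpace I z),
      mfderiv (𝓘(ℝ, ℝ).prod I) I (fun p : ℝ × N => Φ p.1 p.2) (t, z) (r, a) =
        r • L (Φ t z) + A a) ∧
    (∀ a b, extDerivOneForm θ (Φ t z) (A a) (A b) = extDerivOneForm θ z a b) ∧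
    ∀ a, mfderiv I 𝓘(ℝ, ℝ) H (Φ t z) (A a) = mfderiv I 𝓘(ℝ, ℝ) H z a

namespace IsHamiltonian

variable {θ : ∀ x : N, TangentSpace I x →L[ℝ] ℝ} {H : N → ℝ}
    {L : ∀ x : N, TangentSpace I x}

lemma mdifferentiableAt_ham (h : IsHamiltonian θ H L) (x : N) : MDifferentiableAt I 𝓘(ℝ, ℝ) H x :=
  (h.contMDiff_ham x).mdifferentiableAt (by simp)

variable [IsManifold I ∞ N]

lemma extDerivOneForm_self (h : IsHamiltonian θ H L) (x : N) (a : TangentSpace I x) :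
    extDerivOneForm θ x a a = 0 :=
  (extDerivOneForm_eq_dOne h.contDiffOn_form (mem_extChartAt_source x) a a).trans (dOne_self _ _ _)

lemma mfderiv_ham_field (h : IsHamiltonian θ H L) (x : N) : mfderiv I 𝓘(ℝ, ℝ) H x (L x) = 0 :=
  (h.ham_eq x _).trans (h.extDerivOneForm_self x _)

lemma contDiffOn_chartHam (h : IsHamiltonian θ H L) (x : N) :
    ContDiffOn ℝ ∞ (H ∘ (extChartAt I x).symm) (extChartAt I x).target := by
  rw [← contMDiffOn_iff_contDiffOn]
  exact h.contMDiff_ham.comp_contMDiffOn (contMDiffOn_extChartAt_symm x)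

lemma fderiv_chartHam (h : IsHamiltonian θ H L) (x : N) {y : F} (hy : y ∈ (extChartAt I x).target)
    (a : F) : fderiv ℝ (H ∘ (extChartAt I x).symm) y a =
      mfderiv I 𝓘(ℝ, ℝ) H ((extChartAt I x).symm y)
        (mfderiv 𝓘(ℝ, F) I (extChartAt I x).symm y a) := by
  rw [← mfderiv_eq_fderiv, mfderiv_comp _ (h.mdifferentiableAt_ham _)
    (mdifferentiableAt_extChartAt_symm_of_mem hy)]
  rfl

lemma fderiv_chartHam_mfderiv (h : IsHamiltonian θ H L) (x : N) {v : N}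
    (hv : v ∈ (extChartAt I x).source) (a : TangentSpace I v) :
    fderiv ℝ (H ∘ (extChartAt I x).symm) (extChartAt I x v)
      (mfderiv I 𝓘(ℝ, F) (extChartAt I x) v a) = mfderiv I 𝓘(ℝ, ℝ) H v a := by
  have h1 := ((h.contDiffOn_chartHam x).contDiffAt ((isOpen_extChartAt_target x).mem_nhds
    ((extChartAt I x).map_source hv))).differentiableAt (by simp)
  have h2 := h1.hasFDerivAt.hasMFDerivAt.comp v (mdifferentiableAt_extChartAt_of_mem hv).hasMFDerivAt
  have h3 := (h.mdifferentiableAt_ham v).hasMFDerivAt.congr_of_eventuallyEq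
    (f₁ := (H ∘ (extChartAt I x).symm) ∘ extChartAt I x) (by
      filter_upwards [(isOpen_extChartAt_source x).mem_nhds hv] with w hw
      simp only [Function.comp_apply]
      rw [(extChartAt I x).left_inv hw])
  exact congrArg (fun T : F →L[ℝ] ℝ => T a) (hasMFDerivAt_unique h2 h3)

lemma extDerivOneForm_mfderiv_symm (h : IsHamiltonian θ H L) (x : N) {v : N}
    (hv : v ∈ (extChartAt I x).source) (a : F) (b : TangentSpace I v) :
    extDerivOneForm θ v (mfderiv 𝓘(ℝ, F) I (extChartAt I x).symm (extChartAt I x v) a) b =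
      dOne (chartForm θ x) (extChartAt I x v) a (mfderiv I 𝓘(ℝ, F) (extChartAt I x) v b) := by
  refine (extDerivOneForm_eq_dOne h.contDiffOn_form hv _ b).trans ?_
  exact congrArg (fun c => dOne (chartForm θ x) (extChartAt I x v) c
    (mfderiv I 𝓘(ℝ, F) (extChartAt I x) v b)) (mfderiv_extChartAt_mfderiv_symm hv a)

lemma extDerivOneForm_symm_symm (h : IsHamiltonian θ H L) (x : N) {y : F}
    (hy : y ∈ (extChartAt I x).target) (a b : F) :
    extDerivOneForm θ ((extChartAt I x).symm y) (mfderiv 𝓘(ℝ, F) I (extChartAt I x).symm y a)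
      (mfderiv 𝓘(ℝ, F) I (extChartAt I x).symm y b) = dOne (chartForm θ x) y a b := by
  have hv := (extChartAt I x).map_target hy
  have h1 : ∀ c : F, mfderiv I 𝓘(ℝ, F) (extChartAt I x) ((extChartAt I x).symm y)
      (mfderiv 𝓘(ℝ, F) I (extChartAt I x).symm y c) = c := by
    intro c
    have h2 := mfderiv_extChartAt_mfderiv_symm hv c
    rw [(extChartAt I x).right_inv hy] at h2
    exact h2
  have h3 := extDerivOneForm_eq_dOne h.contDiffOn_form hv
    (mfderiv 𝓘(ℝ, F) I (extChartAt I x).symm y a) (mfderiv 𝓘(ℝ, F) I (extChartAt I x).symm y b)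
  rw [(extChartAt I x).right_inv hy] at h3
  exact h3.trans (congr (congrArg (fun c => ⇑(dOne (chartForm θ x) y c)) (h1 a)) (h1 b))

lemma chart_ham_eq (h : IsHamiltonian θ H L) (x : N) {y : F} (hy : y ∈ (extChartAt I x).target)
    (a : F) : fderiv ℝ (H ∘ (extChartAt I x).symm) y a =
      dOne (chartForm θ x) y a (chartField L x y) := by
  obtain ⟨v, hv, rfl⟩ : ∃ v ∈ (extChartAt I x).source, extChartAt I x v = y :=
    ⟨_, (extChartAt I x).map_target hy, (extChartAt I x).right_inv hy⟩
  have h1 := h.fderiv_chartHam_mfderiv x hv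
    (mfderiv 𝓘(ℝ, F) I (extChartAt I x).symm (extChartAt I x v) a)
  rw [chartField_extChartAt hv]
  refine Eq.trans ?_ ((h1.trans (h.ham_eq v _)).trans (h.extDerivOneForm_mfderiv_symm x hv a _))
  exact congrArg (fderiv ℝ (H ∘ (extChartAt I x).symm) (extChartAt I x v))
    (mfderiv_extChartAt_mfderiv_symm hv a).symm

lemma chart_nondegenerate (h : IsHamiltonian θ H L) (x : N) {y : F}
    (hy : y ∈ (extChartAt I x).target) (b : F) (hb : ∀ a, dOne (chartForm θ x) y a b = 0) :
    b = 0 := by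
  obtain ⟨v, hv, rfl⟩ : ∃ v ∈ (extChartAt I x).source, extChartAt I x v = y :=
    ⟨_, (extChartAt I x).map_target hy, (extChartAt I x).right_inv hy⟩
  have h1 : mfderiv 𝓘(ℝ, F) I (extChartAt I x).symm (extChartAt I x v) b = (0 : F) := by
    refine h.nondegenerate v _ fun a => ?_
    refine (extDerivOneForm_eq_dOne h.contDiffOn_form hv a _).trans ?_
    refine Eq.trans ?_ (hb (mfderiv I 𝓘(ℝ, F) (extChartAt I x) v a))
    exact congrArg (dOne (chartForm θ x) (extChartAt I x v)
      (mfderiv I 𝓘(ℝ, F) (extChartAt I x) v a)) (mfderiv_extChartAt_mfderiv_symm hv b)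
  have h2 := mfderiv_extChartAt_mfderiv_symm hv b
  refine h2.symm.trans ?_
  exact (congrArg (mfderiv I 𝓘(ℝ, F) (extChartAt I x) v) h1).trans (map_zero _)

variable [FiniteDimensional ℝ F]

lemma contDiffOn_chartField (h : IsHamiltonian θ H L) (x : N) :
    ContDiffOn ℝ ∞ (chartField L x) (extChartAt I x).target :=
  contDiffOn_hamiltonianVectorField (isOpen_extChartAt_target x) (h.contDiffOn_form x)
    (h.contDiffOn_chartHam x) (fun _ hz b hb => h.chart_nondegenerate x hz b hb)
    (fun _ hz a => h.chart_ham_eq x hz a)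

/-- `IsHamiltonian` does not assume that `L` is smooth; this is forced by `ham_eq` and
non-degeneracy. In the tangent trivialization at `x` the field is `chartField L x`. -/
theorem contMDiff_field (h : IsHamiltonian θ H L) :
    ContMDiff I I.tangent ∞ (fun x => (⟨x, L x⟩ : TangentBundle I N)) := by
  intro x
  rw [Bundle.contMDiffAt_totalSpace]
  refine ⟨contMDiffAt_id, ?_⟩
  have h1 : ContMDiffAt I 𝓘(ℝ, F) ∞ (chartField L x ∘ extChartAt I x) x :=
    ((h.contDiffOn_chartField x).contDiffAt
      (extChartAt_target_mem_nhds x)).contMDiffAt.comp x contMDiffAt_extChartAt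
  refine h1.congr_of_eventuallyEq ?_
  filter_upwards [(isOpen_extChartAt_source x).mem_nhds (mem_extChartAt_source (I := I) x)] with v hv
  rw [Function.comp_apply, chartField_extChartAt hv]
  have hv' : v ∈ (chartAt HN x).source := by rwa [extChartAt_source] at hv
  refine Eq.trans ?_ (congrArg (fun T : F →L[ℝ] F => T (L v))
    (TangentBundle.continuousLinearMapAt_trivializationAt hv'))
  have hb : v ∈ (trivializationAt F (TangentSpace I) x).baseSet := by
    rwa [TangentBundle.trivializationAt_baseSet]
  exact congrFun ((trivializationAt F (TangentSpace I) x).coe_linearMapAt_of_mem (R := ℝ) hb).symm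
    (L v)

/-- The coordinate flow is conjugated with the chart at `z₀`. Its invariance properties transfer
because `dθ` and `dH` may be computed in this chart at every point of its domain. The map `A` of
`IsLocalFlow.deriv` is the spatial differential of the flow. -/
theorem exists_isLocalFlow (h : IsHamiltonian θ H L) (z₀ : N) :
    ∃ (Φ : ℝ → N → N) (ε : ℝ) (W : Set N), z₀ ∈ W ∧ IsLocalFlow θ H L Φ ε W := by
  have hU := isOpen_extChartAt_target (I := I) z₀
  obtain ⟨ε, hε, W, hW, hzW, Φ, hΦ, hflow⟩ := exists_contDiffOn_localFlow hU
    (h.contDiffOn_chartField z₀) (mem_extChartAt_target z₀)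
  set c := extChartAt I z₀ with hc
  have hinv := fun t (ht : t ∈ Ioo (-ε) ε) x (hx : x ∈ W) =>
    hamiltonianFlow_invariant hU (h.contDiffOn_form z₀) (h.contDiffOn_chartHam z₀)
      (h.contDiffOn_chartField z₀) (fun z hz a => h.chart_ham_eq z₀ hz a) hε hW hΦ hflow ht hx
  have hopen : IsOpen (Ioo (-ε) ε ×ˢ W) := isOpen_Ioo.prod hW
  have hmaps : ∀ {t : ℝ} {z : N}, t ∈ Ioo (-ε) ε → z ∈ c.source ∩ c ⁻¹' W →
      c.symm (Φ (t, c z)) ∈ c.source ∧ c (c.symm (Φ (t, c z))) = Φ (t, c z) := fun ht hz =>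
    ⟨c.map_target ((hflow _ hz.2).2 _ ht).1, c.right_inv ((hflow _ hz.2).2 _ ht).1⟩
  have hfield : ∀ {t : ℝ} {z : N}, t ∈ Ioo (-ε) ε → z ∈ c.source ∩ c ⁻¹' W →
      mfderiv 𝓘(ℝ, F) I c.symm (Φ (t, c z)) (chartField L z₀ (Φ (t, c z)) : F) =
        L (c.symm (Φ (t, c z))) := by
    intro t z ht hz
    obtain ⟨h1, h2⟩ := hmaps ht hz
    have h3 := mfderiv_extChartAt_symm_mfderiv h1 (L (c.symm (Φ (t, c z))))
    rw [← hc, h2] at h3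
    exact h3
  refine ⟨fun t z => c.symm (Φ (t, c z)), ε, c.source ∩ c ⁻¹' W,
    ⟨mem_extChartAt_source z₀, hzW⟩, hε, ?_, ?_, ?_, ?_, ?_⟩
  · exact (continuousOn_extChartAt z₀).isOpen_inter_preimage (isOpen_extChartAt_source z₀) hW
  · intro z hz
    rw [(hflow _ hz.2).1, c.left_inv hz.1]
  · intro z hz t ht
    have h1 := ((hflow _ hz.2).2 t ht).2.hasFDerivAt.hasMFDerivAt
    have h2 := (mdifferentiableAt_extChartAt_symm_of_mem
      ((hflow _ hz.2).2 t ht).1).hasMFDerivAt.comp t h1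
    refine (h2.congr_mfderiv ?_).hasMFDerivWithinAt
    ext
    exact (map_smul _ _ _).trans (congrArg _ (hfield ht hz))
  · intro t ht z hz
    have hΦc : ContDiffAt ℝ ∞ Φ (t, c z) := hΦ.contDiffAt (hopen.mem_nhds (mk_mem_prod ht hz.2))
    exact ContMDiffAt.comp (t, z)
      (contMDiffAt_extChartAt_symm_of_mem ((hflow _ hz.2).2 t ht).1)
      (ContMDiffAt.comp (t, z) (g := Φ) (f := fun p : ℝ × N => (p.1, c p.2))
        hΦc.contMDiffAt
        (contMDiffAt_fst.prodMk_space
          ((contMDiffAt_extChartAt_of_mem hz.1).comp (t, z) contMDiffAt_snd)))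
  · intro t ht z hz
    obtain ⟨hi1, hi2, hi3⟩ := hinv t ht (c z) hz.2
    have hΦc : ContDiffAt ℝ ∞ Φ (t, c z) := hΦ.contDiffAt (hopen.mem_nhds (mk_mem_prod ht hz.2))
    have hD : HasMFDerivAt (𝓘(ℝ, ℝ).prod I) I (fun p : ℝ × N => c.symm (Φ (p.1, c p.2))) (t, z) _ :=
      HasMFDerivAt.comp (t, z)
      (mdifferentiableAt_extChartAt_symm_of_mem ((hflow _ hz.2).2 t ht).1).hasMFDerivAt
      (HasMFDerivAt.comp (t, z) (g := Φ) (f := fun p : ℝ × N => (p.1, c p.2))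
        (hΦc.differentiableAt (by simp)).hasFDerivAt.hasMFDerivAt
        (hasMFDerivAt_prodMk_space (hasMFDerivAt_fst (t, z))
          ((mdifferentiableAt_extChartAt_of_mem hz.1).hasMFDerivAt.comp (t, z)
            (hasMFDerivAt_snd (t, z)))))
    let A₀ : F →L[ℝ] F := (fderiv ℝ Φ (t, c z)).comp (.inr ℝ ℝ F)
    refine ⟨(mfderiv 𝓘(ℝ, F) I c.symm (Φ (t, c z))).comp
      (A₀.comp (mfderiv I 𝓘(ℝ, F) c z)), ?_, ?_, ?_⟩
    · intro r a
      rw [hD.mfderiv]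
      change mfderiv 𝓘(ℝ, F) I c.symm (Φ (t, c z))
        (fderiv ℝ Φ (t, c z) (r, mfderiv I 𝓘(ℝ, F) c z a)) = _
      refine (congrArg (mfderiv 𝓘(ℝ, F) I c.symm (Φ (t, c z))) (hi1 r _)).trans ?_
      refine (map_add (mfderiv 𝓘(ℝ, F) I c.symm (Φ (t, c z))) _ _).trans ?_
      refine congr (congrArg HAdd.hAdd ?_) rfl
      exact (map_smul _ _ _).trans (congrArg _ (hfield ht hz))
    · intro a b
      refine (h.extDerivOneForm_symm_symm z₀ ((hflow _ hz.2).2 t ht).1 _ _).trans ?_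
      exact (hi2 _ _).trans (extDerivOneForm_eq_dOne h.contDiffOn_form hz.1 a b).symm
    · intro a
      refine (h.fderiv_chartHam z₀ ((hflow _ hz.2).2 t ht).1 _).symm.trans ?_
      exact (hi3 _).trans (h.fderiv_chartHam_mfderiv z₀ hz.1 a)

end IsHamiltonian
end Hamiltonian

/-! ### Integral curves, and transport of sections along them. -/

section IntegralCurves

variable {F : Type*} [NormedAddCommGroup F] [NormedSpace ℝ F]
  {HN : Type*} [TopologicalSpace HN] {I : ModelWithCorners ℝ F HN}
  {N : Type*} [TopologicalSpace N] [ChartedSpace HN N] {L : ∀ x : N, TangentSpace I x}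

lemma mem_integralCurveThrough_symm {v w : N} (h : w ∈ integralCurveThrough L v) :
    v ∈ integralCurveThrough L w := by
  obtain ⟨γ, a, b, hγ, t₀, ht₀, t₁, ht₁, h0, h1⟩ := h
  exact ⟨γ, a, b, hγ, t₁, ht₁, t₀, ht₀, h1, h0⟩

/-- The symplectic form at a point, as a continuous bilinear form. -/
def sympForm (θ : ∀ x : N, TangentSpace I x →L[ℝ] ℝ) (x : N) : F →L[ℝ] F →L[ℝ] ℝ :=
  (dOne (chartForm θ x) (extChartAt I x x)).bilinearComp
    (mfderiv I 𝓘(ℝ, F) (extChartAt I x) x : F →L[ℝ] F)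
    (mfderiv I 𝓘(ℝ, F) (extChartAt I x) x : F →L[ℝ] F)

variable [T2Space N] [I.Boundaryless] [IsManifold I ∞ N]

/-- The second curve is shifted in time so that it passes through `v` together with the first. On
the overlap the two agree by uniqueness of integral curves, which needs a Hausdorff manifold, and
they glue to a curve on the union of the intervals. -/
lemma mem_integralCurveThrough_trans [FiniteDimensional ℝ F]
    (hL : ContMDiff I I.tangent ∞ (fun x => (⟨x, L x⟩ : TangentBundle I N))) {u v w : N}
    (h : v ∈ integralCurveThrough L u) (h' : w ∈ integralCurveThrough L v) :
    w ∈ integralCurveThrough L u := by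
  have : IsManifold I 1 N := IsManifold.of_le (n := ∞) (by simp)
  obtain ⟨γ, a, b, hγ, t₀, ht₀, t₁, ht₁, h0, h1⟩ := h
  obtain ⟨γ', a', b', hγ', t₀', ht₀', t₁', ht₁', h0', h1'⟩ := h'
  set δ := t₀' - t₁ with hδ
  have hγ'' : IsMIntegralCurveOn (γ' ∘ (· + δ)) L (Ioo (a' - δ) (b' - δ)) := by
    have := hγ'.comp_add δ
    rwa [show {t | t + δ ∈ Ioo a' b'} = Ioo (a' - δ) (b' - δ) by
      ext t; simp [sub_lt_iff_lt_add, lt_sub_iff_add_lt]] at this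
  have hmem : t₁ ∈ Ioo a b ∩ Ioo (a' - δ) (b' - δ) :=
    ⟨ht₁, by constructor <;> linarith [ht₀'.1, ht₀'.2]⟩
  have heq : γ t₁ = (γ' ∘ (· + δ)) t₁ := by simp [hδ, h0', h1]
  have hL1 := hL.of_le (m := 1) (by simp)
  have hglue := isMIntegralCurveOn_piecewise hL1 hγ hγ'' hmem heq
  have heqOn := eqOn_piecewise_of_isMIntegralCurveOn_Ioo hL1 hγ hγ'' hmem heq
  have hunion : Ioo a b ∪ Ioo (a' - δ) (b' - δ) = Ioo (min a (a' - δ)) (max b (b' - δ)) :=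
    Ioo_union_Ioo' (by linarith [hmem.1.1, hmem.1.2, hmem.2.1, hmem.2.2])
      (by linarith [hmem.1.1, hmem.1.2, hmem.2.1, hmem.2.2])
  rw [hunion] at hglue
  have ht₂ : t₁' - δ ∈ Ioo (a' - δ) (b' - δ) := by
    constructor <;> linarith [ht₁'.1, ht₁'.2]
  refine ⟨_, _, _, hglue, t₀, hunion ▸ Or.inl ht₀, t₁' - δ, hunion ▸ Or.inr ht₂, ?_, ?_⟩
  · rw [piecewise_eq_of_mem _ _ _ ht₀, h0]
  · rw [heqOn ht₂]
    simp [h1']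

namespace IsHamiltonian

variable {θ : ∀ x : N, TangentSpace I x →L[ℝ] ℝ} {H : N → ℝ}

-- Conservation of energy: `dH(L) = dθ(L, L) = 0`.
omit [T2Space N] in
lemma ham_eq_of_mem_integralCurve (h : IsHamiltonian θ H L) {v w : N}
    (hw : w ∈ integralCurveThrough L v) : H w = H v := by
  obtain ⟨γ, a, b, hγ, t₀, ht₀, t₁, ht₁, h0, h1⟩ := hw
  have hd : ∀ t ∈ Ioo a b, HasDerivAt (H ∘ γ) 0 t := by
    intro t ht
    have h2 := (hγ t ht).hasMFDerivAt (Ioo_mem_nhds ht.1 ht.2)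
    let T : F →L[ℝ] ℝ := mfderiv I 𝓘(ℝ, ℝ) H (γ t)
    let l : F := L (γ t)
    have h3 : HasFDerivAt (H ∘ γ) (T.comp ((1 : ℝ →L[ℝ] ℝ).smulRight l)) t :=
      ((h.mdifferentiableAt_ham (γ t)).hasMFDerivAt.comp t h2).hasFDerivAt
    refine h3.hasDerivAt.congr_deriv ?_
    exact (congrArg T (one_smul ℝ l)).trans (h.mfderiv_ham_field (γ t))
  have hc := isOpen_Ioo.is_const_of_deriv_eq_zero isPreconnected_Ioo
    (fun s hs => (hd s hs).differentiableAt.differentiableWithinAt)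
    (fun s hs => (hd s hs).deriv) ht₁ ht₀
  simpa [h0, h1] using hc

omit [T2Space N] in
lemma extDerivOneForm_eq_sympForm (h : IsHamiltonian θ H L) (x : N) (a b : TangentSpace I x) :
    extDerivOneForm θ x a b = sympForm θ x a b :=
  extDerivOneForm_eq_dOne h.contDiffOn_form (mem_extChartAt_source x) a b

omit [T2Space N] in
/-- A linear map that preserves the symplectic form and the differential of the Hamiltonian
preserves the Hamiltonian vector field. -/
lemma map_field_eq [FiniteDimensional ℝ F] (h : IsHamiltonian θ H L) {x y : N}
    (A : TangentSpace I x →L[ℝ] TangentSpace I y)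
    (hA : ∀ a b, extDerivOneForm θ y (A a) (A b) = extDerivOneForm θ x a b)
    (hH : ∀ a, mfderiv I 𝓘(ℝ, ℝ) H y (A a) = mfderiv I 𝓘(ℝ, ℝ) H x a) : A (L x) = L y := by
  let A₀ : F →L[ℝ] F := A
  have hinj : Function.Injective (A₀ : F →ₗ[ℝ] F) := by
    rw [← LinearMap.ker_eq_bot, LinearMap.ker_eq_bot']
    intro b hb
    refine h.nondegenerate x b fun a => ?_
    exact (hA a b).symm.trans ((h.extDerivOneForm_eq_sympForm _ _ _).trans
      ((congrArg (sympForm θ y (A a)) hb).trans (map_zero _)))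
  -- `A` is injective because it preserves a non-degenerate form, and both tangent spaces are
  -- modelled on `F`. Being onto, it lets `A (L x)` be tested against vectors of the form `A c`.
  have hsurj := LinearMap.injective_iff_surjective.1 hinj
  refine sub_eq_zero.1 (h.nondegenerate y _ fun a => ?_)
  obtain ⟨c, hc⟩ : ∃ c : TangentSpace I x, A c = a := hsurj a
  refine (h.extDerivOneForm_eq_sympForm y a _).trans ((map_sub (sympForm θ y a) _ _).trans
    (sub_eq_zero.2 ?_))
  refine (h.extDerivOneForm_eq_sympForm y a _).symm.trans (Eq.trans ?_
    (h.extDerivOneForm_eq_sympForm y a _))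
  rw [← hc, hA, ← h.ham_eq, ← h.ham_eq]
  exact (hH c).symm

end IsHamiltonian

namespace IsLocalFlow

variable {θ : ∀ x : N, TangentSpace I x →L[ℝ] ℝ} {H : N → ℝ} {Φ : ℝ → N → N} {ε : ℝ} {W : Set N}

omit [T2Space N] [IsManifold I ∞ N] in
lemma zero_mem (hΦ : IsLocalFlow θ H L Φ ε W) : (0 : ℝ) ∈ Ioo (-ε) ε :=
  ⟨by linarith [hΦ.pos], hΦ.pos⟩

omit [T2Space N] [IsManifold I ∞ N] in
lemma mem_integralCurveThrough (hΦ : IsLocalFlow θ H L Φ ε W) {t : ℝ} (ht : t ∈ Ioo (-ε) ε)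
    {z : N} (hz : z ∈ W) : Φ t z ∈ integralCurveThrough L z :=
  ⟨fun t => Φ t z, -ε, ε, hΦ.curve z hz, 0, hΦ.zero_mem, t, ht, hΦ.map_zero z hz, rfl⟩

/-- Integral curves are given by the local flow. -/
lemma eq_curve [FiniteDimensional ℝ F] (hΦ : IsLocalFlow θ H L Φ ε W)
    (hL : ContMDiff I I.tangent ∞ (fun x => (⟨x, L x⟩ : TangentBundle I N)))
    {γ : ℝ → N} {a b : ℝ} (hγ : IsMIntegralCurveOn γ L (Ioo a b)) {t₁ t₂ : ℝ}
    (ht₁ : t₁ ∈ Ioo a b) (ht₂ : t₂ ∈ Ioo a b) (hW : γ t₁ ∈ W) (ht : t₂ - t₁ ∈ Ioo (-ε) ε) :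
    Φ (t₂ - t₁) (γ t₁) = γ t₂ := by
  have : IsManifold I 1 N := IsManifold.of_le (n := ∞) (by simp)
  have hγ' : IsMIntegralCurveOn (γ ∘ (· + t₁)) L (Ioo (a - t₁) (b - t₁)) := by
    have := hγ.comp_add t₁
    rwa [show {t | t + t₁ ∈ Ioo a b} = Ioo (a - t₁) (b - t₁) by
      ext t; simp [sub_lt_iff_lt_add, lt_sub_iff_add_lt]] at this
  have h0 := hΦ.zero_mem
  have heq := isMIntegralCurveOn_Ioo_eqOn_of_contMDiff_boundaryless (t₀ := 0)
    (a := max (-ε) (a - t₁)) (b := min ε (b - t₁))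
    ⟨max_lt h0.1 (by linarith [ht₁.1]), lt_min h0.2 (by linarith [ht₁.2])⟩ (hL.of_le (by simp))
    ((hΦ.curve _ hW).mono (Ioo_subset_Ioo (le_max_left _ _) (min_le_left _ _)))
    (hγ'.mono (Ioo_subset_Ioo (le_max_right _ _) (min_le_right _ _)))
    (by simp [hΦ.map_zero _ hW])
  have := heq (x := t₂ - t₁) ⟨max_lt ht.1 (by linarith [ht₂.1]), lt_min ht.2 (by linarith [ht₂.2])⟩
  simpa using this

end IsLocalFlow

section Transport

variable {ES : Type*} [NormedAddCommGroup ES] [NormedSpace ℝ ES] {HS : Type*} [TopologicalSpace HS]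
  {IS : ModelWithCorners ℝ ES HS} {S : Type*} [TopologicalSpace S] [ChartedSpace HS S]
  {θ : ∀ x : N, TangentSpace I x →L[ℝ] ℝ} {H : N → ℝ} {ι ψ : S → N} {s : S}

/-- Near `s`, the map `ψ` moves the points `ι s'` along the integral curves of `L`; up to multiples
of `L`, its differential at `s` arises from that of `ι` by a linear map which preserves the
symplectic form and the differential of the Hamiltonian. -/
structure IsTransported (IS : ModelWithCorners ℝ ES HS) [ChartedSpace HS S]
    (θ : ∀ x : N, TangentSpace I x →L[ℝ] ℝ) (H : N → ℝ)
    (L : ∀ x : N, TangentSpace I x) (ι : S → N) (s : S) (ψ : S → N) : Prop where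
  contMDiffAt : ContMDiffAt IS I ∞ ψ s
  mem_curve : ∀ᶠ s' in 𝓝 s, ψ s' ∈ integralCurveThrough L (ι s')
  deriv : ∃ (A : TangentSpace I (ι s) →L[ℝ] TangentSpace I (ψ s)) (c : TangentSpace IS s →L[ℝ] ℝ),
    (∀ w, mfderiv IS I ψ s w = A (mfderiv IS I ι s w) + c w • L (ψ s)) ∧
    (∀ a b, extDerivOneForm θ (ψ s) (A a) (A b) = extDerivOneForm θ (ι s) a b) ∧
    ∀ a, mfderiv I 𝓘(ℝ, ℝ) H (ψ s) (A a) = mfderiv I 𝓘(ℝ, ℝ) H (ι s) a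

variable [FiniteDimensional ℝ F]

omit [T2Space N] in
lemma IsTransported.refl (h : IsHamiltonian θ H L) (hι : ContMDiffAt IS I ∞ ι s) :
    IsTransported IS θ H L ι s ι where
  contMDiffAt := hι
  -- That a point lies on an integral curve through itself needs the existence of some curve there,
  -- hence a local flow.
  mem_curve := Filter.Eventually.of_forall fun s' => by
    obtain ⟨Φ, ε, W, hs, hΦ⟩ := h.exists_isLocalFlow (ι s')
    have := hΦ.mem_integralCurveThrough hΦ.zero_mem hs
    rwa [hΦ.map_zero _ hs] at this
  deriv := ⟨ContinuousLinearMap.id ℝ _, 0, by simp, by simp, by simp⟩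

/-- Transported maps may be moved further along the flow, for a variable time. -/
lemma IsTransported.flow (hψ : IsTransported IS θ H L ι s ψ) (h : IsHamiltonian θ H L)
    {Φ : ℝ → N → N} {ε : ℝ} {W : Set N} (hΦ : IsLocalFlow θ H L Φ ε W) {τ : S → ℝ}
    (hτ : ContMDiffAt IS 𝓘(ℝ, ℝ) ∞ τ s) (hs : ψ s ∈ W) (hτs : τ s ∈ Ioo (-ε) ε) :
    IsTransported IS θ H L ι s (fun s' => Φ (τ s') (ψ s')) where
  contMDiffAt := ContMDiffAt.comp (g := fun p : ℝ × N => Φ p.1 p.2) (f := fun s' => (τ s', ψ s')) s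
    (hΦ.contMDiffAt _ hτs _ hs) (hτ.prodMk hψ.contMDiffAt)
  mem_curve := by
    filter_upwards [hψ.mem_curve, hψ.contMDiffAt.continuousAt.eventually_mem
      (hΦ.isOpen.mem_nhds hs), hτ.continuousAt.eventually_mem (isOpen_Ioo.mem_nhds hτs)]
      with s' h1 h2 h3
    exact mem_integralCurveThrough_trans h.contMDiff_field h1 (hΦ.mem_integralCurveThrough h3 h2)
  deriv := by
    obtain ⟨A, c, hd, hB, hH⟩ := hψ.deriv
    obtain ⟨A', hd', hB', hH'⟩ := hΦ.deriv _ hτs _ hs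
    have hΦd : MDifferentiableAt (𝓘(ℝ, ℝ).prod I) I (fun p : ℝ × N => Φ p.1 p.2) (τ s, ψ s) :=
      (hΦ.contMDiffAt _ hτs _ hs).mdifferentiableAt (by simp)
    have hτd : MDifferentiableAt IS 𝓘(ℝ, ℝ) τ s := hτ.mdifferentiableAt (by simp)
    have hψd : MDifferentiableAt IS I ψ s := hψ.contMDiffAt.mdifferentiableAt (by simp)
    have hcomp := HasMFDerivAt.comp (g := fun p : ℝ × N => Φ p.1 p.2)
      (f := fun s' => (τ s', ψ s')) s hΦd.hasMFDerivAt
      (hτd.hasMFDerivAt.prodMk hψd.hasMFDerivAt)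
    let c' : TangentSpace IS s →L[ℝ] ℝ := mfderiv IS 𝓘(ℝ, ℝ) τ s
    refine ⟨A'.comp A, c' + c, fun w => ?_, fun a b => ?_, fun a => ?_⟩
    -- The variable time contributes `dτ(w) • L`. The old multiple of `L` remains a multiple of `L`
    -- because `A'` maps `L` to `L`.
    · have h1 : mfderiv IS I (fun s' => Φ (τ s') (ψ s')) s w =
          c' w • L (Φ (τ s) (ψ s)) + A' (mfderiv IS I ψ s w) :=
        (congrArg (fun T : ES →L[ℝ] F => T w) hcomp.mfderiv).trans (hd' _ _)
      rw [h1, hd, map_add, map_smul, h.map_field_eq A' hB' hH', add_apply,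
        ContinuousLinearMap.comp_apply]
      module
    · exact (hB' _ _).trans (hB _ _)
    · exact (hH' _).trans (hH _)

/-- Transport along a whole integral curve. -/
theorem IsTransported.exists_of_curve (hψ : IsTransported IS θ H L ι s ψ) (h : IsHamiltonian θ H L)
    {z : N} (hz : z ∈ integralCurveThrough L (ψ s)) :
    ∃ ψ', IsTransported IS θ H L ι s ψ' ∧ ψ' s = z := by
  obtain ⟨γ, a, b, hγ, t₀, ht₀, t₁, ht₁, h0, rfl⟩ := hz
  let P : ℝ → Prop := fun t => ∃ ψ', IsTransported IS θ H L ι s ψ' ∧ ψ' s = γ t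
  have hP : P t₀ → P t₁ := by
    -- Connectedness of the time interval replaces a subdivision into short steps. It suffices that
    -- each `t` can be joined, in both directions, with all nearby times, and one local flow around
    -- `γ t` does this.
    refine isPreconnected_Ioo.induction₂' (fun t t' => P t → P t') ?_ ?_ ht₀ ht₁
    · intro t ht
      obtain ⟨Φ, ε, W, hW, hΦ⟩ := h.exists_isLocalFlow (γ t)
      have hcont : ContinuousWithinAt γ (Ioo a b) t := (hγ t ht).1
      have step : ∀ r ∈ Ioo a b, ∀ r' ∈ Ioo a b, γ r ∈ W → r' - r ∈ Ioo (-ε) ε → P r → P r' := by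
        rintro r hr r' hr' hrW hrr ⟨ψ', hψ', hψs⟩
        refine ⟨_, hψ'.flow h hΦ (τ := fun _ => r' - r) contMDiffAt_const (hψs ▸ hrW) hrr, ?_⟩
        simp only [hψs]
        exact hΦ.eq_curve h.contMDiff_field hγ hr hr' hrW hrr
      have hnear : ∀ᶠ r in 𝓝[Ioo a b] t, r - t ∈ Ioo (-ε) ε ∧ t - r ∈ Ioo (-ε) ε := by
        refine nhdsWithin_le_nhds ?_
        filter_upwards [Ioo_mem_nhds (show t - ε < t by linarith [hΦ.pos])
          (show t < t + ε by linarith [hΦ.pos])] with r hr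
        exact ⟨⟨by linarith [hr.1], by linarith [hr.2]⟩, ⟨by linarith [hr.2], by linarith [hr.1]⟩⟩
      filter_upwards [hnear, hcont.eventually_mem (hΦ.isOpen.mem_nhds hW), self_mem_nhdsWithin]
        with r hr hrW hrI
      exact ⟨step t ht r hrI hW hr.1, step r hrI t ht hrW hr.2⟩
    · intro x y z _ _ _ h1 h2 h3
      exact h2 (h1 h3)
  exact hP ⟨ψ, hψ, h0.symm⟩

end Transport

end IntegralCurves

/-! ### Flow boxes in a normed space. -/

section FlowBox

variable {F : Type*} [NormedAddCommGroup F] [NormedSpace ℝ F] [FiniteDimensional ℝ F]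
  {ES : Type*} [NormedAddCommGroup ES] [NormedSpace ℝ ES] [FiniteDimensional ℝ ES]

omit [FiniteDimensional ℝ F] in
/-- Two points on a short line segment that is transverse to the level sets of `H` lie on the same
level set only if they coincide. -/
lemma eventually_eq_zero_of_ham_eq {H : F → ℝ} {y₀ e : F} (hH : ContDiffAt ℝ ∞ H y₀)
    (he : fderiv ℝ H y₀ e ≠ 0) : ∃ V ∈ 𝓝 y₀, ∀ y ∈ V, ∀ r : ℝ, y + r • e ∈ V →
      H (y + r • e) = H y → r = 0 := by
  have h1 : ∀ᶠ y in 𝓝 y₀, DifferentiableAt ℝ H y ∧ fderiv ℝ H y e ≠ 0 := by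
    have hH1 : ContDiffAt ℝ 1 H y₀ := hH.of_le (by simp)
    have hc : ContinuousAt (fun y => fderiv ℝ H y e) y₀ :=
      ((hH1.fderiv_right (m := 0) (by simp)).continuousAt).clm_apply continuousAt_const
    filter_upwards [hH1.eventually (by simp), hc.eventually_ne he] with y hy hy'
    exact ⟨hy.differentiableAt (by simp), hy'⟩
  obtain ⟨R, hR, hball⟩ := Metric.eventually_nhds_iff_ball.1 h1
  refine ⟨Metric.ball y₀ R, Metric.ball_mem_nhds _ hR, fun y hy r hyr heq => ?_⟩
  have hmem : ∀ x ∈ Icc (0 : ℝ) 1, y + x • r • e ∈ Metric.ball y₀ R := by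
    intro x hx
    refine (convex_ball y₀ R).segment_subset hy hyr ?_
    rw [segment_eq_image']
    exact ⟨x, hx, by simp⟩
  have hd : ∀ x ∈ Icc (0 : ℝ) 1, HasDerivAt (fun x : ℝ => H (y + x • r • e))
      (fderiv ℝ H (y + x • r • e) (r • e)) x := by
    intro x hx
    have h2 : HasDerivAt (fun x : ℝ => y + x • r • e) (r • e) x := by
      simpa using ((hasDerivAt_id x).smul_const (r • e)).const_add y
    exact (hball _ (hmem x hx)).1.hasFDerivAt.comp_hasDerivAt x h2
  -- By Rolle's theorem, equal values at the endpoints give a zero of `r • dH(e)` on the segment,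
  -- where `dH(e)` does not vanish.
  obtain ⟨x, hx, hx0⟩ := exists_hasDerivAt_eq_zero (f := fun x : ℝ => H (y + x • r • e))
    zero_lt_one (fun x hx => (hd x hx).continuousAt.continuousWithinAt) (by simp [heq])
    (fun x hx => hd x (Ioo_subset_Icc_self hx))
  rw [map_smul, smul_eq_mul] at hx0
  exact (mul_eq_zero.1 hx0).resolve_right (hball _ (hmem x (Ioo_subset_Icc_self hx))).2

/-- A flow box: near a point of a transverse section `j` in a level set of `H`, the level set is
swept out by the flow lines through the section. -/
theorem exists_flowBox {Ψ : ℝ × F → F} {j : ES → F} {H : F → ℝ} {y₀ f₀ e : F} {u₀ : ES} {h₀ : ℝ}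
    (hΨ : ContDiffAt ℝ ∞ Ψ (0, y₀)) (hΨ0 : ∀ᶠ y in 𝓝 y₀, Ψ (0, y) = y)
    (hΨf : HasDerivAt (fun t => Ψ (t, y₀)) f₀ 0) (hj : ContDiffAt ℝ ∞ j u₀) (hju : j u₀ = y₀)
    (hH : ContDiffAt ℝ ∞ H y₀) (hHΨ : ∀ᶠ p in 𝓝 (0, y₀), H (Ψ p) = H p.2)
    (hHj : ∀ᶠ u in 𝓝 u₀, H (j u) = h₀) (he : fderiv ℝ H y₀ e ≠ 0) (hf₀ : fderiv ℝ H y₀ f₀ = 0)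
    (hinj : Function.Injective (fderiv ℝ j u₀)) (htr : ∀ w, fderiv ℝ j u₀ w ≠ f₀)
    (hdim : Module.finrank ℝ ES + 2 = Module.finrank ℝ F) :
    ∃ (σ : F → ES) (τ : F → ℝ), ContDiffAt ℝ ∞ σ y₀ ∧ ContDiffAt ℝ ∞ τ y₀ ∧ σ y₀ = u₀ ∧ τ y₀ = 0 ∧
      ∀ᶠ y in 𝓝 y₀, H y = h₀ → Ψ (τ y, j (σ y)) = y := by
  have : CompleteSpace F := FiniteDimensional.complete ℝ F
  have : CompleteSpace ES := FiniteDimensional.complete ℝ ES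
  -- The section has codimension two. One missing coordinate is the time; the other is a
  -- displacement `r` along `e`, which leaves the level set. With both, `G` is a local
  -- diffeomorphism onto a neighbourhood in the whole space.
  let κ : ES × ℝ × ℝ → ℝ × F := fun p => (p.2.1, j p.1 + p.2.2 • e)
  let G : ES × ℝ × ℝ → F := fun p => Ψ (κ p)
  let p₀ : ES × ℝ × ℝ := (u₀, 0, 0)
  have hκ0 : κ p₀ = (0, y₀) := by simp [κ, p₀, hju]
  have hκ : ContDiffAt ℝ ∞ κ p₀ := by
    refine ContDiffAt.prodMk (contDiff_fst.comp contDiff_snd).contDiffAt (ContDiffAt.add ?_ ?_)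
    · exact hj.comp p₀ contDiff_fst.contDiffAt
    · exact ((contDiff_snd.comp contDiff_snd).smul contDiff_const).contDiffAt
  have hG : ContDiffAt ℝ ∞ G p₀ := by
    refine ContDiffAt.comp p₀ ?_ hκ
    rwa [hκ0]
  have hΨd : HasFDerivAt Ψ (fderiv ℝ Ψ (0, y₀)) (0, y₀) :=
    (hΨ.differentiableAt (by simp)).hasFDerivAt
  have hid : ∀ a, fderiv ℝ Ψ (0, y₀) (0, a) = a := by
    intro a
    have h1 : HasFDerivAt (fun y : F => ((0 : ℝ), y)) (.inr ℝ ℝ F) y₀ := hasFDerivAt_prodMk_right _ _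
    have h2 := hΨd.comp y₀ h1
    have h3 : HasFDerivAt (Ψ ∘ fun y : F => ((0 : ℝ), y)) (ContinuousLinearMap.id ℝ F) y₀ :=
      (hasFDerivAt_id y₀).congr_of_eventuallyEq (by
        filter_upwards [hΨ0] with y hy using hy)
    simpa using congrArg (fun T => T a) (h2.unique h3)
  have hone : fderiv ℝ Ψ (0, y₀) (1, 0) = f₀ := fderiv_flow_one_zero hΨd.differentiableAt hΨf
  have hGd : ∀ v : ES × ℝ × ℝ, fderiv ℝ G p₀ v = v.2.1 • f₀ + (fderiv ℝ j u₀ v.1 + v.2.2 • e) := by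
    intro v
    have hjd : HasFDerivAt (fun p : ES × ℝ × ℝ => j p.1)
        ((fderiv ℝ j u₀).comp (.fst ℝ ES (ℝ × ℝ))) p₀ :=
      HasFDerivAt.comp p₀ (g := j) (hj.differentiableAt (by simp)).hasFDerivAt hasFDerivAt_fst
    have hrd : HasFDerivAt (fun p : ES × ℝ × ℝ => p.2.2 • e)
        (((ContinuousLinearMap.snd ℝ ℝ ℝ).comp (.snd ℝ ES (ℝ × ℝ))).smulRight e) p₀ :=
      (((ContinuousLinearMap.snd ℝ ℝ ℝ).comp (.snd ℝ ES (ℝ × ℝ))).smulRight e).hasFDerivAt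
    have htd : HasFDerivAt (fun p : ES × ℝ × ℝ => p.2.1)
        ((ContinuousLinearMap.fst ℝ ℝ ℝ).comp (.snd ℝ ES (ℝ × ℝ))) p₀ :=
      ((ContinuousLinearMap.fst ℝ ℝ ℝ).comp (.snd ℝ ES (ℝ × ℝ))).hasFDerivAt
    have hκd := htd.prodMk (hjd.add hrd)
    have h1 : HasFDerivAt G _ p₀ := HasFDerivAt.comp p₀ (g := Ψ) (by rw [hκ0]; exact hΨd) hκd
    rw [h1.fderiv]
    have h2 : ∀ (r : ℝ) (a : F), fderiv ℝ Ψ (0, y₀) (r, a) = r • f₀ + a := by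
      intro r a
      have : ((r, a) : ℝ × F) = r • ((1 : ℝ), (0 : F)) + ((0 : ℝ), a) := by simp
      rw [this, map_add, map_smul, hone, hid]
    exact h2 _ _
  have hinjG : Function.Injective (fderiv ℝ G p₀ : ES × ℝ × ℝ →ₗ[ℝ] F) := by
    rw [← LinearMap.ker_eq_bot, LinearMap.ker_eq_bot']
    rintro ⟨u, t, r⟩ hv
    replace hv : t • f₀ + (fderiv ℝ j u₀ u + r • e) = 0 := (hGd (u, t, r)).symm.trans hv
    have hHju : fderiv ℝ H y₀ (fderiv ℝ j u₀ u) = 0 := by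
      have h1 : HasFDerivAt (H ∘ j) ((fderiv ℝ H y₀).comp (fderiv ℝ j u₀)) u₀ :=
        HasFDerivAt.comp u₀ (by rw [hju]; exact (hH.differentiableAt (by simp)).hasFDerivAt)
          (hj.differentiableAt (by simp)).hasFDerivAt
      have h2 : HasFDerivAt (H ∘ j) (0 : ES →L[ℝ] ℝ) u₀ :=
        (hasFDerivAt_const h₀ u₀).congr_of_eventuallyEq hHj
      exact congrArg (fun T : ES →L[ℝ] ℝ => T u) (h1.unique h2)
    -- `dH` vanishes on the section and on the flow direction, so it detects `r`. After that,
    -- transversality gives `t = 0` and the immersion property gives `u = 0`.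
    have hr : r = 0 := by
      have h1 := congrArg (fderiv ℝ H y₀) hv
      simp only [map_add, map_smul, hf₀, hHju, mul_zero, zero_add, map_zero, smul_eq_mul] at h1
      exact (mul_eq_zero.1 h1).resolve_right he
    subst hr
    have ht : t = 0 := by
      by_contra ht
      -- Transversality excludes only the vector `f₀` itself; since the image of the differential is
      -- a linear space, rescaling excludes its non-zero multiples too.
      refine htr (-t⁻¹ • u) ?_
      rw [zero_smul, add_zero, add_comm] at hv
      rw [map_smul, eq_neg_of_add_eq_zero_left hv, smul_neg, neg_smul, neg_neg, smul_smul,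
        inv_mul_cancel₀ ht, one_smul]
    subst ht
    have hu : u = 0 := by
      refine hinj ?_
      simpa using hv
    rw [hu]
    rfl
  have hdim' : Module.finrank ℝ (ES × ℝ × ℝ) = Module.finrank ℝ F := by
    rw [← hdim]
    simp
  let D : (ES × ℝ × ℝ) ≃L[ℝ] F :=
    (LinearEquiv.ofInjectiveOfFinrankEq _ hinjG hdim').toContinuousLinearEquiv
  have hD : HasFDerivAt G (D : ES × ℝ × ℝ →L[ℝ] F) p₀ := by
    have : (D : ES × ℝ × ℝ →L[ℝ] F) = fderiv ℝ G p₀ := by ext <;> rfl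
    rw [this]
    exact (hG.differentiableAt (by simp)).hasFDerivAt
  have hn : (∞ : WithTop ℕ∞) ≠ 0 := by simp
  have hGp : G p₀ = y₀ := by
    change Ψ (κ p₀) = y₀
    rw [hκ0]
    exact hΨ0.self_of_nhds
  let g : F → ES × ℝ × ℝ := hG.localInverse hD hn
  have hg : ContDiffAt ℝ ∞ g y₀ := hGp ▸ hG.to_localInverse hD hn
  have hg0 : g y₀ = p₀ := hGp ▸ hG.localInverse_apply_image hD hn
  have hGg : ∀ᶠ y in 𝓝 y₀, G (g y) = y := by
    have := (hG.hasStrictFDerivAt' hD hn).eventually_right_inverse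
    rwa [hGp] at this
  refine ⟨fun y => (g y).1, fun y => (g y).2.1, contDiff_fst.contDiffAt.comp y₀ hg,
    (contDiff_fst.comp contDiff_snd).contDiffAt.comp y₀ hg, by simp [hg0, p₀], by simp [hg0, p₀], ?_⟩
  obtain ⟨V, hV, hVr⟩ := eventually_eq_zero_of_ham_eq hH he
  have hgt : Filter.Tendsto g (𝓝 y₀) (𝓝 p₀) := hg0 ▸ hg.continuousAt
  have hjt : Filter.Tendsto (fun y => j (g y).1) (𝓝 y₀) (𝓝 y₀) := by
    have h1 : Filter.Tendsto (fun y => (g y).1) (𝓝 y₀) (𝓝 u₀) := (continuous_fst.tendsto p₀).comp hgt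
    have h2 := hj.continuousAt.tendsto.comp h1
    rwa [hju] at h2
  have hκt : Filter.Tendsto (fun y => κ (g y)) (𝓝 y₀) (𝓝 (0, y₀)) := by
    have h1 := hκ.continuousAt.tendsto.comp hgt
    rwa [hκ0] at h1
  have hκt2 : Filter.Tendsto (fun y => (κ (g y)).2) (𝓝 y₀) (𝓝 y₀) :=
    (continuous_snd.tendsto _).comp hκt
  filter_upwards [hGg, hκt.eventually hHΨ, hjt.eventually_mem hV, hκt2.eventually_mem hV,
    ((continuous_fst.tendsto p₀).comp hgt).eventually hHj] with y h1 h2 h3 h4 h5 h6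
  -- On the level `h₀` the displacement disappears: the flow preserves `H`, so the point displaced
  -- by `r • e` and the section point have equal energy.
  have h7 : (g y).2.2 = 0 := by
    refine hVr _ h3 _ h4 ?_
    have h8 : H (G (g y)) = H (κ (g y)).2 := h2
    rw [h1, h6] at h8
    exact h8.symm.trans h5.symm
  have h9 : κ (g y) = ((g y).2.1, j (g y).1) := by simp [κ, h7]
  rw [← h9]
  exact h1

end FlowBox

/-! ### Differentials of immersions. -/

section Immersion

variable {E₁ E₂ H₁ H₂ M₁ M₂ : Type*} [NormedAddCommGroup E₁] [NormedSpace ℝ E₁]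
  [NormedAddCommGroup E₂] [NormedSpace ℝ E₂] [TopologicalSpace H₁] [TopologicalSpace H₂]
  {I₁ : ModelWithCorners ℝ E₁ H₁} {I₂ : ModelWithCorners ℝ E₂ H₂}
  [TopologicalSpace M₁] [ChartedSpace H₁ M₁] [TopologicalSpace M₂] [ChartedSpace H₂ M₂]
  [IsManifold I₁ ∞ M₁] [IsManifold I₂ ∞ M₂] [I₁.Boundaryless] [I₂.Boundaryless]

-- In adapted charts an immersion is `u ↦ (u, 0)` up to a linear equivalence. Reading off the first
-- component gives a smooth local left inverse `G`, whose differential is a left inverse of that of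
-- `f`.
omit [IsManifold I₁ ∞ M₁] [IsManifold I₂ ∞ M₂] [I₂.Boundaryless] in
lemma injective_mfderiv_of_isImmersionAt {f : M₁ → M₂} {x : M₁}
    (h : Manifold.IsImmersionAt I₁ I₂ ∞ f x) : Function.Injective (mfderiv I₁ I₂ f x) := by
  have hx := h.mem_domChart_source
  have hfx := h.mem_codChart_source
  let P : E₂ → E₁ := fun y => (h.equiv.symm y).1
  have hPd : ContDiff ℝ ∞ P := contDiff_fst.comp h.equiv.symm.contDiff
  have hxt : h.domChart.extend I₁ x ∈ (h.domChart.extend I₁).target :=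
    (h.domChart.extend I₁).map_source (by rwa [OpenPartialHomeomorph.extend_source])
  have hP : ∀ x' ∈ h.domChart.source,
      P (h.codChart.extend I₂ (f x')) = h.domChart.extend I₁ x' := by
    intro x' hx'
    have hs : x' ∈ (h.domChart.extend I₁).source := by rwa [OpenPartialHomeomorph.extend_source]
    have h1 := h.writtenInCharts ((h.domChart.extend I₁).map_source hs)
    simp only [Function.comp_apply, (h.domChart.extend I₁).left_inv hs] at h1
    exact (congrArg P h1).trans (by simp [P])
  have h1 : ContMDiffAt I₁ I₁ ∞ (fun x' => (h.domChart.extend I₁).symm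
      (h.domChart.extend I₁ x')) x := contMDiffAt_id.congr_of_eventuallyEq (by
    filter_upwards [h.domChart.open_source.mem_nhds hx] with x' hx'
    exact (h.domChart.extend I₁).left_inv (by rwa [OpenPartialHomeomorph.extend_source]))
  have hsymm : ContMDiffAt 𝓘(ℝ, E₁) I₁ ∞ (h.domChart.extend I₁).symm (h.domChart.extend I₁ x) := by
    refine (contMDiffOn_extend_symm h.domChart_mem_maximalAtlas).contMDiffAt ?_
    rw [← OpenPartialHomeomorph.extend_target']
    exact h.domChart.isOpen_extend_target.mem_nhds hxt
  let G : M₂ → M₁ := fun y => (h.domChart.extend I₁).symm (P (h.codChart.extend I₂ y))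
  have hG : ContMDiffAt I₂ I₁ ∞ G (f x) := by
    refine ContMDiffAt.comp (f x) (by rw [hP x hx]; exact hsymm) ?_
    exact hPd.contMDiff.contMDiffAt.comp (f x)
      (h.codChart.contMDiffAt_extend h.codChart_mem_maximalAtlas hfx)
  have hGf : G ∘ f =ᶠ[𝓝 x] id := by
    filter_upwards [h.domChart.open_source.mem_nhds hx] with x' hx'
    change (h.domChart.extend I₁).symm (P (h.codChart.extend I₂ (f x'))) = x'
    rw [hP x' hx']
    exact (h.domChart.extend I₁).left_inv (by rwa [OpenPartialHomeomorph.extend_source])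
  have h2 := HasMFDerivAt.comp x (hG.mdifferentiableAt (by simp)).hasMFDerivAt
    (h.contMDiffAt.mdifferentiableAt (by simp)).hasMFDerivAt
  have h3 := (hasMFDerivAt_id (I := I₁) x).congr_of_eventuallyEq hGf
  have h4 := hasMFDerivAt_unique h2 h3
  refine Function.LeftInverse.injective (g := mfderiv I₂ I₁ G (f x)) fun w => ?_
  exact congrArg (fun T : E₁ →L[ℝ] E₁ => T w) h4

end Immersion

/-! ### Smoothness of the map between transverse sections. -/

section CrossSections

variable {F : Type*} [NormedAddCommGroup F] [NormedSpace ℝ F] [FiniteDimensional ℝ F]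
  {HN : Type*} [TopologicalSpace HN] {I : ModelWithCorners ℝ F HN} [I.Boundaryless]
  {N : Type*} [TopologicalSpace N] [ChartedSpace HN N] [T2Space N] [IsManifold I ∞ N]
  {L : ∀ x : N, TangentSpace I x} {θ : ∀ x : N, TangentSpace I x →L[ℝ] ℝ} {H : N → ℝ}
  {ES : Type*} [NormedAddCommGroup ES] [NormedSpace ℝ ES] {HS : Type*} [TopologicalSpace HS]
  {IS : ModelWithCorners ℝ ES HS} {S : Type*} [TopologicalSpace S] [ChartedSpace HS S]

omit [FiniteDimensional ℝ F] [T2Space N] [IsManifold I ∞ N] in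
lemma IsTransported.congr {ι ψ ψ' : S → N} {s : S} (h : IsTransported IS θ H L ι s ψ)
    (heq : ψ' =ᶠ[𝓝 s] ψ) : IsTransported IS θ H L ι s ψ' where
  contMDiffAt := h.contMDiffAt.congr_of_eventuallyEq heq
  mem_curve := by
    filter_upwards [h.mem_curve, heq] with s' h1 h2
    rwa [h2]
  deriv := by
    have hd : (mfderiv IS I ψ' s : ES →L[ℝ] F) = mfderiv IS I ψ s := heq.mfderiv_eq
    -- The target of `A` is a tangent space at a point that changes from `ψ s` to `ψ' s`, so the
    -- statement is generalized over this point before the equality is used.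
    have key : ∀ z : N, z = ψ s →
        ∃ (A : TangentSpace I (ι s) →L[ℝ] TangentSpace I z) (c : TangentSpace IS s →L[ℝ] ℝ),
          (∀ w, (mfderiv IS I ψ s w : F) = (A (mfderiv IS I ι s w) + c w • L z : TangentSpace I z)) ∧
          (∀ a b, extDerivOneForm θ z (A a) (A b) = extDerivOneForm θ (ι s) a b) ∧
          ∀ a, mfderiv I 𝓘(ℝ, ℝ) H z (A a) = mfderiv I 𝓘(ℝ, ℝ) H (ι s) a := by
      rintro z rfl
      exact h.deriv
    obtain ⟨A, c, h1, h2⟩ := key (ψ' s) heq.eq_of_nhds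
    exact ⟨A, c, fun w => (congrArg (fun T : ES →L[ℝ] F => T w) hd).trans (h1 w), h2⟩

variable [FiniteDimensional ℝ ES] [IS.Boundaryless] [IsManifold IS ∞ S]

/-- Near a point of a transverse section `ι` in a level set of the Hamiltonian, the points of the
level set flow into the section, after a time and to a place that depend smoothly on the point. -/
theorem IsLocalFlow.exists_flowBox {Φ : ℝ → N → N} {ε : ℝ} {W : Set N}
    (hΦ : IsLocalFlow θ H L Φ ε W) (h : IsHamiltonian θ H L) {ι : S → N} {s : S} {h₀ : ℝ}
    (hι : ContMDiff IS I ∞ ι) (hs : ι s ∈ W) (hH : ∀ s', H (ι s') = h₀)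
    (hinj : Function.Injective (mfderiv IS I ι s)) (htr : ∀ w, mfderiv IS I ι s w ≠ L (ι s))
    {a : TangentSpace I (ι s)} (ha : mfderiv I 𝓘(ℝ, ℝ) H (ι s) a ≠ 0)
    (hdim : Module.finrank ℝ ES + 2 = Module.finrank ℝ F) :
    ∃ (σ : N → S) (τ : N → ℝ), ContMDiffAt I IS ∞ σ (ι s) ∧ ContMDiffAt I 𝓘(ℝ, ℝ) ∞ τ (ι s) ∧
      σ (ι s) = s ∧ τ (ι s) = 0 ∧ ∀ᶠ z in 𝓝 (ι s), H z = h₀ →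
        z ∈ W ∧ τ z ∈ Ioo (-ε) ε ∧ Φ (τ z) z = ι (σ z) := by
  set c := extChartAt I (ι s) with hc
  set cS := extChartAt IS s with hcS
  have hcs : ι s ∈ c.source := mem_extChartAt_source _
  have hct : c (ι s) ∈ c.target := mem_extChartAt_target _
  have hcc : c.symm (c (ι s)) = ι s := c.left_inv hcs
  have hcSs : cS.symm (cS s) = s := cS.left_inv (mem_extChartAt_source _)
  have hcSt : cS s ∈ cS.target := mem_extChartAt_target _
  have hsymm : ContMDiffAt 𝓘(ℝ, F) I ∞ c.symm (c (ι s)) := contMDiffAt_extChartAt_symm_of_mem hct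
  have hSsymm : ContMDiffAt 𝓘(ℝ, ES) IS ∞ cS.symm (cS s) := contMDiffAt_extChartAt_symm_of_mem hcSt
  have hc1 : ContMDiffAt I 𝓘(ℝ, F) ∞ c (ι s) := contMDiffAt_extChartAt_of_mem hcs
  have hΦ0 : Φ 0 (ι s) = ι s := hΦ.map_zero _ hs
  -- The flow and the section are expressed in charts around `ι s` and `s`, where the flow box on
  -- the model space applies.
  let Ψ : ℝ × F → F := fun p => c (Φ p.1 (c.symm p.2))
  let j : ES → F := fun u => c (ι (cS.symm u))
  have hΦs : ContMDiffAt 𝓘(ℝ, ℝ × F) I ∞ (fun p : ℝ × F => Φ p.1 (c.symm p.2)) (0, c (ι s)) := by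
    refine ContMDiffAt.comp (I' := 𝓘(ℝ, ℝ).prod I) (g := fun p : ℝ × N => Φ p.1 p.2)
      (f := fun p : ℝ × F => (p.1, c.symm p.2)) (0, c (ι s)) ?_ ?_
    · simp only [hcc]
      exact hΦ.contMDiffAt 0 hΦ.zero_mem _ hs
    · exact contDiffAt_fst.contMDiffAt.prodMk
        (ContMDiffAt.comp (0, c (ι s)) (g := c.symm) (f := Prod.snd) hsymm
          contDiffAt_snd.contMDiffAt)
  have hΨ : ContDiffAt ℝ ∞ Ψ (0, c (ι s)) := by
    rw [← contMDiffAt_iff_contDiffAt]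
    refine ContMDiffAt.comp (0, c (ι s)) (g := c) ?_ hΦs
    simp only [hcc, hΦ0]
    exact hc1
  have hΦc : ∀ᶠ p in 𝓝 ((0 : ℝ), c (ι s)), Φ p.1 (c.symm p.2) ∈ c.source :=
    hΦs.continuousAt.eventually_mem (by
      simp only [hcc, hΦ0]
      exact (isOpen_extChartAt_source _).mem_nhds hcs)
  have hWy : ∀ᶠ y in 𝓝 (c (ι s)), c.symm y ∈ W :=
    hsymm.continuousAt.eventually_mem (by rw [hcc]; exact hΦ.isOpen.mem_nhds hs)
  have hΨ0 : ∀ᶠ y in 𝓝 (c (ι s)), Ψ (0, y) = y := by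
    filter_upwards [hWy, (isOpen_extChartAt_target (ι s)).mem_nhds hct] with y h1 h2
    simp only [Ψ, hΦ.map_zero _ h1]
    exact c.right_inv h2
  have hΨf : HasDerivAt (fun t => Ψ (t, c (ι s)))
      (mfderiv I 𝓘(ℝ, F) c (ι s) (L (ι s)) : F) 0 := by
    have h1 := (hΦ.curve _ hs 0 hΦ.zero_mem).hasMFDerivAt
      (isOpen_Ioo.mem_nhds hΦ.zero_mem)
    have h2 : MDifferentiableAt I 𝓘(ℝ, F) c (Φ 0 (ι s)) := by
      rw [hΦ0]
      exact hc1.mdifferentiableAt (by simp)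
    let T : F →L[ℝ] F := mfderiv I 𝓘(ℝ, F) c (Φ 0 (ι s))
    let l : F := L (Φ 0 (ι s))
    have h3 : HasFDerivAt (fun t => c (Φ t (ι s))) (T.comp ((1 : ℝ →L[ℝ] ℝ).smulRight l)) 0 :=
      (h2.hasMFDerivAt.comp (0 : ℝ) h1).hasFDerivAt
    simp only [Ψ, hcc]
    refine h3.hasDerivAt.congr_deriv ?_
    have h4 : ∀ z : N, z = ι s → (mfderiv I 𝓘(ℝ, F) c z (L z) : F) =
        mfderiv I 𝓘(ℝ, F) c (ι s) (L (ι s)) := by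
      rintro z rfl
      rfl
    exact (congrArg T (one_smul ℝ l)).trans (h4 _ hΦ0)
  have hj : ContDiffAt ℝ ∞ j (cS s) := by
    rw [← contMDiffAt_iff_contDiffAt]
    refine ContMDiffAt.comp (cS s) (g := c) (f := fun u => ι (cS.symm u)) ?_
      ((hι _).comp (cS s) hSsymm)
    simp only [hcSs]
    exact hc1
  have hjd : ∀ w : ES, fderiv ℝ j (cS s) w = mfderiv I 𝓘(ℝ, F) c (ι s)
      (mfderiv IS I ι s (mfderiv 𝓘(ℝ, ES) IS cS.symm (cS s) w)) := by
    have h1 : HasMFDerivAt 𝓘(ℝ, ES) IS cS.symm (cS s) (mfderiv 𝓘(ℝ, ES) IS cS.symm (cS s)) :=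
      (hSsymm.mdifferentiableAt (by simp)).hasMFDerivAt
    have h2 : ∀ s' : S, s' = s → MDifferentiableAt IS 𝓘(ℝ, F) (c ∘ ι) s' := by
      rintro s' rfl
      exact (hc1.comp s' (hι s')).mdifferentiableAt (by simp)
    let T : ES →L[ℝ] F := mfderiv IS 𝓘(ℝ, F) (c ∘ ι) (cS.symm (cS s))
    let U : ES →L[ℝ] ES := mfderiv 𝓘(ℝ, ES) IS cS.symm (cS s)
    have h3 : HasFDerivAt j (T.comp U) (cS s) :=
      ((h2 _ hcSs).hasMFDerivAt.comp (cS s) h1).hasFDerivAt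
    have h4 : ∀ s' : S, s' = s → (mfderiv IS 𝓘(ℝ, F) (c ∘ ι) s' : ES →L[ℝ] F) =
        (mfderiv I 𝓘(ℝ, F) c (ι s)).comp (mfderiv IS I ι s) := by
      rintro s' rfl
      exact mfderiv_comp s' (hc1.mdifferentiableAt (by simp)) ((hι s').mdifferentiableAt (by simp))
    intro w
    refine (congrArg (fun T : ES →L[ℝ] F => T w) h3.fderiv).trans ?_
    exact congrArg (fun T : ES →L[ℝ] F => T (mfderiv 𝓘(ℝ, ES) IS cS.symm (cS s) w)) (h4 _ hcSs)
  have hHc : ContDiffAt ℝ ∞ (H ∘ c.symm) (c (ι s)) :=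
    (h.contDiffOn_chartHam _).contDiffAt ((isOpen_extChartAt_target _).mem_nhds hct)
  have hHΨ : ∀ᶠ p in 𝓝 ((0 : ℝ), c (ι s)), (H ∘ c.symm) (Ψ p) = (H ∘ c.symm) p.2 := by
    filter_upwards [hΦc, (continuous_snd.tendsto ((0 : ℝ), c (ι s))).eventually hWy,
      (continuous_fst.tendsto ((0 : ℝ), c (ι s))).eventually
        (isOpen_Ioo.mem_nhds hΦ.zero_mem)] with p h1 h2 h3
    simp only [Ψ, Function.comp_apply, c.left_inv h1]
    exact h.ham_eq_of_mem_integralCurve (hΦ.mem_integralCurveThrough h3 h2)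
  have hjc : ∀ᶠ u in 𝓝 (cS s), ι (cS.symm u) ∈ c.source :=
    (hι.continuous.continuousAt.comp hSsymm.continuousAt).eventually_mem (by
      simp only [Function.comp_apply, hcSs]
      exact (isOpen_extChartAt_source _).mem_nhds hcs)
  have hHj : ∀ᶠ u in 𝓝 (cS s), (H ∘ c.symm) (j u) = h₀ := by
    filter_upwards [hjc] with u hu
    simp only [j, Function.comp_apply, c.left_inv hu, hH]
  have hcinj : Function.Injective (mfderiv I 𝓘(ℝ, F) c (ι s)) := fun x y hxy => by
    rw [← mfderiv_extChartAt_symm_mfderiv hcs x, ← mfderiv_extChartAt_symm_mfderiv hcs y]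
    exact congrArg (mfderiv 𝓘(ℝ, F) I c.symm (c (ι s))) hxy
  have hcSinj : Function.Injective (mfderiv 𝓘(ℝ, ES) IS cS.symm (cS s)) := fun x y hxy => by
    rw [← mfderiv_extChartAt_mfderiv_symm (mem_extChartAt_source (I := IS) s) x,
      ← mfderiv_extChartAt_mfderiv_symm (mem_extChartAt_source (I := IS) s) y]
    exact congrArg (mfderiv IS 𝓘(ℝ, ES) cS s) hxy
  let e : F := mfderiv I 𝓘(ℝ, F) c (ι s) a
  obtain ⟨σ, τ, hσ, hτ, hσ0, hτ0, hev⟩ := Kinetic.exists_flowBox hΨ hΨ0 hΨf hj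
    (show j (cS s) = c (ι s) by simp only [j, hcSs]) hHc hHΨ hHj (e := e)
    (fun h0 => ha ((h.fderiv_chartHam_mfderiv _ hcs a).symm.trans h0))
    ((h.fderiv_chartHam_mfderiv _ hcs _).trans (h.mfderiv_ham_field _))
    (fun x y hxy => hcSinj (hinj (hcinj ((hjd x).symm.trans (hxy.trans (hjd y))))))
    (fun w hw => htr _ (hcinj ((hjd w).symm.trans hw))) hdim
  have hσc : ContMDiffAt I 𝓘(ℝ, ES) ∞ (fun z => σ (c z)) (ι s) :=
    hσ.contMDiffAt.comp (ι s) hc1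
  have hτc : ContMDiffAt I 𝓘(ℝ, ℝ) ∞ (fun z => τ (c z)) (ι s) :=
    hτ.contMDiffAt.comp (ι s) hc1
  have hσ' : ContMDiffAt I IS ∞ (fun z => cS.symm (σ (c z))) (ι s) := by
    refine ContMDiffAt.comp (ι s) ?_ hσc
    simp only [hσ0]
    exact hSsymm
  have hτ0' : τ (c (ι s)) = 0 := hτ0
  -- The flow box on the model space leads from the section to the point; here the point flows into
  -- the section, hence the minus sign.
  refine ⟨fun z => cS.symm (σ (c z)), fun z => -τ (c z), hσ', hτc.neg, ?_, ?_, ?_⟩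
  · simp only [hσ0, hcSs]
  · simp only [hτ0, neg_zero]
  have hισ : Filter.Tendsto (fun z => ι (cS.symm (σ (c z)))) (𝓝 (ι s)) (𝓝 (ι s)) := by
    have h1 := hι.continuous.continuousAt.tendsto.comp hσ'.continuousAt.tendsto
    simp only [hσ0, hcSs] at h1
    exact h1
  have hpair : Filter.Tendsto (fun z => (τ (c z), c (ι (cS.symm (σ (c z)))))) (𝓝 (ι s))
      (𝓝 ((0 : ℝ), c (ι s))) := by
    have h1 := hτc.continuousAt.tendsto
    simp only [hτ0'] at h1
    exact h1.prodMk_nhds (hc1.continuousAt.tendsto.comp hισ)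
  have hτI : ∀ᶠ z in 𝓝 (ι s), τ (c z) ∈ Ioo (-ε) ε :=
    hτc.continuousAt.eventually_mem (by
      rw [hτ0']
      exact isOpen_Ioo.mem_nhds hΦ.zero_mem)
  filter_upwards [hc1.continuousAt.eventually hev, hισ.eventually_mem
    ((isOpen_extChartAt_source _).mem_nhds hcs), hισ.eventually_mem (hΦ.isOpen.mem_nhds hs),
    hpair.eventually hΦc, hτI, hΦ.isOpen.mem_nhds hs, (isOpen_extChartAt_source _).mem_nhds hcs]
    with z h1 h2 h3 h4 h5 h6 h7 hz
  have h8 : c (Φ (τ (c z)) (ι (cS.symm (σ (c z))))) = c z := by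
    have := h1 (by simp only [Function.comp_apply, c.left_inv h7, hz])
    simpa only [Ψ, j, c.left_inv h2] using this
  simp only [c.left_inv h2] at h4
  have h9 := c.injOn h4 h7 h8
  refine ⟨h6, ⟨by linarith [h5.2], by linarith [h5.1]⟩, ?_⟩
  have h10 := hΦ.eq_curve h.contMDiff_field (hΦ.curve _ h3) h5 hΦ.zero_mem
    (by simp only [h9]; exact h6) ⟨by linarith [h5.2], by linarith [h5.1]⟩
  simp only [h9, hΦ.map_zero _ h3, zero_sub] at h10
  exact h10

variable {ES' : Type*} [NormedAddCommGroup ES'] [NormedSpace ℝ ES'] {HS' : Type*}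
  [TopologicalSpace HS'] {IS' : ModelWithCorners ℝ ES' HS'} {S' : Type*} [TopologicalSpace S']
  [ChartedSpace HS' S']

/-- The map into a transverse section `ι₂` of a level set of the Hamiltonian, along the integral
curves of the Hamiltonian vector field, is smooth, and it preserves the symplectic form and the
differential of the Hamiltonian up to multiples of the vector field. -/
theorem IsHamiltonian.contMDiffAt_and_isTransported (h : IsHamiltonian θ H L) {ι₁ : S' → N}
    {ι₂ : S → N} {h₀ : ℝ} (hι₁ : ContMDiff IS' I ∞ ι₁) (hι₂ : ContMDiff IS I ∞ ι₂)
    (hH : ∀ s, H (ι₂ s) = h₀) (hinj : ∀ s, Function.Injective (mfderiv IS I ι₂ s))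
    (htr : ∀ s w, mfderiv IS I ι₂ s w ≠ L (ι₂ s))
    (hdH : ∀ s, ∃ a, mfderiv I 𝓘(ℝ, ℝ) H (ι₂ s) a ≠ 0)
    (hdim : Module.finrank ℝ ES + 2 = Module.finrank ℝ F) {φ : S' → S}
    (hφ : ∀ s, ι₂ (φ s) ∈ integralCurveThrough L (ι₁ s))
    (huniq : ∀ s t, ι₂ t ∈ integralCurveThrough L (ι₁ s) → t = φ s) (s : S') :
    ContMDiffAt IS' IS ∞ φ s ∧ IsTransported IS' θ H L ι₁ s (ι₂ ∘ φ) := by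
  -- The map `ψ` meets the second section at `s` only; the flow box functions `σ` and `τ` correct it
  -- at the neighbouring points.
  obtain ⟨ψ, hψ, hψs⟩ := (IsTransported.refl h (hι₁ s)).exists_of_curve h (hφ s)
  obtain ⟨Φ, ε, W, hW, hΦ⟩ := h.exists_isLocalFlow (ι₂ (φ s))
  obtain ⟨a, ha⟩ := hdH (φ s)
  obtain ⟨σ, τ, hσ, hτ, hσ0, hτ0, hev⟩ := hΦ.exists_flowBox h hι₂ hW hH (hinj _) (htr _) ha hdim
  rw [← hψs] at hσ hτ hσ0 hτ0 hev hW
  have hH₁ : ∀ s', H (ι₁ s') = h₀ := fun s' =>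
    (h.ham_eq_of_mem_integralCurve (hφ s')).symm.trans (hH _)
  have hnear : ∀ᶠ s' in 𝓝 s, φ s' = σ (ψ s') ∧ ι₂ (φ s') = Φ (τ (ψ s')) (ψ s') := by
    filter_upwards [hψ.mem_curve, hψ.contMDiffAt.continuousAt.eventually hev] with s' h1 h2
    obtain ⟨h3, h4, h5⟩ := h2 ((h.ham_eq_of_mem_integralCurve h1).trans (hH₁ s'))
    have h6 : ι₂ (σ (ψ s')) ∈ integralCurveThrough L (ι₁ s') := by
      rw [← h5]
      exact mem_integralCurveThrough_trans h.contMDiff_field h1 (hΦ.mem_integralCurveThrough h4 h3)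
    -- The corrected point lies on the second section and on the integral curve of `ι₁ s'`, so it is
    -- the one that defines `φ s'`.
    have h7 := huniq s' _ h6
    exact ⟨h7.symm, by rw [← h7, h5]⟩
  refine ⟨?_, ?_⟩
  · exact (hσ.comp s hψ.contMDiffAt).congr_of_eventuallyEq (hnear.mono fun _ hs' => hs'.1)
  · refine (hψ.flow h hΦ (hτ.comp s hψ.contMDiffAt) hW ?_).congr (hnear.mono fun _ hs' => hs'.2)
    simp only [Function.comp_apply, hτ0]
    exact hΦ.zero_mem

end CrossSections

/-! ### Linear algebra of alternating maps. -/

section AlternatingMaps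

variable {V : Type*} [AddCommGroup V] [Module ℝ V] {k : ℕ}

/-- Since `b` is already an argument, every term of the multilinear expansion that contains a
multiple of `b` in another slot vanishes. This is why multiples of `L` do not matter for `i_L Ω`. -/
lemma alternatingMap_add_smul (f : V [⋀^Fin (k + 2)]→ₗ[ℝ] ℝ) (a b : V) (w : Fin k → V)
    (c : Fin k → ℝ) :
    f (Matrix.vecCons a (Matrix.vecCons b fun i => w i + c i • b)) =
      f (Matrix.vecCons a (Matrix.vecCons b w)) := by
  classical
  let g : V [⋀^Fin k]→ₗ[ℝ] ℝ := (f.curryLeft a).curryLeft b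
  have hg : ∀ v : Fin k → V, g v = f (Matrix.vecCons a (Matrix.vecCons b v)) := fun _ => rfl
  have h0 : ∀ (v : Fin k → V) (i : Fin k), v i = c i • b → g v = 0 := by
    intro v i hi
    rw [← Function.update_eq_self i v, hi, g.map_update_smul, hg]
    rw [f.map_eq_zero_of_eq _ (i := 1) (j := i.succ.succ) (by simp) (by simp [Fin.ext_iff]), smul_zero]
  have h1 := g.toMultilinearMap.map_add_univ w (fun i => c i • b)
  rw [Finset.sum_eq_single Finset.univ] at h1
  · rw [Finset.piecewise_univ] at h1
    exact h1
  · intro s _ hs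
    obtain ⟨i, hi⟩ : ∃ i, i ∉ s := by
      by_contra! h
      exact hs (Finset.eq_univ_iff_forall.2 h)
    exact h0 _ i (by simp [hi])
  · simp

/-- A form of top degree, contracted with vectors in a hyperplane, depends only on the class of the
remaining vector modulo the hyperplane. -/
lemma alternatingMap_vecCons_eq [FiniteDimensional ℝ V] (hdim : Module.finrank ℝ V = k + 1)
    (f : V [⋀^Fin (k + 1)]→ₗ[ℝ] ℝ) (h : V →ₗ[ℝ] ℝ) {a a' : V} (ha : h a = h a') (hne : h ≠ 0)
    {v : Fin k → V} (hv : ∀ i, h (v i) = 0) : f (Matrix.vecCons a v) = f (Matrix.vecCons a' v) := by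
  have h1 : f (Matrix.vecCons (a - a') v) = 0 := by
    -- The vector `a - a'` lies in `ker h` as well, and `k + 1` vectors in this `k`-dimensional
    -- space are dependent.
    refine f.map_linearDependent _ fun hli => ?_
    have hmem : ∀ i, Matrix.vecCons (a - a') v i ∈ LinearMap.ker h := by
      intro i
      refine Fin.cases ?_ (fun i => ?_) i
      · simp [ha]
      · simpa using hv i
    have hli' : LinearIndependent ℝ (fun i => (⟨_, hmem i⟩ : LinearMap.ker h)) :=
      LinearIndependent.of_comp (LinearMap.ker h).subtype hli
    have h2 := hli'.fintype_card_le_finrank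
    have h3 := Module.Dual.finrank_ker_add_one_of_ne_zero hne
    rw [Fintype.card_fin] at h2
    omega
  rw [← sub_eq_zero, ← h1]
  exact (map_sub (f.curryLeft) a a' ▸ rfl : f.curryLeft a v - f.curryLeft a' v = f.curryLeft (a - a') v)

lemma abs_alternatingMap_map_basis {E : Type*} [AddCommGroup E] [Module ℝ E] {ι : Type*} [Fintype ι]
    [DecidableEq ι] (b : Module.Basis ι ℝ E) (f : E [⋀^ι]→ₗ[ℝ] ℝ) (D : E →ₗ[ℝ] E) :
    |f fun i => D (b i)| = |LinearMap.det D| * |f b| := by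
  have h1 := congrArg (fun g : E [⋀^ι]→ₗ[ℝ] ℝ => g (D ∘ b)) (f.eq_smul_basis_det b)
  have h2 := b.det_comp D b
  simp only [b.det_self, mul_one] at h2
  simp only [AlternatingMap.smul_apply, h2, smul_eq_mul] at h1
  rw [← abs_mul, mul_comm, ← h1]
  rfl

end AlternatingMaps

/-! ### Wedge powers of a bilinear form and their contractions. -/

section WedgePow

variable {V : Type*} [NormedAddCommGroup V] [NormedSpace ℝ V] (B : V →L[ℝ] V →L[ℝ] ℝ) (n : ℕ)

/-- The multilinear map `B ⊗ ⋯ ⊗ B`. -/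
def tensorPow : MultilinearMap ℝ (fun _ : Fin (2 * n) => V) ℝ where
  toFun w := ∏ i : Fin n, B (w ⟨2 * i, by omega⟩) (w ⟨2 * i + 1, by omega⟩)
  map_update_add' w k x y := by
    -- The slot `k` occurs in the factor with index `k / 2` only, as first or second argument
    -- according to parity; the other factors do not see the update.
    let j : Fin n := ⟨k / 2, by omega⟩
    have hne : ∀ z z', ∀ i ∈ Finset.univ.erase j,
        B (Function.update w k z ⟨2 * i, by omega⟩) (Function.update w k z ⟨2 * i + 1, by omega⟩) =
        B (Function.update w k z' ⟨2 * i, by omega⟩)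
          (Function.update w k z' ⟨2 * i + 1, by omega⟩) := by
      intro z z' i hi
      have hij : (i : ℕ) ≠ k / 2 := fun h => Finset.ne_of_mem_erase hi (Fin.ext h)
      have h1 : (⟨2 * i, by omega⟩ : Fin (2 * n)) ≠ k := fun h => by
        have := congrArg Fin.val h
        simp only at this
        omega
      have h2 : (⟨2 * i + 1, by omega⟩ : Fin (2 * n)) ≠ k := fun h => by
        have := congrArg Fin.val h
        simp only at this
        omega
      simp [Function.update_of_ne h1, Function.update_of_ne h2]
    simp only [← Finset.mul_prod_erase Finset.univ _ (Finset.mem_univ j)]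
    rw [Finset.prod_congr rfl (hne (x + y) y), Finset.prod_congr rfl (hne x y), ← add_mul]
    congr 1
    rcases Nat.even_or_odd' (k : ℕ) with ⟨m, hm | hm⟩
    · have h1 : (⟨2 * j, by omega⟩ : Fin (2 * n)) = k := Fin.ext (by simp only [j]; omega)
      have h2 : (⟨2 * j + 1, by omega⟩ : Fin (2 * n)) ≠ k := fun h => by
        have := congrArg Fin.val h
        simp only [j] at this
        omega
      rw [h1]
      simp [Function.update_of_ne h2]
    · have h1 : (⟨2 * j + 1, by omega⟩ : Fin (2 * n)) = k := Fin.ext (by simp only [j]; omega)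
      have h2 : (⟨2 * j, by omega⟩ : Fin (2 * n)) ≠ k := fun h => by
        have := congrArg Fin.val h
        simp only [j] at this
        omega
      rw [h1]
      simp [Function.update_of_ne h2]
  map_update_smul' w k r x := by
    let j : Fin n := ⟨k / 2, by omega⟩
    have hne : ∀ z z', ∀ i ∈ Finset.univ.erase j,
        B (Function.update w k z ⟨2 * i, by omega⟩) (Function.update w k z ⟨2 * i + 1, by omega⟩) =
        B (Function.update w k z' ⟨2 * i, by omega⟩)
          (Function.update w k z' ⟨2 * i + 1, by omega⟩) := by
      intro z z' i hi
      have hij : (i : ℕ) ≠ k / 2 := fun h => Finset.ne_of_mem_erase hi (Fin.ext h)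
      have h1 : (⟨2 * i, by omega⟩ : Fin (2 * n)) ≠ k := fun h => by
        have := congrArg Fin.val h
        simp only at this
        omega
      have h2 : (⟨2 * i + 1, by omega⟩ : Fin (2 * n)) ≠ k := fun h => by
        have := congrArg Fin.val h
        simp only at this
        omega
      simp [Function.update_of_ne h1, Function.update_of_ne h2]
    simp only [← Finset.mul_prod_erase Finset.univ _ (Finset.mem_univ j)]
    rw [Finset.prod_congr rfl (hne (r • x) x), smul_eq_mul, ← mul_assoc]
    congr 1
    rcases Nat.even_or_odd' (k : ℕ) with ⟨m, hm | hm⟩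
    · have h1 : (⟨2 * j, by omega⟩ : Fin (2 * n)) = k := Fin.ext (by simp only [j]; omega)
      have h2 : (⟨2 * j + 1, by omega⟩ : Fin (2 * n)) ≠ k := fun h => by
        have := congrArg Fin.val h
        simp only [j] at this
        omega
      rw [h1]
      simp [Function.update_of_ne h2]
    · have h1 : (⟨2 * j + 1, by omega⟩ : Fin (2 * n)) = k := Fin.ext (by simp only [j]; omega)
      have h2 : (⟨2 * j, by omega⟩ : Fin (2 * n)) ≠ k := fun h => by
        have := congrArg Fin.val h
        simp only [j] at this
        omega
      rw [h1]
      simp [Function.update_of_ne h2]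

/-- The wedge power of a bilinear form is an alternating map. -/
def wedgePowAlternating : V [⋀^Fin (2 * n)]→ₗ[ℝ] ℝ :=
  (1 / 2 : ℝ) ^ n • MultilinearMap.alternatization (tensorPow B n)

lemma wedgePowAlternating_apply (w : Fin (2 * n) → V) :
    wedgePowAlternating B n w = wedgePow (fun a b => B a b) n w := by
  rw [wedgePowAlternating, AlternatingMap.smul_apply, MultilinearMap.alternatization_apply, wedgePow,
    smul_eq_mul]
  congr 1
  refine Finset.sum_congr rfl fun τ _ => ?_
  rw [Units.smul_def, zsmul_eq_mul]
  rfl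

lemma continuousAt_wedgePow {X : Type*} [TopologicalSpace X] {x₀ : X} {β : X → V →L[ℝ] V →L[ℝ] ℝ}
    {w : X → Fin (2 * n) → V} (hβ : ContinuousAt β x₀) (hw : ∀ i, ContinuousAt (fun x => w x i) x₀) :
    ContinuousAt (fun x => wedgePow (fun a b => β x a b) n (w x)) x₀ := by
  unfold wedgePow
  refine continuousAt_const.mul (tendsto_finsetSum _ fun τ _ => ?_)
  exact continuousAt_const.mul (tendsto_finsetProd _ fun i _ =>
    (hβ.clm_apply (hw _)).clm_apply (hw _))

variable {B n}

/-- Contracting a wedge power of the symplectic form with a vector transverse to the level sets of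
`h` and with `L` gives a form which is invariant under symplectic maps. -/
theorem wedgePow_contract_eq [FiniteDimensional ℝ V] {V' : Type*} [NormedAddCommGroup V']
    [NormedSpace ℝ V'] {d : ℕ} (hdim : Module.finrank ℝ V = 2 * (d + 1))
    {B' : V' →L[ℝ] V' →L[ℝ] ℝ} {h : V →L[ℝ] ℝ} {h' : V' →L[ℝ] ℝ} {A : V' →L[ℝ] V}
    (hB : ∀ a b, B (A a) (A b) = B' a b) (hh : ∀ a, h (A a) = h' a) {N L : V} {N' L' : V'}
    (hN : h N = 1) (hN' : h' N' = 1) (hL : h L = 0) (hAL : A L' = L) {w : Fin (2 * d) → V}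
    {w' : Fin (2 * d) → V'} (hw' : ∀ i, h' (w' i) = 0) (c : Fin (2 * d) → ℝ)
    (hw : ∀ i, w i = A (w' i) + c i • L) :
    wedgePow (fun a b => B a b) (d + 1) (Matrix.vecCons N (Matrix.vecCons L w)) =
      wedgePow (fun a b => B' a b) (d + 1) (Matrix.vecCons N' (Matrix.vecCons L' w')) := by
  have h1 : wedgePow (fun a b => B' a b) (d + 1) (Matrix.vecCons N' (Matrix.vecCons L' w')) =
      wedgePow (fun a b => B a b) (d + 1)
        (fun i => A ((Matrix.vecCons N' (Matrix.vecCons L' w') : Fin (2 * d + 2) → V') i)) := by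
    simp only [wedgePow, hB]
  have h2 : (fun i => A ((Matrix.vecCons N' (Matrix.vecCons L' w') : Fin (2 * d + 2) → V') i)) =
      Matrix.vecCons (A N') (Matrix.vecCons L fun i => A (w' i)) := by
    funext i
    refine Fin.cases rfl (fun i => ?_) i
    exact Fin.cases hAL (fun i => rfl) i
  -- The multiples of `L` in `w` are removed, which leaves images under `A`.
  have h3 : wedgePow (fun a b => B a b) (d + 1) (Matrix.vecCons N (Matrix.vecCons L w)) =
      wedgePow (fun a b => B a b) (d + 1)
        (Matrix.vecCons N (Matrix.vecCons L fun i => A (w' i))) := by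
    rw [← wedgePowAlternating_apply, ← wedgePowAlternating_apply, funext hw]
    exact alternatingMap_add_smul (k := 2 * d) (wedgePowAlternating B (d + 1)) N L _ c
  refine h3.trans (Eq.trans ?_ (h1.trans (congrArg (wedgePow (fun a b => B a b) (d + 1)) h2)).symm)
  rw [← wedgePowAlternating_apply, ← wedgePowAlternating_apply]
  -- `N` and `A N'` have the same value under `h`, and all the other arguments lie in `ker h`, so
  -- `A` need not map `N'` to `N`.
  refine alternatingMap_vecCons_eq (k := 2 * d + 1) hdim (wedgePowAlternating B (d + 1))
    (h : V →ₗ[ℝ] ℝ) ?_ ?_ ?_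
  · exact hN.trans (hN'.symm.trans (hh _).symm)
  · intro h0
    have := congrArg (fun T : V →ₗ[ℝ] ℝ => T N) h0
    simp [hN] at this
  · intro i
    exact Fin.cases hL (fun i => (hh _).trans (hw' i)) i

end WedgePow

/-! ### The measure of a form of top degree, computed in one chart. -/

section ChartMeasures

variable {k : ℕ} {S : Type*} [TopologicalSpace S] [ChartedSpace (EuclideanSpace ℝ (Fin k)) S]
  [MeasurableSpace S]

/-- The density of a form with respect to a chart. -/
def chartDensity (α : ∀ s : S, (Fin k → TangentSpace (𝓡 k) s) → ℝ)
    (e : OpenPartialHomeomorph S (EuclideanSpace ℝ (Fin k))) (y : EuclideanSpace ℝ (Fin k)) : ℝ :=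
  |α (e.symm y) fun i => mfderiv (𝓡 k) (𝓡 k) e.symm y
      (EuclideanSpace.single i (1 : ℝ) : EuclideanSpace ℝ (Fin k))|

variable [BorelSpace S] {α : ∀ s : S, (Fin k → TangentSpace (𝓡 k) s) → ℝ}
  {e e₀ : OpenPartialHomeomorph S (EuclideanSpace ℝ (Fin k))}

-- Nothing is known about `e.symm` outside `e.target`, so measurability is only available almost
-- everywhere for the restricted measure.
omit [ChartedSpace (EuclideanSpace ℝ (Fin k)) S] in
lemma aemeasurable_symm_withDensity (e : OpenPartialHomeomorph S (EuclideanSpace ℝ (Fin k)))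
    (ρ : EuclideanSpace ℝ (Fin k) → ENNReal) :
    AEMeasurable e.symm ((volume.restrict e.target).withDensity ρ) :=
  (e.continuousOn_symm.aemeasurable e.open_target.measurableSet).mono_ac
    (withDensity_absolutelyContinuous _ _)

omit [ChartedSpace (EuclideanSpace ℝ (Fin k)) S] in
lemma measurableSet_target_inter_preimage (e : OpenPartialHomeomorph S (EuclideanSpace ℝ (Fin k)))
    {B : Set S} (hB : MeasurableSet B) : MeasurableSet (e.symm ⁻¹' B ∩ e.target) := by
  have h1 : Measurable (e.target.domRestrict e.symm) := e.continuousOn_symm.domRestrict.measurable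
  have h2 := (MeasurableEmbedding.subtype_coe e.open_target.measurableSet).measurableSet_image.2
    (h1 hB)
  convert h2 using 1
  ext y
  simp [and_comm, domRestrict_apply]

lemma chartMeasure_apply {B : Set S} (hB : MeasurableSet B) :
    chartMeasure α e B =
      ∫⁻ y in e.symm ⁻¹' B ∩ e.target, ENNReal.ofReal (chartDensity α e y) := by
  rw [chartMeasure, Measure.map_apply_of_aemeasurable (aemeasurable_symm_withDensity e _) hB,
    withDensity_apply', Measure.restrict_restrict' e.open_target.measurableSet]
  rfl

variable [IsManifold (𝓡 k) ∞ S]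

omit [MeasurableSpace S] [BorelSpace S] [IsManifold (𝓡 k) ∞ S] in
/-- The densities in two charts differ by the Jacobian determinant. -/
lemma chartDensity_eq (hα : ∀ s, ∃ a : EuclideanSpace ℝ (Fin k) [⋀^Fin k]→ₗ[ℝ] ℝ, ∀ w, α s w = a w)
    (he : e ∈ IsManifold.maximalAtlas (𝓡 k) ∞ S) (he₀ : e₀ ∈ IsManifold.maximalAtlas (𝓡 k) ∞ S)
    {y : EuclideanSpace ℝ (Fin k)} (hy : y ∈ e.target) (hy₀ : e.symm y ∈ e₀.source) :
    DifferentiableAt ℝ (e₀ ∘ e.symm) y ∧ chartDensity α e y =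
      |(fderiv ℝ (e₀ ∘ e.symm) y).det| * chartDensity α e₀ (e₀ (e.symm y)) := by
  have h1 : ContMDiffAt (𝓡 k) (𝓡 k) ∞ e.symm y := contMDiffAt_symm_of_mem_maximalAtlas he hy
  have h2 : ContMDiffAt (𝓡 k) (𝓡 k) ∞ e₀ (e.symm y) := contMDiffAt_of_mem_maximalAtlas he₀ hy₀
  have h3 : ContMDiffAt (𝓡 k) (𝓡 k) ∞ e₀.symm (e₀ (e.symm y)) :=
    contMDiffAt_symm_of_mem_maximalAtlas he₀ (e₀.map_source hy₀)
  have h4 : DifferentiableAt ℝ (e₀ ∘ e.symm) y :=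
    ((h2.comp y h1).contDiffAt).differentiableAt (by simp)
  refine ⟨h4, ?_⟩
  let U : EuclideanSpace ℝ (Fin k) →L[ℝ] EuclideanSpace ℝ (Fin k) :=
    mfderiv (𝓡 k) (𝓡 k) e₀.symm (e₀ (e.symm y))
  let U' : EuclideanSpace ℝ (Fin k) →L[ℝ] EuclideanSpace ℝ (Fin k) := mfderiv (𝓡 k) (𝓡 k) e.symm y
  have hnear : e.symm =ᶠ[𝓝 y] e₀.symm ∘ (e₀ ∘ e.symm) := by
    filter_upwards [h1.continuousAt.eventually_mem (e₀.open_source.mem_nhds hy₀)] with y' hy'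
    exact (e₀.left_inv hy').symm
  have h5 : U' = U.comp (fderiv ℝ (e₀ ∘ e.symm) y) := by
    have h6 := HasMFDerivAt.comp (g := e₀.symm) (f := e₀ ∘ e.symm) y
      (h3.mdifferentiableAt (by simp)).hasMFDerivAt h4.hasFDerivAt.hasMFDerivAt
    exact (h6.congr_of_eventuallyEq hnear).mfderiv
  have h7 : e₀.symm (e₀ (e.symm y)) = e.symm y := e₀.left_inv hy₀
  obtain ⟨a, ha⟩ := hα (e.symm y)
  have h8 : ∀ s : S, s = e.symm y → ∀ w : Fin k → EuclideanSpace ℝ (Fin k),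
      α s w = a w := by
    rintro s rfl w
    exact ha w
  have h9 := abs_alternatingMap_map_basis (EuclideanSpace.basisFun (Fin k) ℝ).toBasis
    (a.compLinearMap (U : EuclideanSpace ℝ (Fin k) →ₗ[ℝ] EuclideanSpace ℝ (Fin k)))
    (fderiv ℝ (e₀ ∘ e.symm) y : EuclideanSpace ℝ (Fin k) →ₗ[ℝ] EuclideanSpace ℝ (Fin k))
  have h10 : chartDensity α e y = |a fun i => U' (EuclideanSpace.single i 1)| :=
    congrArg _ (h8 _ rfl _)
  have h11 : chartDensity α e₀ (e₀ (e.symm y)) = |a fun i => U (EuclideanSpace.single i 1)| :=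
    congrArg _ (h8 _ h7 _)
  rw [h10, h11, h5]
  simpa [Function.comp_def, AlternatingMap.compLinearMap_apply] using h9

omit [IsManifold (𝓡 k) ∞ S] in
/-- On the domain of a chart, the measure given by the form in this chart dominates the measure
given by the form in any other chart. -/
lemma chartMeasure_le
    (hα : ∀ s, ∃ a : EuclideanSpace ℝ (Fin k) [⋀^Fin k]→ₗ[ℝ] ℝ, ∀ w, α s w = a w)
    (he : e ∈ IsManifold.maximalAtlas (𝓡 k) ∞ S) (he₀ : e₀ ∈ IsManifold.maximalAtlas (𝓡 k) ∞ S)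
    {B : Set S} (hB : MeasurableSet B) (hBs : B ⊆ e₀.source) :
    chartMeasure α e B ≤ chartMeasure α e₀ B := by
  rw [chartMeasure_apply hB, chartMeasure_apply hB]
  have hD := measurableSet_target_inter_preimage e hB
  -- The change of variables holds for an arbitrary non-negative density, so no measurability of `α`
  -- enters.
  have key := lintegral_image_eq_lintegral_abs_det_fderiv_mul volume hD
    (f := e₀ ∘ e.symm) (f' := fderiv ℝ (e₀ ∘ e.symm))
    (fun y hy => (chartDensity_eq hα he he₀ hy.2 (hBs hy.1)).1.hasFDerivAt.hasFDerivWithinAt)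
    (fun y hy y' hy' h => e.symm.injOn hy.2 hy'.2 (e₀.injOn (hBs hy.1) (hBs hy'.1) h))
    (fun y => ENNReal.ofReal (chartDensity α e₀ y))
  calc _ = ∫⁻ y in e.symm ⁻¹' B ∩ e.target, ENNReal.ofReal |(fderiv ℝ (e₀ ∘ e.symm) y).det| *
        ENNReal.ofReal (chartDensity α e₀ ((e₀ ∘ e.symm) y)) := by
        refine setLIntegral_congr_fun hD fun y hy => ?_
        simp only [Function.comp_apply]
        rw [← ENNReal.ofReal_mul (abs_nonneg _), (chartDensity_eq hα he he₀ hy.2 (hBs hy.1)).2]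
    _ = _ := key.symm
    _ ≤ _ := by
        refine lintegral_mono_set ?_
        rintro _ ⟨y, hy, rfl⟩
        refine ⟨?_, e₀.map_source (hBs hy.1)⟩
        simp only [mem_preimage, Function.comp_apply, e₀.left_inv (hBs hy.1)]
        exact hy.1

omit [IsManifold (𝓡 k) ∞ S] in
lemma formMeasure_apply_le
    (hα : ∀ s, ∃ a : EuclideanSpace ℝ (Fin k) [⋀^Fin k]→ₗ[ℝ] ℝ, ∀ w, α s w = a w)
    (he₀ : e₀ ∈ IsManifold.maximalAtlas (𝓡 k) ∞ S) {B : Set S} (hB : MeasurableSet B)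
    (hBs : B ⊆ e₀.source) : formMeasure α B ≤ chartMeasure α e₀ B := by
  -- A bound for the supremum must dominate every chart measure on all of `S`. Off the domain of
  -- `e₀` the largest measure is used, and it disappears on subsets of the domain.
  have h1 : formMeasure α ≤ chartMeasure α e₀ + (⊤ : Measure S).restrict e₀.sourceᶜ := by
    refine iSup₂_le fun e he => Measure.le_iff.2 fun B' hB' => ?_
    rw [← measure_inter_add_sdiff B' e₀.open_source.measurableSet, Measure.add_apply,
      Measure.restrict_apply hB']
    refine add_le_add ?_ ?_
    · exact (chartMeasure_le hα he he₀ (hB'.inter e₀.open_source.measurableSet)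
        inter_subset_right).trans (measure_mono inter_subset_left)
    · exact Measure.le_iff.1 le_top _ (hB'.diff e₀.open_source.measurableSet)
  refine (Measure.le_iff.1 h1 B hB).trans ?_
  rw [Measure.add_apply, Measure.restrict_apply hB,
    show B ∩ e₀.sourceᶜ = ∅ from (disjoint_compl_right_iff_subset.2 hBs).inter_eq, measure_empty,
    add_zero]

/-- A form whose densities are locally bounded defines a locally finite measure. -/
theorem isLocallyFiniteMeasure_formMeasure
    (hα : ∀ s, ∃ a : EuclideanSpace ℝ (Fin k) [⋀^Fin k]→ₗ[ℝ] ℝ, ∀ w, α s w = a w)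
    (hbdd : ∀ s : S, ∃ C, ∀ᶠ y in 𝓝 (chartAt (EuclideanSpace ℝ (Fin k)) s s),
      chartDensity α (chartAt (EuclideanSpace ℝ (Fin k)) s) y ≤ C) :
    IsLocallyFiniteMeasure (formMeasure α) where
  finiteAtNhds s := by
    set e₀ := chartAt (EuclideanSpace ℝ (Fin k)) s
    have he₀ : e₀ ∈ IsManifold.maximalAtlas (𝓡 k) ∞ S := IsManifold.chart_mem_maximalAtlas s
    have hs : s ∈ e₀.source := mem_chart_source _ s
    obtain ⟨C, hC⟩ := hbdd s
    obtain ⟨R, hR, hball⟩ := Metric.eventually_nhds_iff_ball.1 hC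
    have hopen := e₀.isOpen_inter_preimage (Metric.isOpen_ball (x := e₀ s) (ε := R))
    refine ⟨_, hopen.mem_nhds ⟨hs, Metric.mem_ball_self hR⟩, ?_⟩
    refine (formMeasure_apply_le hα he₀ hopen.measurableSet inter_subset_left).trans_lt ?_
    rw [chartMeasure_apply hopen.measurableSet]
    calc _ ≤ ∫⁻ y in Metric.ball (e₀ s) R, ENNReal.ofReal C := by
          refine (setLIntegral_mono' (measurableSet_target_inter_preimage e₀ hopen.measurableSet)
            (g := fun _ => ENNReal.ofReal C) fun y hy => ?_).trans (lintegral_mono_set fun y hy => ?_)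
          · have h1 := hy.1.2
            rw [mem_preimage, e₀.right_inv hy.2] at h1
            exact ENNReal.ofReal_le_ofReal (hball y h1)
          · have h1 := hy.1.2
            rwa [mem_preimage, e₀.right_inv hy.2] at h1
      _ < ⊤ := by
          rw [setLIntegral_const]
          exact ENNReal.mul_lt_top ENNReal.ofReal_lt_top measure_ball_lt_top

end ChartMeasures

/-! ### Behaviour of these measures under diffeomorphisms. -/

section Transfer

variable {k : ℕ} {S₁ S₂ : Type*} [TopologicalSpace S₁] [ChartedSpace (EuclideanSpace ℝ (Fin k)) S₁]
  [MeasurableSpace S₁] [BorelSpace S₁] [IsManifold (𝓡 k) ∞ S₁]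
  [TopologicalSpace S₂] [ChartedSpace (EuclideanSpace ℝ (Fin k)) S₂]
  [MeasurableSpace S₂] [BorelSpace S₂] [IsManifold (𝓡 k) ∞ S₂]
  {α₁ : ∀ s : S₁, (Fin k → TangentSpace (𝓡 k) s) → ℝ}
  {α₂ : ∀ s : S₂, (Fin k → TangentSpace (𝓡 k) s) → ℝ}

-- Composing a chart of `S₂` with `φ` gives a chart in the maximal atlas of `S₁`, and the two chart
-- measures correspond exactly. Taking suprema gives one inequality; the other comes from `φ.symm`.
omit [IsManifold (𝓡 k) ∞ S₂] in
lemma formMeasure_le_map (φ : Diffeomorph (𝓡 k) (𝓡 k) S₁ S₂ ∞)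
    (h : ∀ s w, |α₁ s w| = |α₂ (φ s) fun i => mfderiv (𝓡 k) (𝓡 k) φ s (w i)|) :
    formMeasure α₂ ≤ (formMeasure α₁).map φ := by
  refine iSup₂_le fun e he => ?_
  let e' : OpenPartialHomeomorph S₁ (EuclideanSpace ℝ (Fin k)) :=
    φ.toHomeomorph.transOpenPartialHomeomorph e
  have he' : e' ∈ IsManifold.maximalAtlas (𝓡 k) ∞ S₁ := by
    refine e'.mem_maximalAtlas_of_contMDiffOn ?_ ?_
    · exact (contMDiffOn_of_mem_maximalAtlas he).comp φ.contMDiff.contMDiffOn fun _ hx => hx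
    · exact φ.symm.contMDiff.comp_contMDiffOn (contMDiffOn_symm_of_mem_maximalAtlas he)
  have hsymm : ∀ y, φ (e'.symm y) = e.symm y := fun y => φ.apply_symm_apply (e.symm y)
  have hφ : Measurable φ := φ.continuous.measurable
  have key : chartMeasure α₂ e = (chartMeasure α₁ e').map φ := by
    rw [chartMeasure, chartMeasure, AEMeasurable.map_map_of_aemeasurable hφ.aemeasurable
      (aemeasurable_symm_withDensity e' _)]
    have hd : (volume.restrict e.target).withDensity
        (fun y => ENNReal.ofReal (chartDensity α₂ e y)) =
        (volume.restrict e'.target).withDensity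
          (fun y => ENNReal.ofReal (chartDensity α₁ e' y)) := by
      refine withDensity_congr_ae ?_
      filter_upwards [ae_restrict_mem e.open_target.measurableSet] with y hy
      congr 1
      have h1 : MDifferentiableAt (𝓡 k) (𝓡 k) e'.symm y :=
        (contMDiffAt_symm_of_mem_maximalAtlas he' hy).mdifferentiableAt (by simp)
      have h2 : MDifferentiableAt (𝓡 k) (𝓡 k) φ (e'.symm y) :=
        (φ.contMDiff _).mdifferentiableAt (by simp)
      have h3 := (h2.hasMFDerivAt.comp y h1.hasMFDerivAt).congr_of_eventuallyEq
        (f₁ := e.symm) (Filter.Eventually.of_forall fun y => (hsymm y).symm)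
      have h4 : ∀ t : S₂, t = e.symm y → ∀ w : Fin k → EuclideanSpace ℝ (Fin k),
          α₂ t w = α₂ (e.symm y) w := by
        rintro t rfl w
        rfl
      refine Eq.trans ?_ (h (e'.symm y) _).symm
      refine Eq.trans ?_ (congrArg _ (h4 _ (hsymm y) _)).symm
      refine congrArg _ (congrArg (α₂ (e.symm y)) (funext fun i => ?_))
      exact congrArg (fun T : EuclideanSpace ℝ (Fin k) →L[ℝ] EuclideanSpace ℝ (Fin k) =>
        T (EuclideanSpace.single i 1)) h3.mfderiv
    have hf : φ ∘ e'.symm = e.symm := funext hsymm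
    rw [hf]
    exact congrArg (Measure.map e.symm) hd
  rw [key]
  exact Measure.map_mono (le_iSup₂ (f := fun e _ => chartMeasure α₁ e) e' he') hφ

/-- A diffeomorphism that matches two forms up to sign matches the measures. -/
theorem map_formMeasure (φ : Diffeomorph (𝓡 k) (𝓡 k) S₁ S₂ ∞)
    (h : ∀ s w, |α₁ s w| = |α₂ (φ s) fun i => mfderiv (𝓡 k) (𝓡 k) φ s (w i)|) :
    (formMeasure α₁).map φ = formMeasure α₂ := by
  refine le_antisymm ?_ (formMeasure_le_map φ h)
  have h1 : formMeasure α₁ ≤ (formMeasure α₂).map φ.symm := by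
    refine formMeasure_le_map φ.symm fun t w => ?_
    have h2 := HasMFDerivAt.comp t ((φ.contMDiff (φ.symm t)).mdifferentiableAt
      (by simp)).hasMFDerivAt ((φ.symm.contMDiff t).mdifferentiableAt (by simp)).hasMFDerivAt
    have h3 := hasMFDerivAt_unique h2 ((hasMFDerivAt_id t).congr_of_eventuallyEq
      (Filter.Eventually.of_forall fun t => φ.apply_symm_apply t))
    have h4 : ∀ t' : S₂, t' = t → ∀ w w' : Fin k → EuclideanSpace ℝ (Fin k), w' = w →
        |α₂ t' w'| = |α₂ t w| := by
      rintro t' rfl w w' rfl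
      rfl
    refine Eq.trans ?_ (h (φ.symm t) _).symm
    refine (h4 _ (φ.apply_symm_apply t) _ _ (funext fun i => ?_)).symm
    exact congrArg (fun T : EuclideanSpace ℝ (Fin k) →L[ℝ] EuclideanSpace ℝ (Fin k) => T (w i)) h3
  refine (Measure.map_mono h1 φ.continuous.measurable).trans_eq ?_
  rw [Measure.map_map φ.continuous.measurable φ.symm.continuous.measurable]
  have h5 : φ ∘ φ.symm = id := funext φ.apply_symm_apply
  rw [h5, Measure.map_id]

end Transfer

/-! ### Forms induced on transverse sections. -/

section SectionForms

variable {d : ℕ} {F : Type*} [NormedAddCommGroup F] [NormedSpace ℝ F]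
  {HN : Type*} [TopologicalSpace HN] {I : ModelWithCorners ℝ F HN} [I.Boundaryless]
  {N : Type*} [TopologicalSpace N] [ChartedSpace HN N]
  {S : Type*} [TopologicalSpace S] [ChartedSpace (EuclideanSpace ℝ (Fin (2 * d))) S]

variable (d) in
/-- The pull-back by `ι` of the `(d + 1)`-st wedge power of `dθ`, contracted with the vector fields
`X` and `L`, up to a factor `C`. -/
def sectionForm (C : ℝ) (θ : ∀ x : N, TangentSpace I x →L[ℝ] ℝ) (X L : ∀ x : N, TangentSpace I x)
    (ι : S → N) (s : S) (w : Fin (2 * d) → TangentSpace (𝓡 (2 * d)) s) : ℝ :=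
  C * wedgePow (extDerivOneForm θ (ι s)) (d + 1) (Matrix.vecCons (X (ι s))
    (Matrix.vecCons (L (ι s)) fun i => mfderiv (𝓡 (2 * d)) I ι s (w i)))

variable (d) in
/-- `ι` is an immersion into the level set `H = h₀` which is transverse to `L`. -/
structure IsTransverseSection (H : N → ℝ) (h₀ : ℝ) (L : ∀ x : N, TangentSpace I x) (ι : S → N) :
    Prop where
  contMDiff : ContMDiff (𝓡 (2 * d)) I ∞ ι
  ham_eq : ∀ s, H (ι s) = h₀
  injective : ∀ s, Function.Injective (mfderiv (𝓡 (2 * d)) I ι s)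
  transverse : ∀ s w, mfderiv (𝓡 (2 * d)) I ι s w ≠ L (ι s)

variable {C h₀ : ℝ} {θ : ∀ x : N, TangentSpace I x →L[ℝ] ℝ} {H : N → ℝ}
  {X L : ∀ x : N, TangentSpace I x} {ι : S → N} [IsManifold I ∞ N]

lemma IsHamiltonian.sectionForm_eq (h : IsHamiltonian θ H L) (s : S)
    (w : Fin (2 * d) → TangentSpace (𝓡 (2 * d)) s) : sectionForm d C θ X L ι s w =
      C * wedgePow (fun a b : F => sympForm θ (ι s) a b) (d + 1) (Matrix.vecCons (X (ι s))
        (Matrix.vecCons (L (ι s)) fun i => mfderiv (𝓡 (2 * d)) I ι s (w i))) := by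
  have h1 : extDerivOneForm θ (ι s) = fun a b : F => sympForm θ (ι s) a b :=
    funext fun a => funext fun b => h.extDerivOneForm_eq_sympForm _ a b
  exact congrArg (fun B => C * wedgePow B (d + 1) _) h1

/-- Multilinearity and antisymmetry are what make the densities in two charts differ by a Jacobian
determinant. -/
lemma IsHamiltonian.exists_alternatingMap_sectionForm (h : IsHamiltonian θ H L) (s : S) :
    ∃ a : EuclideanSpace ℝ (Fin (2 * d)) [⋀^Fin (2 * d)]→ₗ[ℝ] ℝ,
      ∀ w, sectionForm d C θ X L ι s w = a w := by
  let f : F [⋀^Fin (2 * d + 2)]→ₗ[ℝ] ℝ := wedgePowAlternating (sympForm θ (ι s)) (d + 1)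
  let T : EuclideanSpace ℝ (Fin (2 * d)) →L[ℝ] F := mfderiv (𝓡 (2 * d)) I ι s
  let X₀ : F := X (ι s)
  let L₀ : F := L (ι s)
  refine ⟨C • ((f.curryLeft X₀).curryLeft L₀).compLinearMap
    (T : EuclideanSpace ℝ (Fin (2 * d)) →ₗ[ℝ] F), fun w => ?_⟩
  refine (h.sectionForm_eq s w).trans ?_
  exact congrArg (C * ·) (wedgePowAlternating_apply (sympForm θ (ι s)) (d + 1) _).symm

omit [IsManifold I ∞ N] in
lemma IsTransverseSection.mfderiv_ham (hι : IsTransverseSection d H h₀ L ι)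
    (h : IsHamiltonian θ H L) (s : S) (w : TangentSpace (𝓡 (2 * d)) s) :
    mfderiv I 𝓘(ℝ, ℝ) H (ι s) (mfderiv (𝓡 (2 * d)) I ι s w) = 0 := by
  have h1 := HasMFDerivAt.comp s (h.mdifferentiableAt_ham (ι s)).hasMFDerivAt
    ((hι.contMDiff s).mdifferentiableAt (by simp)).hasMFDerivAt
  have h2 := (hasMFDerivAt_const (I := 𝓡 (2 * d)) (I' := 𝓘(ℝ, ℝ)) h₀ s).congr_of_eventuallyEq
    (f₁ := H ∘ ι) (Filter.Eventually.of_forall hι.ham_eq)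
  exact congrArg (fun T : EuclideanSpace ℝ (Fin (2 * d)) →L[ℝ] ℝ => T w) (hasMFDerivAt_unique h1 h2)

variable [FiniteDimensional ℝ F] [IsManifold (𝓡 (2 * d)) ∞ S]

omit [IsManifold (𝓡 (2 * d)) ∞ S] in
/-- The form induced on a section is preserved by transport along the flow. -/
lemma IsTransported.sectionForm_eq {S' : Type*} [TopologicalSpace S']
    [ChartedSpace (EuclideanSpace ℝ (Fin (2 * d))) S'] {ι' : S' → N} {φ : S' → S} {s : S'}
    (hψ : IsTransported (𝓡 (2 * d)) θ H L ι' s (ι ∘ φ)) (h : IsHamiltonian θ H L)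
    (hdim : Module.finrank ℝ F = 2 * (d + 1))
    (hX : ∀ z, H z = h₀ → mfderiv I 𝓘(ℝ, ℝ) H z (X z) = 1)
    (hι : IsTransverseSection d H h₀ L ι) (hι' : IsTransverseSection d H h₀ L ι')
    (hφ : MDifferentiableAt (𝓡 (2 * d)) (𝓡 (2 * d)) φ s)
    (w : Fin (2 * d) → TangentSpace (𝓡 (2 * d)) s) :
    sectionForm d C θ X L ι (φ s) (fun i => mfderiv (𝓡 (2 * d)) (𝓡 (2 * d)) φ s (w i)) =
      sectionForm d C θ X L ι' s w := by
  obtain ⟨A, c, hd, hB, hH⟩ := hψ.deriv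
  rw [h.sectionForm_eq, h.sectionForm_eq]
  have hcomp : mfderiv (𝓡 (2 * d)) I (ι ∘ φ) s = (mfderiv (𝓡 (2 * d)) I ι (φ s)).comp
      (mfderiv (𝓡 (2 * d)) (𝓡 (2 * d)) φ s) :=
    mfderiv_comp s ((hι.contMDiff _).mdifferentiableAt (by simp)) hφ
  refine congrArg (C * ·) ?_
  -- Only the values `dH(X) = 1` at the two points enter; no relation between `A` and `X` is needed.
  exact wedgePow_contract_eq (V := F) (V' := F) (d := d) hdim (A := A)
    (h := mfderiv I 𝓘(ℝ, ℝ) H (ι (φ s))) (h' := mfderiv I 𝓘(ℝ, ℝ) H (ι' s))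
    (fun a b => (h.extDerivOneForm_eq_sympForm _ _ _).symm.trans
      ((hB a b).trans (h.extDerivOneForm_eq_sympForm _ _ _)))
    hH (hX _ (hι.ham_eq _)) (hX _ (hι'.ham_eq _)) (h.mfderiv_ham_field _) (h.map_field_eq A hB hH)
    (fun i => hι'.mfderiv_ham h s (w i)) (fun i => c (w i))
    (fun i => (congrArg (fun T : EuclideanSpace ℝ (Fin (2 * d)) →L[ℝ] F => T (w i)) hcomp).symm.trans
      (hd (w i)))

/-- The density of the form induced on a section is locally bounded. -/
lemma IsTransverseSection.eventually_chartDensity_le (hι : IsTransverseSection d H h₀ L ι)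
    (h : IsHamiltonian θ H L) (hdim : Module.finrank ℝ F = 2 * (d + 1))
    (hX : ∀ z, H z = h₀ → mfderiv I 𝓘(ℝ, ℝ) H z (X z) = 1) (s : S) :
    ∃ K, ∀ᶠ y in 𝓝 (chartAt (EuclideanSpace ℝ (Fin (2 * d))) s s),
      chartDensity (sectionForm d C θ X L ι) (chartAt (EuclideanSpace ℝ (Fin (2 * d))) s) y ≤ K := by
  set e := chartAt (EuclideanSpace ℝ (Fin (2 * d))) s
  set c := extChartAt I (ι s) with hc
  have he : e ∈ IsManifold.maximalAtlas (𝓡 (2 * d)) ∞ S := IsManifold.chart_mem_maximalAtlas s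
  have hs : s ∈ e.source := mem_chart_source _ s
  have hes : e.symm (e s) = s := e.left_inv hs
  have hcs : ι s ∈ c.source := mem_extChartAt_source _
  let j : EuclideanSpace ℝ (Fin (2 * d)) → F := fun y => c (ι (e.symm y))
  have hιe : ContMDiffAt (𝓡 (2 * d)) I ∞ (fun y => ι (e.symm y)) (e s) :=
    (hι.contMDiff _).comp (e s) (contMDiffAt_symm_of_mem_maximalAtlas he (e.map_source hs))
  have hj : ContDiffAt ℝ ∞ j (e s) := by
    rw [← contMDiffAt_iff_contDiffAt]
    refine ContMDiffAt.comp (e s) (g := c) ?_ hιe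
    simp only [hes]
    exact contMDiffAt_extChartAt_of_mem hcs
  have hjs : j (e s) = c (ι s) := by simp only [j, hes]
  have hnear : ∀ᶠ y in 𝓝 (e s), y ∈ e.target ∧ ι (e.symm y) ∈ c.source := by
    refine (e.open_target.eventually_mem (e.map_source hs)).and (hιe.continuousAt.eventually_mem ?_)
    simp only [hes]
    exact (isOpen_extChartAt_source _).mem_nhds hcs
  -- Continuity of `X` is not assumed. The contracted form depends on `X` only through `dH(X) = 1`,
  -- so `X` is replaced by the constant coordinate vector `v`, rescaled by `(D y v)⁻¹`, and the
  -- resulting expression `G` is continuous at `e s`.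
  let v : F := mfderiv I 𝓘(ℝ, F) c (ι s) (X (ι s))
  let D : EuclideanSpace ℝ (Fin (2 * d)) → F →L[ℝ] ℝ := fun y => fderiv ℝ (H ∘ c.symm) (j y)
  have hHc : ContDiffAt ℝ ∞ (H ∘ c.symm) (j (e s)) := by
    rw [hjs]
    exact (h.contDiffOn_chartHam _).contDiffAt (extChartAt_target_mem_nhds _)
  have hD : ContinuousAt D (e s) :=
    ContinuousAt.comp (g := fderiv ℝ (H ∘ c.symm))
      (hHc.fderiv_right (m := 0) (by simp)).continuousAt hj.continuousAt
  have hDv : D (e s) v ≠ 0 := by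
    have h1 : D (e s) v = 1 := by
      simp only [D, hjs]
      exact (h.fderiv_chartHam_mfderiv _ hcs _).trans (hX _ (hι.ham_eq s))
    rw [h1]
    exact one_ne_zero
  have hDve : ∀ᶠ y in 𝓝 (e s), D y v ≠ 0 := (hD.clm_apply continuousAt_const).eventually_ne hDv
  let G : EuclideanSpace ℝ (Fin (2 * d)) → ℝ := fun y =>
    wedgePow (fun a b : F => dOne (chartForm θ (ι s)) (j y) a b) (d + 1)
      (Matrix.vecCons ((D y v)⁻¹ • v) (Matrix.vecCons (chartField L (ι s) (j y))
        fun i => fderiv ℝ j y (EuclideanSpace.single i (1 : ℝ))))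
  have hG : ContinuousAt G (e s) := by
    refine continuousAt_wedgePow (d + 1) (w := fun y => Matrix.vecCons ((D y v)⁻¹ • v)
      (Matrix.vecCons (chartField L (ι s) (j y))
        fun i => fderiv ℝ j y (EuclideanSpace.single i (1 : ℝ)))) ?_ fun i => ?_
    · refine ContinuousAt.comp (g := dOne (chartForm θ (ι s))) ?_ hj.continuousAt
      rw [hjs]
      exact (contDiffAt_dOne ((h.contDiffOn_form _).contDiffAt
        (extChartAt_target_mem_nhds _))).continuousAt
    · refine Fin.cases ?_ (fun i => ?_) i
      · exact ((hD.clm_apply continuousAt_const).inv₀ hDv).smul continuousAt_const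
      refine Fin.cases ?_ (fun i => ?_) i
      · refine ContinuousAt.comp (g := chartField L (ι s)) ?_ hj.continuousAt
        rw [hjs]
        exact ((h.contDiffOn_chartField _).contDiffAt (extChartAt_target_mem_nhds _)).continuousAt
      · exact (hj.fderiv_right (m := 0) (by simp)).continuousAt.clm_apply continuousAt_const
  have hCG : ContinuousAt (fun y => |C * G y|) (e s) := (continuousAt_const.mul hG).abs
  refine ⟨|C * G (e s)| + 1, ?_⟩
  filter_upwards [hnear, hDve, hCG.eventually_lt continuousAt_const (lt_add_one _)]
    with y hy hyv hyC
  refine le_trans (le_of_eq ?_) hyC.le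
  refine congrArg abs ?_
  rw [h.sectionForm_eq]
  refine congrArg (C * ·) (Eq.symm ?_)
  have hsy : MDifferentiableAt (𝓡 (2 * d)) (𝓡 (2 * d)) e.symm y :=
    (contMDiffAt_symm_of_mem_maximalAtlas he hy.1).mdifferentiableAt (by simp)
  have hιy : MDifferentiableAt (𝓡 (2 * d)) I ι (e.symm y) :=
    (hι.contMDiff _).mdifferentiableAt (by simp)
  have hcy : MDifferentiableAt I 𝓘(ℝ, F) c (ι (e.symm y)) :=
    mdifferentiableAt_extChartAt_of_mem hy.2
  have hjy := (hcy.hasMFDerivAt.comp y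
    (HasMFDerivAt.comp y hιy.hasMFDerivAt hsy.hasMFDerivAt)).mfderiv
  -- Here the symplectic map is the differential of the chart, and no multiples of `L` occur.
  refine wedgePow_contract_eq (V := F) (V' := F) (d := d) hdim
    (A := mfderiv I 𝓘(ℝ, F) c (ι (e.symm y))) (h := D y)
    (h' := mfderiv I 𝓘(ℝ, ℝ) H (ι (e.symm y)))
    (fun a b => (extDerivOneForm_eq_dOne h.contDiffOn_form hy.2 a b).symm.trans
      (h.extDerivOneForm_eq_sympForm _ _ _))
    (fun a => h.fderiv_chartHam_mfderiv _ hy.2 a) ?_ (hX _ (hι.ham_eq _)) ?_ ?_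
    (fun i => hι.mfderiv_ham h _ _) (fun _ => 0) (fun i => ?_)
  · rw [map_smul, smul_eq_mul, inv_mul_cancel₀ hyv]
  · rw [show chartField L (ι s) (j y) = _ from chartField_extChartAt hy.2]
    exact (h.fderiv_chartHam_mfderiv _ hy.2 _).trans (h.mfderiv_ham_field _)
  · exact (chartField_extChartAt hy.2).symm
  · rw [zero_smul, add_zero, ← mfderiv_eq_fderiv]
    exact congrArg (fun T : EuclideanSpace ℝ (Fin (2 * d)) →L[ℝ] F =>
      T (EuclideanSpace.single i 1)) hjy

theorem IsTransverseSection.isLocallyFiniteMeasure [MeasurableSpace S] [BorelSpace S]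
    (hι : IsTransverseSection d H h₀ L ι)
    (h : IsHamiltonian θ H L) (hdim : Module.finrank ℝ F = 2 * (d + 1))
    (hX : ∀ z, H z = h₀ → mfderiv I 𝓘(ℝ, ℝ) H z (X z) = 1) :
    IsLocallyFiniteMeasure (formMeasure (sectionForm d C θ X L ι)) :=
  isLocallyFiniteMeasure_formMeasure h.exists_alternatingMap_sectionForm
    (hι.eventually_chartDensity_le h hdim hX)

/-- Two transverse sections which meet the same integral curves, each of them once, are
diffeomorphic by the flow, and the diffeomorphism preserves the induced forms. -/
theorem IsHamiltonian.exists_diffeomorph [T2Space N] {S' : Type*} [TopologicalSpace S']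
    [ChartedSpace (EuclideanSpace ℝ (Fin (2 * d))) S'] [IsManifold (𝓡 (2 * d)) ∞ S'] {ι' : S' → N}
    (h : IsHamiltonian θ H L) (hdim : Module.finrank ℝ F = 2 * (d + 1))
    (hX : ∀ z, H z = h₀ → mfderiv I 𝓘(ℝ, ℝ) H z (X z) = 1)
    (hι' : IsTransverseSection d H h₀ L ι') (hι : IsTransverseSection d H h₀ L ι)
    (hu : ∀ s : S', ∃! t : S, ι t ∈ integralCurveThrough L (ι' s))
    (hu' : ∀ t : S, ∃! s : S', ι' s ∈ integralCurveThrough L (ι t)) :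
    ∃ φ : Diffeomorph (𝓡 (2 * d)) (𝓡 (2 * d)) S' S ∞,
      (∀ s, ι (φ s) ∈ integralCurveThrough L (ι' s)) ∧
      ∀ s w, sectionForm d C θ X L ι (φ s)
        (fun i => mfderiv (𝓡 (2 * d)) (𝓡 (2 * d)) φ s (w i)) = sectionForm d C θ X L ι' s w := by
  choose φ hφ using fun s => (hu s).exists
  choose φ' hφ' using fun t => (hu' t).exists
  have hφu : ∀ s t, ι t ∈ integralCurveThrough L (ι' s) → t = φ s :=
    fun s t ht => (hu s).unique ht (hφ s)
  have hφu' : ∀ t s, ι' s ∈ integralCurveThrough L (ι t) → s = φ' t :=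
    fun t s hs => (hu' t).unique hs (hφ' t)
  have hE : Module.finrank ℝ (EuclideanSpace ℝ (Fin (2 * d))) + 2 = Module.finrank ℝ F := by
    rw [hdim, finrank_euclideanSpace_fin]
    ring
  have hdH : ∀ z, H z = h₀ → ∃ a, mfderiv I 𝓘(ℝ, ℝ) H z a ≠ 0 := fun z hz =>
    ⟨X z, fun h0 => one_ne_zero (α := ℝ) ((hX z hz).symm.trans h0)⟩
  have key := h.contMDiffAt_and_isTransported hι'.contMDiff hι.contMDiff hι.ham_eq hι.injective
    hι.transverse (fun s => hdH _ (hι.ham_eq s)) hE hφ hφu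
  have key' := h.contMDiffAt_and_isTransported hι.contMDiff hι'.contMDiff hι'.ham_eq hι'.injective
    hι'.transverse (fun s => hdH _ (hι'.ham_eq s)) hE hφ' hφu'
  -- Lying on the same integral curve is a symmetric relation, so uniqueness makes the two maps
  -- inverse to each other.
  refine ⟨⟨⟨φ, φ', fun s => (hφu' _ _ (mem_integralCurveThrough_symm (hφ s))).symm,
    fun t => (hφu _ _ (mem_integralCurveThrough_symm (hφ' t))).symm⟩, fun s => (key s).1,
    fun t => (key' t).1⟩, hφ, fun s w => ?_⟩
  exact (key s).2.sectionForm_eq h hdim hX hι hι' ((key s).1.mdifferentiableAt (by simp)) w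

end SectionForms

/-! ### Hausdorff total spaces. -/

section FiberBundles

/-- This is needed for `TM`, where uniqueness of integral curves requires the Hausdorff property.
Points of one fibre are separated in a trivialization, other pairs by their projections. -/
lemma t2Space_totalSpace {B F : Type*} {E : B → Type*} [TopologicalSpace B] [TopologicalSpace F]
    [TopologicalSpace (Bundle.TotalSpace F E)] [∀ b, TopologicalSpace (E b)] [FiberBundle F E]
    [T2Space B] [T2Space F] : T2Space (Bundle.TotalSpace F E) := by
  refine ⟨fun v w hvw => ?_⟩
  by_cases hp : v.proj = w.proj
  · let e := trivializationAt F E v.proj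
    have hv : v ∈ e.source := FiberBundle.mem_trivializationAt_proj_source
    have hw : w ∈ e.source := by
      rw [e.mem_source, ← hp]
      exact FiberBundle.mem_baseSet_trivializationAt' v.proj
    obtain ⟨U, V, hU, hV, hvU, hwV, hUV⟩ := t2_separation (e.injOn.ne hv hw hvw)
    refine ⟨e.source ∩ e ⁻¹' U, e.source ∩ e ⁻¹' V, e.toOpenPartialHomeomorph.isOpen_inter_preimage hU,
      e.toOpenPartialHomeomorph.isOpen_inter_preimage hV, ⟨hv, hvU⟩, ⟨hw, hwV⟩, ?_⟩
    exact (hUV.preimage e).mono inter_subset_right inter_subset_right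
  · exact separated_by_continuous (FiberBundle.continuous_proj F E) hp

end FiberBundles

/-! ### Existence of the Hamiltonian vector. -/

section Existence

variable {F : Type*} [NormedAddCommGroup F] [NormedSpace ℝ F] [FiniteDimensional ℝ F]
  {HN : Type*} [TopologicalSpace HN] {I : ModelWithCorners ℝ F HN} [I.Boundaryless]
  {N : Type*} [TopologicalSpace N] [ChartedSpace HN N] [IsManifold I ∞ N]

/-- This ensures that the choice in the definition of `liouville` picks an actual solution. An
injective map into the dual of a finite-dimensional space of the same dimension is onto. -/
lemma exists_hamiltonian_vector {θ : ∀ x : N, TangentSpace I x →L[ℝ] ℝ}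
    (hθ : ∀ x : N, ContDiffOn ℝ ∞ (chartForm θ x) (extChartAt I x).target) {x : N}
    (hnd : ∀ b : TangentSpace I x, (∀ a, extDerivOneForm θ x a b = 0) → b = 0)
    (D : TangentSpace I x →L[ℝ] ℝ) :
    ∃ L : TangentSpace I x, ∀ a, D a = extDerivOneForm θ x a L := by
  have hB : ∀ a b : F, extDerivOneForm θ x a b = sympForm θ x a b := fun a b =>
    extDerivOneForm_eq_dOne hθ (mem_extChartAt_source x) a b
  let T : F →ₗ[ℝ] Module.Dual ℝ F :=
    { toFun := fun b => ((sympForm θ x).flip b : F →ₗ[ℝ] ℝ)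
      map_add' := fun b b' => by ext; simp
      map_smul' := fun r b => by ext; simp }
  have hinj : Function.Injective T := by
    rw [← LinearMap.ker_eq_bot, LinearMap.ker_eq_bot']
    intro b hb
    exact hnd b fun a => (hB a b).trans (congrArg (fun S : Module.Dual ℝ F => S a) hb)
  have hsurj := (LinearMap.injective_iff_surjective_of_finrank_eq_finrank
    (Subspace.dual_finrank_eq (K := ℝ) (V := F)).symm).1 hinj
  let D₀ : F →L[ℝ] ℝ := D
  obtain ⟨b, hb⟩ := hsurj (D₀ : F →ₗ[ℝ] ℝ)
  exact ⟨b, fun a => (congrArg (fun S : Module.Dual ℝ F => S a) hb).symm.trans (hB a b).symm⟩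

end Existence

/-! ### Lorentz metrics and the Hamiltonian. -/

section Spacetime

variable {d : ℕ} {M : Type*} [TopologicalSpace M]
  [ChartedSpace (EuclideanSpace ℝ (Fin (d + 1))) M] [IsManifold (𝓡 (d + 1)) ∞ M]

/-- A vector orthogonal to everything is orthogonal to `t`, where the metric is positive definite,
and also to itself. -/
lemma LorentzMetric.nondegenerate (g : LorentzMetric d M) {x : M} {b : TangentSpace (𝓡 (d + 1)) x}
    (hb : ∀ a, g.val x b a = 0) : b = 0 := by
  obtain ⟨t, -, ht⟩ := g.signature x
  by_contra h
  exact (ht b ((g.symm x t b).trans (hb t)) h).ne' (hb b)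

lemma LorentzMetric.contMDiffWithinAt_apply (g : LorentzMetric d M) {EP HP P : Type*}
    [NormedAddCommGroup EP] [NormedSpace ℝ EP] [TopologicalSpace HP] {IP : ModelWithCorners ℝ EP HP}
    [TopologicalSpace P] [ChartedSpace HP P] {b : P → M} {v w : ∀ p, TangentSpace (𝓡 (d + 1)) (b p)}
    {s : Set P} {p : P}
    (hv : ContMDiffWithinAt IP (𝓡 (d + 1)).tangent ∞
      (fun p => (⟨b p, v p⟩ : TangentBundle (𝓡 (d + 1)) M)) s p)
    (hw : ContMDiffWithinAt IP (𝓡 (d + 1)).tangent ∞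
      (fun p => (⟨b p, w p⟩ : TangentBundle (𝓡 (d + 1)) M)) s p) :
    ContMDiffWithinAt IP 𝓘(ℝ, ℝ) ∞ (fun p => g.val (b p) (v p) (w p)) s p := by
  have hb : ContMDiffWithinAt IP (𝓡 (d + 1)) ∞ b s p :=
    (Bundle.contMDiffWithinAt_totalSpace.1 hv).1
  have h : ContMDiffWithinAt IP ((𝓡 (d + 1)).prod 𝓘(ℝ, ℝ)) ∞
      (fun p => Bundle.TotalSpace.mk' ℝ (E := Bundle.Trivial M ℝ) (b p) (g.val (b p) (v p) (w p)))
      s p := by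
    apply ContMDiffWithinAt.clm_bundle_apply₂ (F₁ := EuclideanSpace ℝ (Fin (d + 1)))
      (F₂ := EuclideanSpace ℝ (Fin (d + 1)))
    · exact ContMDiffAt.comp_contMDiffWithinAt p g.contMDiff.contMDiffAt hb
    · exact hv
    · exact hw
  exact (Bundle.contMDiffWithinAt_totalSpace.1 h).2

lemma OneForm.contMDiffWithinAt_apply (A : OneForm d M) {EP HP P : Type*}
    [NormedAddCommGroup EP] [NormedSpace ℝ EP] [TopologicalSpace HP] {IP : ModelWithCorners ℝ EP HP}
    [TopologicalSpace P] [ChartedSpace HP P] {b : P → M} {v : ∀ p, TangentSpace (𝓡 (d + 1)) (b p)}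
    {s : Set P} {p : P}
    (hv : ContMDiffWithinAt IP (𝓡 (d + 1)).tangent ∞
      (fun p => (⟨b p, v p⟩ : TangentBundle (𝓡 (d + 1)) M)) s p) :
    ContMDiffWithinAt IP 𝓘(ℝ, ℝ) ∞ (fun p => A.val (b p) (v p)) s p := by
  have hb : ContMDiffWithinAt IP (𝓡 (d + 1)) ∞ b s p :=
    (Bundle.contMDiffWithinAt_totalSpace.1 hv).1
  have h : ContMDiffWithinAt IP ((𝓡 (d + 1)).prod 𝓘(ℝ, ℝ)) ∞
      (fun p => Bundle.TotalSpace.mk' ℝ (E := Bundle.Trivial M ℝ) (b p) (A.val (b p) (v p)))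
      s p := by
    apply ContMDiffWithinAt.clm_bundle_apply (F₁ := EuclideanSpace ℝ (Fin (d + 1)))
    · exact ContMDiffAt.comp_contMDiffWithinAt p A.contMDiff.contMDiffAt hb
    · exact hv
  exact (Bundle.contMDiffWithinAt_totalSpace.1 h).2

lemma contMDiff_hamiltonian (g : LorentzMetric d M) :
    ContMDiff (𝓡 (d + 1)).tangent 𝓘(ℝ, ℝ) ∞ (hamiltonian g) := by
  intro v
  have h1 : ContMDiffWithinAt (𝓡 (d + 1)).tangent (𝓡 (d + 1)).tangent ∞
      (fun p : TangentBundle (𝓡 (d + 1)) M => (⟨p.proj, p.snd⟩ : TangentBundle (𝓡 (d + 1)) M))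
      univ v := contMDiffWithinAt_id
  have h2 := g.contMDiffWithinAt_apply h1 h1
  rw [contMDiffWithinAt_univ] at h2
  exact (h2.mul (contMDiffAt_const (c := (2 : ℝ)⁻¹))).congr_of_eventuallyEq
    (Filter.Eventually.of_forall fun p => div_eq_mul_inv _ _)

lemma mdifferentiableAt_rescaling (v : TangentBundle (𝓡 (d + 1)) M) :
    MDifferentiableAt 𝓘(ℝ, ℝ) (𝓡 (d + 1)).tangent
      (fun t : ℝ => (⟨v.proj, Real.exp t • v.snd⟩ : TangentBundle (𝓡 (d + 1)) M)) 0 := by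
  have h : ContMDiffAt 𝓘(ℝ, ℝ) (𝓡 (d + 1)).tangent 1
      (fun t : ℝ => (⟨v.proj, Real.exp t • v.snd⟩ : TangentBundle (𝓡 (d + 1)) M)) 0 := by
    rw [Bundle.contMDiffAt_totalSpace]
    refine ⟨contMDiffAt_const, ?_⟩
    let e := trivializationAt (EuclideanSpace ℝ (Fin (d + 1))) (TangentSpace (𝓡 (d + 1)) (M := M)) v.proj
    have h1 : ∀ t : ℝ, (e ⟨v.proj, Real.exp t • v.snd⟩).2 = Real.exp t • (e ⟨v.proj, v.snd⟩).2 :=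
      fun t => (e.linear ℝ (FiberBundle.mem_baseSet_trivializationAt' v.proj)).map_smul _ _
    change ContMDiffAt 𝓘(ℝ, ℝ) 𝓘(ℝ, EuclideanSpace ℝ (Fin (d + 1))) 1
      (fun t : ℝ => (e ⟨v.proj, Real.exp t • v.snd⟩).2) 0
    simp only [h1]
    exact (Real.contDiff_exp.smul contDiff_const).contDiffAt.contMDiffAt
  exact h.mdifferentiableAt (by simp)

/-- Euler's relation for the Hamiltonian. -/
lemma mfderiv_hamiltonian_rescalingField (g : LorentzMetric d M) (v : TangentBundle (𝓡 (d + 1)) M) :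
    mfderiv (𝓡 (d + 1)).tangent 𝓘(ℝ, ℝ) (hamiltonian g) v (rescalingField v) =
      2 * hamiltonian g v := by
  let γ : ℝ → TangentBundle (𝓡 (d + 1)) M := fun t => ⟨v.proj, Real.exp t • v.snd⟩
  have hγ0 : γ 0 = v := by simp [γ]
  have hγ : HasMFDerivAt 𝓘(ℝ, ℝ) (𝓡 (d + 1)).tangent γ 0 _ :=
    (mdifferentiableAt_rescaling v).hasMFDerivAt
  have h1 : HasMFDerivAt 𝓘(ℝ, ℝ) 𝓘(ℝ, ℝ) (hamiltonian g ∘ γ) 0 _ := HasMFDerivAt.comp (0 : ℝ)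
    (((contMDiff_hamiltonian g) (γ 0)).mdifferentiableAt (by simp)).hasMFDerivAt hγ
  have h2 : hamiltonian g ∘ γ = fun t => Real.exp t ^ 2 * hamiltonian g v := by
    funext t
    simp only [Function.comp_apply, hamiltonian, γ, map_smul, smul_apply,
      smul_eq_mul]
    ring
  have h3 : HasDerivAt (hamiltonian g ∘ γ) (2 * hamiltonian g v) 0 := by
    rw [h2]
    have := (((Real.hasDerivAt_exp 0).pow 2).mul_const (hamiltonian g v))
    simpa using this
  have h4 := hasMFDerivAt_unique h1 h3.hasFDerivAt.hasMFDerivAt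
  have h5 : ∀ u : TangentBundle (𝓡 (d + 1)) M, u = v → ∀ X : EuclideanSpace ℝ (Fin (d + 1)) ×
      EuclideanSpace ℝ (Fin (d + 1)),
      (mfderiv (𝓡 (d + 1)).tangent 𝓘(ℝ, ℝ) (hamiltonian g) u X : ℝ) =
        mfderiv (𝓡 (d + 1)).tangent 𝓘(ℝ, ℝ) (hamiltonian g) v X := by
    rintro u rfl X
    rfl
  refine (h5 _ hγ0 _).symm.trans ?_
  refine (congrArg (fun T : ℝ →L[ℝ] ℝ => T 1) h4).trans ?_
  exact one_smul ℝ (2 * hamiltonian g v)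

end Spacetime

/-! ### The Poincaré form in coordinates, and non-degeneracy of the symplectic form. -/

section PoincareForm

variable {d : ℕ} {M : Type*} [TopologicalSpace M]
  [ChartedSpace (EuclideanSpace ℝ (Fin (d + 1))) M] [IsManifold (𝓡 (d + 1)) ∞ M]

lemma tangentBundle_extChartAt_symm (v : TangentBundle (𝓡 (d + 1)) M)
    {y : EuclideanSpace ℝ (Fin (d + 1)) × EuclideanSpace ℝ (Fin (d + 1))}
    (hy : y ∈ (extChartAt (𝓡 (d + 1)).tangent v).target) :
    y.1 ∈ (extChartAt (𝓡 (d + 1)) v.proj).target ∧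
    (extChartAt (𝓡 (d + 1)) v.proj).symm y.1 ∈ (trivializationAt (EuclideanSpace ℝ (Fin (d + 1)))
      (TangentSpace (𝓡 (d + 1)) (M := M)) v.proj).baseSet ∧
    (extChartAt (𝓡 (d + 1)).tangent v).symm y =
      ⟨(extChartAt (𝓡 (d + 1)) v.proj).symm y.1,
        (trivializationAt (EuclideanSpace ℝ (Fin (d + 1))) (TangentSpace (𝓡 (d + 1)) (M := M))
          v.proj).symmL ℝ ((extChartAt (𝓡 (d + 1)) v.proj).symm y.1) y.2⟩ := by
  have h1 := hy
  rw [ModelWithCorners.tangent, FiberBundle.extChartAt_target] at h1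
  refine ⟨h1.1.1, h1.1.2, ?_⟩
  rw [ModelWithCorners.tangent, FiberBundle.extChartAt]
  exact (Bundle.Trivialization.mk_symm (trivializationAt (EuclideanSpace ℝ (Fin (d + 1)))
    (TangentSpace (𝓡 (d + 1)) (M := M)) v.proj) h1.1.2 y.2).symm.trans
    (congrArg (Bundle.TotalSpace.mk _) (Bundle.Trivialization.symmL_apply _ h1.1.2 y.2).symm)

/-- The Poincaré form in the coordinates of the tangent bundle. -/
lemma chartForm_poincareForm (g : LorentzMetric d M) (q : ℝ) (A : OneForm d M)
    (v : TangentBundle (𝓡 (d + 1)) M)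
    {y : EuclideanSpace ℝ (Fin (d + 1)) × EuclideanSpace ℝ (Fin (d + 1))}
    (hy : y ∈ (extChartAt (𝓡 (d + 1)).tangent v).target)
    (X : EuclideanSpace ℝ (Fin (d + 1)) × EuclideanSpace ℝ (Fin (d + 1))) :
    chartForm (poincareForm g q A) v y X =
      g.val ((extChartAt (𝓡 (d + 1)) v.proj).symm y.1)
        ((trivializationAt (EuclideanSpace ℝ (Fin (d + 1))) (TangentSpace (𝓡 (d + 1)) (M := M))
          v.proj).symmL ℝ ((extChartAt (𝓡 (d + 1)) v.proj).symm y.1) y.2)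
        (mfderiv 𝓘(ℝ, EuclideanSpace ℝ (Fin (d + 1))) (𝓡 (d + 1))
          (extChartAt (𝓡 (d + 1)) v.proj).symm y.1 X.1) +
      q * A.val ((extChartAt (𝓡 (d + 1)) v.proj).symm y.1)
        (mfderiv 𝓘(ℝ, EuclideanSpace ℝ (Fin (d + 1))) (𝓡 (d + 1))
          (extChartAt (𝓡 (d + 1)) v.proj).symm y.1 X.1) := by
  obtain ⟨h1, h2, h3⟩ := tangentBundle_extChartAt_symm v hy
  have hc : HasMFDerivAt 𝓘(ℝ, EuclideanSpace ℝ (Fin (d + 1)) × EuclideanSpace ℝ (Fin (d + 1)))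
      (𝓡 (d + 1)).tangent (extChartAt (𝓡 (d + 1)).tangent v).symm y _ :=
    (mdifferentiableAt_extChartAt_symm_of_mem hy).hasMFDerivAt
  have hπ : MDifferentiableAt (𝓡 (d + 1)).tangent (𝓡 (d + 1))
      (fun w : TangentBundle (𝓡 (d + 1)) M => w.proj) ((extChartAt (𝓡 (d + 1)).tangent v).symm y) :=
    (Bundle.contMDiffAt_proj (TangentSpace (𝓡 (d + 1)) (M := M)) (n := 1)).mdifferentiableAt (by simp)
  have h4 := hπ.hasMFDerivAt.comp y hc
  have h5 : HasMFDerivAt 𝓘(ℝ, EuclideanSpace ℝ (Fin (d + 1)) × EuclideanSpace ℝ (Fin (d + 1)))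
      (𝓡 (d + 1)) (fun y : EuclideanSpace ℝ (Fin (d + 1)) × EuclideanSpace ℝ (Fin (d + 1)) =>
        (extChartAt (𝓡 (d + 1)) v.proj).symm y.1) y _ :=
    HasMFDerivAt.comp y (mdifferentiableAt_extChartAt_symm_of_mem h1).hasMFDerivAt
      hasFDerivAt_fst.hasMFDerivAt
  have h6 := h5.congr_of_eventuallyEq (f₁ := (fun w : TangentBundle (𝓡 (d + 1)) M => w.proj) ∘
      (extChartAt (𝓡 (d + 1)).tangent v).symm) (by
    filter_upwards [(isOpen_extChartAt_target v).mem_nhds hy] with y' hy'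
    exact congrArg Bundle.TotalSpace.proj (tangentBundle_extChartAt_symm v hy').2.2)
  have h7 := hasMFDerivAt_unique h4 h6
  have key : ∀ z : TangentBundle (𝓡 (d + 1)) M, z = (extChartAt (𝓡 (d + 1)).tangent v).symm y →
      ∀ W W' : EuclideanSpace ℝ (Fin (d + 1)), W' = W →
      (g.val ((extChartAt (𝓡 (d + 1)).tangent v).symm y).proj
        ((extChartAt (𝓡 (d + 1)).tangent v).symm y).snd +
        q • A.val ((extChartAt (𝓡 (d + 1)).tangent v).symm y).proj) W' =
      g.val z.proj z.snd W + q * A.val z.proj W := by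
    rintro z rfl W W' rfl
    rfl
  exact key _ h3.symm _ _ (congrArg (fun T : EuclideanSpace ℝ (Fin (d + 1)) ×
    EuclideanSpace ℝ (Fin (d + 1)) →L[ℝ] EuclideanSpace ℝ (Fin (d + 1)) => T X) h7)

lemma contDiffOn_chartForm_poincareForm (g : LorentzMetric d M) (q : ℝ) (A : OneForm d M)
    (v : TangentBundle (𝓡 (d + 1)) M) :
    ContDiffOn ℝ ∞ (chartForm (poincareForm g q A) v) (extChartAt (𝓡 (d + 1)).tangent v).target := by
  have : IsManifold (𝓡 (d + 1)) 1 M := IsManifold.of_le (n := ∞) (by simp)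
  refine contDiffOn_clm_apply.2 fun X => ?_
  set c := extChartAt (𝓡 (d + 1)).tangent v
  set φ := extChartAt (𝓡 (d + 1)) v.proj
  set e := trivializationAt (EuclideanSpace ℝ (Fin (d + 1))) (TangentSpace (𝓡 (d + 1)) (M := M)) v.proj
  have hp : ContMDiffOn 𝓘(ℝ, EuclideanSpace ℝ (Fin (d + 1)) × EuclideanSpace ℝ (Fin (d + 1)))
      (𝓡 (d + 1)).tangent ∞
      (fun y => (⟨φ.symm y.1, e.symmL ℝ (φ.symm y.1) y.2⟩ : TangentBundle (𝓡 (d + 1)) M))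
      c.target :=
    (contMDiffOn_extChartAt_symm v).congr fun y hy => (tangentBundle_extChartAt_symm v hy).2.2.symm
  -- The coordinate vector field is the image of a constant section under the tangent map of the
  -- inverse chart.
  have hW : ContMDiffOn 𝓘(ℝ, EuclideanSpace ℝ (Fin (d + 1)) × EuclideanSpace ℝ (Fin (d + 1)))
      (𝓡 (d + 1)).tangent ∞
      (fun y => (⟨φ.symm y.1, mfderiv 𝓘(ℝ, EuclideanSpace ℝ (Fin (d + 1))) (𝓡 (d + 1)) φ.symm y.1
        X.1⟩ : TangentBundle (𝓡 (d + 1)) M)) c.target := by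
    have h1 := (contMDiffOn_extChartAt_symm (I := 𝓡 (d + 1)) (n := ∞)
      v.proj).contMDiffOn_tangentMapWithin (m := ∞) (by simp)
      (isOpen_extChartAt_target v.proj).uniqueMDiffOn
    have h2 : ContMDiffOn 𝓘(ℝ, EuclideanSpace ℝ (Fin (d + 1)))
        𝓘(ℝ, EuclideanSpace ℝ (Fin (d + 1))).tangent ∞
        (fun u => (⟨u, X.1⟩ : TangentBundle 𝓘(ℝ, EuclideanSpace ℝ (Fin (d + 1)))
          (EuclideanSpace ℝ (Fin (d + 1))))) φ.target := fun u _ =>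
      contMDiffWithinAt_vectorSpace_iff_contDiffWithinAt.2 contDiffWithinAt_const
    have h3 := (h1.comp h2 fun u hu => hu).comp
      (contDiff_fst.contMDiff.contMDiffOn (s := c.target))
      fun y hy => (tangentBundle_extChartAt_symm v hy).1
    refine h3.congr fun y hy => ?_
    have h4 : mfderivWithin 𝓘(ℝ, EuclideanSpace ℝ (Fin (d + 1))) (𝓡 (d + 1)) φ.symm φ.target y.1 =
        mfderiv 𝓘(ℝ, EuclideanSpace ℝ (Fin (d + 1))) (𝓡 (d + 1)) φ.symm y.1 :=
      mfderivWithin_of_mem_nhds ((isOpen_extChartAt_target v.proj).mem_nhds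
        (tangentBundle_extChartAt_symm v hy).1)
    simp only [Function.comp_apply, tangentMapWithin]
    rw [h4]
  have h1 : ContMDiffOn 𝓘(ℝ, EuclideanSpace ℝ (Fin (d + 1)) × EuclideanSpace ℝ (Fin (d + 1)))
      𝓘(ℝ, ℝ) ∞ (fun y => g.val (φ.symm y.1) (e.symmL ℝ (φ.symm y.1) y.2)
        (mfderiv 𝓘(ℝ, EuclideanSpace ℝ (Fin (d + 1))) (𝓡 (d + 1)) φ.symm y.1 X.1) +
        q * A.val (φ.symm y.1)
          (mfderiv 𝓘(ℝ, EuclideanSpace ℝ (Fin (d + 1))) (𝓡 (d + 1)) φ.symm y.1 X.1)) c.target :=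
    fun y hy => (g.contMDiffWithinAt_apply (hp y hy) (hW y hy)).add
      (contMDiffWithinAt_const.mul (A.contMDiffWithinAt_apply (hW y hy)))
  exact h1.contDiffOn.congr fun y hy => chartForm_poincareForm g q A v hy X

/-- The symplectic form, in coordinates, on a pair of vectors the second of which is vertical. -/
lemma dOne_chartForm_poincareForm (g : LorentzMetric d M) (q : ℝ) (A : OneForm d M)
    (v : TangentBundle (𝓡 (d + 1)) M)
    {y : EuclideanSpace ℝ (Fin (d + 1)) × EuclideanSpace ℝ (Fin (d + 1))}
    (hy : y ∈ (extChartAt (𝓡 (d + 1)).tangent v).target)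
    (X : EuclideanSpace ℝ (Fin (d + 1)) × EuclideanSpace ℝ (Fin (d + 1)))
    (b : EuclideanSpace ℝ (Fin (d + 1))) :
    dOne (chartForm (poincareForm g q A) v) y X (0, b) =
      -g.val ((extChartAt (𝓡 (d + 1)) v.proj).symm y.1)
        ((trivializationAt (EuclideanSpace ℝ (Fin (d + 1))) (TangentSpace (𝓡 (d + 1)) (M := M))
          v.proj).symmL ℝ ((extChartAt (𝓡 (d + 1)) v.proj).symm y.1) b)
        (mfderiv 𝓘(ℝ, EuclideanSpace ℝ (Fin (d + 1))) (𝓡 (d + 1))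
          (extChartAt (𝓡 (d + 1)) v.proj).symm y.1 X.1) := by
  have hnhds := (isOpen_extChartAt_target v).mem_nhds hy
  have hθ : DifferentiableAt ℝ (chartForm (poincareForm g q A) v) y :=
    ((contDiffOn_chartForm_poincareForm g q A v).contDiffAt hnhds).differentiableAt (by simp)
  have h0 : ∀ Y, HasFDerivAt (fun y' => chartForm (poincareForm g q A) v y' Y)
      ((fderiv ℝ (chartForm (poincareForm g q A) v) y).flip Y) y := fun Y => by
    simpa using hθ.hasFDerivAt.clm_apply (hasFDerivAt_const Y y)
  -- `Θ` annihilates vertical vectors, so this half of the antisymmetrization is the derivative of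
  -- zero.
  have h1 : fderiv ℝ (chartForm (poincareForm g q A) v) y X (0, b) = 0 := by
    have h2 : HasFDerivAt (fun y' => chartForm (poincareForm g q A) v y' (0, b))
        (0 : EuclideanSpace ℝ (Fin (d + 1)) × EuclideanSpace ℝ (Fin (d + 1)) →L[ℝ] ℝ) y := by
      refine (hasFDerivAt_const (0 : ℝ) y).congr_of_eventuallyEq ?_
      filter_upwards [hnhds] with y' hy'
      rw [chartForm_poincareForm g q A v hy']
      have key : ∀ (x : M) (p : TangentSpace (𝓡 (d + 1)) x)
          (R : EuclideanSpace ℝ (Fin (d + 1)) →L[ℝ] TangentSpace (𝓡 (d + 1)) x),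
          g.val x p (R 0) + q * A.val x (R 0) = 0 := by simp
      exact key _ _ _
    exact congrArg (fun T : _ →L[ℝ] ℝ => T X) ((h0 (0, b)).unique h2)
  -- Along a fibre `Θ` is affine: the metric term is linear in the momentum and the potential term
  -- is constant.
  have h3 : fderiv ℝ (chartForm (poincareForm g q A) v) y (0, b) X =
      g.val ((extChartAt (𝓡 (d + 1)) v.proj).symm y.1)
        ((trivializationAt (EuclideanSpace ℝ (Fin (d + 1))) (TangentSpace (𝓡 (d + 1)) (M := M))
          v.proj).symmL ℝ ((extChartAt (𝓡 (d + 1)) v.proj).symm y.1) b)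
        (mfderiv 𝓘(ℝ, EuclideanSpace ℝ (Fin (d + 1))) (𝓡 (d + 1))
          (extChartAt (𝓡 (d + 1)) v.proj).symm y.1 X.1) := by
    have hline : HasDerivAt (fun t : ℝ => y + t • ((0 : EuclideanSpace ℝ (Fin (d + 1))), b))
        ((0 : EuclideanSpace ℝ (Fin (d + 1))), b) 0 := by
      simpa using ((hasDerivAt_id (0 : ℝ)).smul_const
        ((0 : EuclideanSpace ℝ (Fin (d + 1))), b)).const_add y
    have h4 : HasDerivAt (fun t : ℝ => chartForm (poincareForm g q A) v
        (y + t • ((0 : EuclideanSpace ℝ (Fin (d + 1))), b)) X)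
        (fderiv ℝ (chartForm (poincareForm g q A) v) y (0, b) X) 0 := by
      have h5 : HasFDerivAt (fun y' => chartForm (poincareForm g q A) v y' X)
          ((fderiv ℝ (chartForm (poincareForm g q A) v) y).flip X)
          (y + (0 : ℝ) • ((0 : EuclideanSpace ℝ (Fin (d + 1))), b)) := by
        simpa using h0 X
      exact h5.comp_hasDerivAt (0 : ℝ) hline
    have hev : ∀ᶠ t in 𝓝 (0 : ℝ), y + t • ((0 : EuclideanSpace ℝ (Fin (d + 1))), b) ∈
        (extChartAt (𝓡 (d + 1)).tangent v).target :=
      hline.continuousAt.eventually_mem (by simpa using hnhds)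
    have h5 : HasDerivAt (fun t : ℝ => chartForm (poincareForm g q A) v
        (y + t • ((0 : EuclideanSpace ℝ (Fin (d + 1))), b)) X)
        (g.val ((extChartAt (𝓡 (d + 1)) v.proj).symm y.1)
        ((trivializationAt (EuclideanSpace ℝ (Fin (d + 1))) (TangentSpace (𝓡 (d + 1)) (M := M))
          v.proj).symmL ℝ ((extChartAt (𝓡 (d + 1)) v.proj).symm y.1) b)
        (mfderiv 𝓘(ℝ, EuclideanSpace ℝ (Fin (d + 1))) (𝓡 (d + 1))
          (extChartAt (𝓡 (d + 1)) v.proj).symm y.1 X.1)) 0 := by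
      have h6 := ((hasDerivAt_id (0 : ℝ)).mul_const (g.val ((extChartAt (𝓡 (d + 1)) v.proj).symm y.1)
        ((trivializationAt (EuclideanSpace ℝ (Fin (d + 1))) (TangentSpace (𝓡 (d + 1)) (M := M))
          v.proj).symmL ℝ ((extChartAt (𝓡 (d + 1)) v.proj).symm y.1) b)
        (mfderiv 𝓘(ℝ, EuclideanSpace ℝ (Fin (d + 1))) (𝓡 (d + 1))
          (extChartAt (𝓡 (d + 1)) v.proj).symm y.1 X.1))).const_add
          (chartForm (poincareForm g q A) v y X)
      rw [one_mul] at h6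
      refine h6.congr_of_eventuallyEq ?_
      filter_upwards [hev] with t ht
      have hyt : y + t • ((0 : EuclideanSpace ℝ (Fin (d + 1))), b) = (y.1, y.2 + t • b) :=
        Prod.ext (by simp) (by simp)
      rw [hyt] at ht
      simp only [hyt]
      rw [chartForm_poincareForm g q A v ht, chartForm_poincareForm g q A v hy]
      simp only [map_add, map_smul, add_apply, smul_apply, smul_eq_mul, id]
      ring
    exact h4.unique h5
  rw [dOne_apply, h1, h3, zero_sub]

/-- Pairing with vertical vectors shows that the base component of `Y` is zero, since `g` is
non-degenerate. Then `Y` is vertical, and pairing with vectors over all base directions shows that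
its fibre component is zero. Both pairings contain a vertical vector, so the potential plays no
role. -/
lemma symplecticForm_nondegenerate (g : LorentzMetric d M) (q : ℝ) (A : OneForm d M)
    (v : TangentBundle (𝓡 (d + 1)) M) (Y : TangentSpace (𝓡 (d + 1)).tangent v)
    (hY : ∀ X, extDerivOneForm (poincareForm g q A) v X Y = 0) : Y = 0 := by
  have hv : v ∈ (extChartAt (𝓡 (d + 1)).tangent v).source := mem_extChartAt_source v
  have hy := mem_extChartAt_target (I := (𝓡 (d + 1)).tangent) v
  set c := extChartAt (𝓡 (d + 1)).tangent v with hc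
  obtain ⟨h1, h2, -⟩ := tangentBundle_extChartAt_symm v hy
  set φ := extChartAt (𝓡 (d + 1)) v.proj with hφ
  set e := trivializationAt (EuclideanSpace ℝ (Fin (d + 1))) (TangentSpace (𝓡 (d + 1)) (M := M)) v.proj
  let R : EuclideanSpace ℝ (Fin (d + 1)) → TangentSpace (𝓡 (d + 1)) (φ.symm (c v).1) :=
    mfderiv 𝓘(ℝ, EuclideanSpace ℝ (Fin (d + 1))) (𝓡 (d + 1)) φ.symm (c v).1
  let T := (e.continuousLinearEquivAt ℝ _ h2).symm
  have hT : ∀ w, T w = e.symmL ℝ (φ.symm (c v).1) w := fun w =>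
    congrFun (e.symm_continuousLinearEquivAt_eq h2) w
  have hx := φ.map_target h1
  have hRl : ∀ a, mfderiv (𝓡 (d + 1)) 𝓘(ℝ, EuclideanSpace ℝ (Fin (d + 1))) φ (φ.symm (c v).1)
      (R a) = a := by
    intro a
    have h3 := mfderiv_extChartAt_mfderiv_symm hx a
    rw [← hφ, φ.right_inv h1] at h3
    exact h3
  have hRr : ∀ a, ∃ a', R a' = a := by
    intro a
    have h3 := mfderiv_extChartAt_symm_mfderiv hx a
    rw [← hφ, φ.right_inv h1] at h3
    exact ⟨_, h3⟩
  let Z : EuclideanSpace ℝ (Fin (d + 1)) × EuclideanSpace ℝ (Fin (d + 1)) :=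
    mfderiv (𝓡 (d + 1)).tangent 𝓘(ℝ, EuclideanSpace ℝ (Fin (d + 1)) ×
      EuclideanSpace ℝ (Fin (d + 1))) c v Y
  have hZ : ∀ X, dOne (chartForm (poincareForm g q A) v) (c v) X Z = 0 := by
    intro X
    have h3 := extDerivOneForm_eq_dOne (contDiffOn_chartForm_poincareForm g q A) hv
      (mfderiv 𝓘(ℝ, EuclideanSpace ℝ (Fin (d + 1)) × EuclideanSpace ℝ (Fin (d + 1)))
        (𝓡 (d + 1)).tangent c.symm (c v) X) Y
    refine Eq.trans ?_ (h3.symm.trans (hY _))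
    exact congrArg (fun W => dOne (chartForm (poincareForm g q A) v) (c v) W Z)
      (mfderiv_extChartAt_mfderiv_symm hv X).symm
  have hZ1 : Z.1 = 0 := by
    have h3 : R Z.1 = 0 := by
      refine g.nondegenerate fun a => ?_
      have h4 := hZ (0, T.symm a)
      rw [dOne_swap, neg_eq_zero, dOne_chartForm_poincareForm g q A v hy, neg_eq_zero] at h4
      rw [g.symm]
      refine Eq.trans ?_ h4
      refine congrArg (fun w => g.val _ w (R Z.1)) ?_
      exact (T.apply_symm_apply a).symm.trans (hT _)
    have h4 := hRl Z.1
    rw [h3] at h4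
    exact h4.symm.trans (map_zero _)
  have hZ2 : Z.2 = 0 := by
    have h3 : T Z.2 = 0 := by
      refine g.nondegenerate fun a => ?_
      obtain ⟨a', rfl⟩ := hRr a
      have h4 := hZ (a', 0)
      rw [show Z = (0, Z.2) from Prod.ext hZ1 rfl, dOne_chartForm_poincareForm g q A v hy,
        neg_eq_zero] at h4
      rw [hT]
      exact h4
    exact (map_eq_zero_iff T T.injective).1 h3
  have hZ0 : Z = 0 := Prod.ext hZ1 hZ2
  have h3 := mfderiv_extChartAt_symm_mfderiv hv Y
  refine h3.symm.trans ?_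
  exact (congrArg (mfderiv 𝓘(ℝ, EuclideanSpace ℝ (Fin (d + 1)) × EuclideanSpace ℝ (Fin (d + 1)))
        (𝓡 (d + 1)).tangent c.symm (c v)) hZ0).trans (map_zero _)

/-- The Liouville vector field is the Hamiltonian vector field of `H`. -/
theorem isHamiltonian_liouville (g : LorentzMetric d M) (q : ℝ) (A : OneForm d M) :
    IsHamiltonian (poincareForm g q A) (hamiltonian g) (liouville g q A) where
  contDiffOn_form := contDiffOn_chartForm_poincareForm g q A
  contMDiff_ham := contMDiff_hamiltonian g
  nondegenerate := symplecticForm_nondegenerate g q A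
  ham_eq v := Classical.epsilon_spec (exists_hamiltonian_vector
    (contDiffOn_chartForm_poincareForm g q A) (symplecticForm_nondegenerate g q A v)
    (mfderiv (𝓡 (d + 1)).tangent 𝓘(ℝ, ℝ) (hamiltonian g) v))

end PoincareForm

/-! ### Cross sections of the mass shell. -/

section MassShell

variable {d : ℕ} {M : Type*} [TopologicalSpace M]
  [ChartedSpace (EuclideanSpace ℝ (Fin (d + 1))) M] [IsManifold (𝓡 (d + 1)) ∞ M]
  {S : Type*} [TopologicalSpace S] [ChartedSpace (EuclideanSpace ℝ (Fin (2 * d))) S]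
  {g : LorentzMetric d M} {T : TimeOrientation g} {m q : ℝ} {A : OneForm d M}
  {ι : S → TangentBundle (𝓡 (d + 1)) M}

lemma IsCrossSection.isTransverseSection [IsManifold (𝓡 (2 * d)) ∞ S]
    (h : IsCrossSection g T m q A ι) :
    IsTransverseSection d (hamiltonian g) (-m ^ 2 / 2) (liouville g q A) ι where
  contMDiff := h.isSmoothEmbedding.contMDiff
  ham_eq s := (h.mem_massShell s).1
  injective s := injective_mfderiv_of_isImmersionAt (h.isSmoothEmbedding.isImmersion.isImmersionAt s)
  transverse := h.transverse

/-- The vector field `X / (2H)` on the tangent bundle, where `X` generates the rescalings of the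
fibres. -/
def normalField (g : LorentzMetric d M) (v : TangentBundle (𝓡 (d + 1)) M) :
    TangentSpace (𝓡 (d + 1)).tangent v :=
  (2 * hamiltonian g v)⁻¹ • rescalingField v

/-- Since `H` is quadratic on the fibres, Euler's relation gives `dH(X) = 2H`. -/
lemma mfderiv_hamiltonian_normalField {v : TangentBundle (𝓡 (d + 1)) M} (hv : hamiltonian g v ≠ 0) :
    mfderiv (𝓡 (d + 1)).tangent 𝓘(ℝ, ℝ) (hamiltonian g) v (normalField g v) = 1 := by
  refine (map_smul (mfderiv (𝓡 (d + 1)).tangent 𝓘(ℝ, ℝ) (hamiltonian g) v) _ _).trans ?_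
  refine (congrArg (fun r : ℝ => (2 * hamiltonian g v)⁻¹ • r)
    (mfderiv_hamiltonian_rescalingField g v)).trans ?_
  exact inv_mul_cancel₀ (mul_ne_zero two_ne_zero hv)

lemma inducedMeasure_eq [MeasurableSpace S] : inducedMeasure g q A ι =
    formMeasure (sectionForm d ((-1) ^ ((d + 1) * d / 2) / (Nat.factorial (d + 1) : ℝ))
      (poincareForm g q A) (normalField g) (liouville g q A) ι) :=
  rfl

end MassShell

end Kinetic

end

theorem mainTheorem9 {d : ℕ} {M : Type*} [TopologicalSpace M] [T2Space M]
    [SecondCountableTopology M] [ChartedSpace (EuclideanSpace ℝ (Fin (d + 1))) M]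
    [IsManifold (𝓡 (d + 1)) ∞ M]
    (g : Kinetic.LorentzMetric d M) (T : Kinetic.TimeOrientation g)
    (q : ℝ) (A : Kinetic.OneForm d M) (m : ℝ) (hm : 0 < m)
    {S₁ S₂ : Type*}
    [TopologicalSpace S₁] [T2Space S₁] [SecondCountableTopology S₁]
    [ChartedSpace (EuclideanSpace ℝ (Fin (2 * d))) S₁] [IsManifold (𝓡 (2 * d)) ∞ S₁]
    [MeasurableSpace S₁] [BorelSpace S₁]
    [TopologicalSpace S₂] [T2Space S₂] [SecondCountableTopology S₂]
    [ChartedSpace (EuclideanSpace ℝ (Fin (2 * d))) S₂] [IsManifold (𝓡 (2 * d)) ∞ S₂]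
    [MeasurableSpace S₂] [BorelSpace S₂]
    (ι₁ : S₁ → TangentBundle (𝓡 (d + 1)) M) (ι₂ : S₂ → TangentBundle (𝓡 (d + 1)) M)
    (h₁ : Kinetic.IsCrossSection g T m q A ι₁) (h₂ : Kinetic.IsCrossSection g T m q A ι₂) :
    ∃ φ : Diffeomorph (𝓡 (2 * d)) (𝓡 (2 * d)) S₁ S₂ ∞,
      (∀ s : S₁, ι₂ (φ s) ∈ Kinetic.integralCurveThrough (Kinetic.liouville g q A) (ι₁ s)) ∧
      ∀ f : S₂ → ℝ, ContMDiff (𝓡 (2 * d)) 𝓘(ℝ, ℝ) ∞ f → HasCompactSupport f →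
        Integrable f (Kinetic.inducedMeasure g q A ι₂) ∧
        Integrable (fun s => f (φ s)) (Kinetic.inducedMeasure g q A ι₁) ∧
        ∫ s, f s ∂(Kinetic.inducedMeasure g q A ι₂) =
          ∫ s, f (φ s) ∂(Kinetic.inducedMeasure g q A ι₁) := by
  have : T2Space (TangentBundle (𝓡 (d + 1)) M) := Kinetic.t2Space_totalSpace
  have hH := Kinetic.isHamiltonian_liouville g q A
  have hdim : Module.finrank ℝ (EuclideanSpace ℝ (Fin (d + 1)) × EuclideanSpace ℝ (Fin (d + 1))) =
      2 * (d + 1) := by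
    rw [Module.finrank_prod, finrank_euclideanSpace_fin]
    ring
  have hX : ∀ v : TangentBundle (𝓡 (d + 1)) M, Kinetic.hamiltonian g v = -m ^ 2 / 2 →
      mfderiv (𝓡 (d + 1)).tangent 𝓘(ℝ, ℝ) (Kinetic.hamiltonian g) v (Kinetic.normalField g v) = 1 := by
    intro v hv
    -- Positivity of `m` makes `H = -m² / 2` non-zero on the mass shell.
    refine Kinetic.mfderiv_hamiltonian_normalField ?_
    rw [hv]
    have := pow_pos hm 2
    linarith
  have hι₁ := h₁.isTransverseSection
  have hι₂ := h₂.isTransverseSection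
  -- Each section lies in the mass shell, so the integral curve through any of its points meets the
  -- other section exactly once.
  obtain ⟨φ, hφ, hform⟩ := hH.exists_diffeomorph
    (C := (-1) ^ ((d + 1) * d / 2) / (Nat.factorial (d + 1) : ℝ)) hdim hX hι₁ hι₂
    (fun s => h₂.existsUnique _ (h₁.mem_massShell s))
    (fun t => h₁.existsUnique _ (h₂.mem_massShell t))
  have hmap : (Kinetic.inducedMeasure g q A ι₁).map φ = Kinetic.inducedMeasure g q A ι₂ :=
    Kinetic.map_formMeasure φ fun s w => congrArg abs (hform s w).symm
  -- Local finiteness makes continuous functions of compact support integrable; on the first section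
  -- integrability is inherited through `hmap`.
  have hfin : IsLocallyFiniteMeasure (Kinetic.inducedMeasure g q A ι₂) := by
    rw [Kinetic.inducedMeasure_eq]
    exact hι₂.isLocallyFiniteMeasure hH hdim hX
  refine ⟨φ, hφ, fun f hf hfc => ?_⟩
  have hfi : Integrable f (Kinetic.inducedMeasure g q A ι₂) :=
    hf.continuous.integrable_of_hasCompactSupport hfc
  have hφm : AEMeasurable φ (Kinetic.inducedMeasure g q A ι₁) := φ.continuous.measurable.aemeasurable
  refine ⟨hfi, ?_, ?_⟩
  · rw [← hmap] at hfi
    exact hfi.comp_aemeasurable hφm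
  · rw [← hmap] at hfi ⊢
    exact integral_map hφm hfi.aestronglyMeasurable
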